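/- Let $M$ be a smooth finite-dimensional (Hausdorff) manifold and $(E,[\cdot,\cdot]_E,\sigma)$ a Lie algebroid of finite rank over $M$: a smooth vector bundle $\pi:E\to M$ with an anchor $\sigma:E\to TM$ and a real Lie bracket on $\Gamma(E)$ such that $\sigma[s,t]_E=[\sigma(s),\sigma(t)]$ and $[s,ft]_E=f[s,t]_E+(\sigma(s)f)\,t$. Let $\tau:E^*\to M$ be the dual bundle and let $\mathcal TE^*\to E^*$ be the prolongation of $E$ over $\tau$, with fibres $$\mathcal T_{u}E^*=\{(a,v)\in E_{\tau(u)}\times T_{u}E^*\mid \sigma(a)=T_{u}\tau(v)\},$$ anchor $\sigma^1(a,v)=v$, vertical subbundle $V\mathcal TE^*=\{(0,v)\}$, and the Lie algebroid bracket $[\cdot,\cdot]$ determined by the Leibniz rule and by $[(X_1\circ\tau,U_1),(X_2\circ\tau,U_2)]=([X_1,X_2]_E\circ\tau,[U_1,U_2])$ for $X_i\in\Gamma(E)$ and vector fields $U_i$ on $E^*$ with $T\tau\, U_i=\sigma(X_i)\circ\tau$. Sections of $\mathcal TE^*$ act on functions on $E^*$ through $\sigma^1$, and $d^E$ denotes the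 exterior differential of the Lie algebroid $\mathcal TE^*$. Let $\theta_E(u)(a,v)=u(a)$ be the Liouville section and $\omega_E=-d^E\theta_E$ the canonical symplectic section. Let $W\subseteq E^*$ be open (for instance $W=E^*$, or $E^*$ without the zero section) and let $\mathcal H:W\to\mathbb R$ be smooth and regular, that is, the fibre Hessian $g^{\alpha\beta}=\partial^2\mathcal H/\partial\mu_\alpha\partial\mu_\beta$, where $\mu_\alpha$ are linear fibre coordinates, is nondegenerate at every point of $W$. Let $g$ be the pseudo-Riemannian metric on $V\mathcal TE^*$ over $W$ with $g\big((0,\partial/\partial\mu_\alpha),(0,\partial/\partial\mu_\beta)\big)=g^{\alpha\beta}$. All sections below are smooth sections over $W$. Then there is a section $\rho_{\mathcal H}$ of $\mathcal TE^*$ over $W$ (the Hamilton section) with $i_{\rho_{\mathcal H}}\omega_E=d^E\mathcal H$, and there is a smooth endomorphism field $\mathcal J_{\mathcal H}$ of $\mathcal TE^*$ over $W$ with $\operatorname{Im}\mathcal J_{\mathcal H}=\ker\mathcal J_{\mathcal H}=V\mathcal TE^*$, $\omega_E(\mathcal J_{\mathcal H}\rho,\nu)=\omega_E(\mathcal J_{\mathcal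 H}\nu,\rho)$ and $g(\mathcal J_{\mathcal H}\rho,\mathcal J_{\mathcal H}\nu)=-\omega_E(\mathcal J_{\mathcal H}\rho,\nu)$ for all sections $\rho,\nu$. For any such $\rho_{\mathcal H}$ and $\mathcal J_{\mathcal H}$, the formula $\mathcal N=-\mathcal L_{\rho_{\mathcal H}}\mathcal J_{\mathcal H}$, that is, $\mathcal N\nu=-[\rho_{\mathcal H},\mathcal J_{\mathcal H}\nu]+\mathcal J_{\mathcal H}[\rho_{\mathcal H},\nu]$, defines a nonlinear connection (the canonical nonlinear connection induced by $\mathcal H$): a smooth endomorphism field of $\mathcal TE^*$ over $W$ with $\mathcal N^2=\mathrm{Id}$ and $\ker(\mathrm{Id}+\mathcal N)=V\mathcal TE^*$. This connection is metric: with $\mathrm h=\tfrac12(\mathrm{Id}+\mathcal N)$, $\mathrm v=\tfrac12(\mathrm{Id}-\mathcal N)$ and the dynamical covariant derivative $\nabla X=\mathrm h[\rho_{\mathcal H},\mathrm hX]+\mathrm v[\rho_{\mathcal H},\mathrm vX]$, one has $\nabla g=0$, i.e. $$\rho_{\mathcal H}\big(g(X,Y)\big)=g(\nabla X,Y)+g(X,\nabla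 Y)$$ for all vertical sections $X,Y$ of $\mathcal TE^*$ over $W$. -/

import Mathlib

open Bundle Set
open scoped Manifold ContDiff

noncomputable section

namespace LieAlgd

universe uB uF uM uE

section Definitions

variable (EB : Type uB) [NormedAddCommGroup EB] [NormedSpace ℝ EB]
  (F : Type uF) [NormedAddCommGroup F] [NormedSpace ℝ F]
  {M : Type uM} [TopologicalSpace M] [ChartedSpace EB M]
  [IsManifold 𝓘(ℝ, EB) ∞ M]
  (E : M → Type uE) [TopologicalSpace (TotalSpace F E)]
  [∀ x, AddCommGroup (E x)] [∀ x, Module ℝ (E x)] [∀ x, TopologicalSpace (E x)]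
  [∀ x, IsTopologicalAddGroup (E x)] [∀ x, ContinuousSMul ℝ (E x)]
  [FiberBundle F E] [VectorBundle ℝ F E] [ContMDiffVectorBundle ∞ F E 𝓘(ℝ, EB)]

/-- Global smooth sections of the vector bundle `E → M` with typical fibre `F`. -/
abbrev SmoothSec : Type _ := ContMDiffSection 𝓘(ℝ, EB) F ∞ E

variable {EB} in
/-- The derivative at `x` of a function on `M` along a tangent vector. -/
def dirDeriv (f : M → ℝ) (x : M) (w : TangentSpace 𝓘(ℝ, EB) x) : ℝ :=
  mfderiv 𝓘(ℝ, EB) 𝓘(ℝ, ℝ) f x w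

/-- A Lie algebroid structure on the smooth vector bundle `E → M`: a smooth bundle map
`anchor : E → TM` and a real Lie bracket on the global smooth sections of `E`, such that the anchor
induces a homomorphism into the Lie algebra of vector fields and the Leibniz rule holds. -/
structure LieAlgebroid where
  anchor : ∀ x : M, E x →L[ℝ] TangentSpace 𝓘(ℝ, EB) x
  anchor_smooth : ∀ s : SmoothSec EB F E,
    ContMDiff 𝓘(ℝ, EB) 𝓘(ℝ, EB).tangent ∞
      (fun x => (⟨x, anchor x (s x)⟩ : TangentBundle 𝓘(ℝ, EB) M))
  bracket : SmoothSec EB F E → SmoothSec EB F E → SmoothSec EB F E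
  bracket_add_left : ∀ s₁ s₂ t, bracket (s₁ + s₂) t = bracket s₁ t + bracket s₂ t
  bracket_smul_left : ∀ (c : ℝ) s t, bracket (c • s) t = c • bracket s t
  bracket_skew : ∀ s t, bracket s t = -bracket t s
  bracket_jacobi : ∀ s₁ s₂ s₃,
    bracket s₁ (bracket s₂ s₃) + bracket s₂ (bracket s₃ s₁) + bracket s₃ (bracket s₁ s₂) = 0
  anchor_bracket : ∀ (s t : SmoothSec EB F E) (x : M),
    anchor x (bracket s t x) =
      VectorField.mlieBracket 𝓘(ℝ, EB) (fun y => anchor y (s y)) (fun y => anchor y (t y)) x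
  leibniz : ∀ (f : M → ℝ), ContMDiff 𝓘(ℝ, EB) 𝓘(ℝ, ℝ) ∞ f →
    ∀ s t ft : SmoothSec EB F E, (∀ x, ft x = f x • t x) →
    ∀ x, bracket s ft x =
      f x • bracket s t x + dirDeriv f x (anchor x (s x)) • t x

/-- The total space `E*` of the dual bundle; a point is `u = (x, μ)` with `x = u.proj` in `M` and
`μ = u.snd` a linear form on `E x`. -/
abbrev Dual : Type _ :=
  TotalSpace (F →L[ℝ] ℝ) (fun x : M => E x →L[ℝ] Bundle.Trivial M ℝ x)

/-- The model with corners of `E*` as a manifold. -/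
abbrev dualModel : ModelWithCorners ℝ (EB × (F →L[ℝ] ℝ)) (ModelProd EB (F →L[ℝ] ℝ)) :=
  𝓘(ℝ, EB).prod 𝓘(ℝ, F →L[ℝ] ℝ)

variable {EB F E}

/-- The differential at `u` of the projection `τ : E* → M`. -/
def dProj (u : Dual F E) :
    TangentSpace (dualModel EB F) u →L[ℝ] TangentSpace 𝓘(ℝ, EB) u.proj :=
  mfderiv (dualModel EB F) 𝓘(ℝ, EB) (fun w : Dual F E => w.proj) u

/-- The fibre at `u` of the prolongation `𝒯E*` of the Lie algebroid over `τ : E* → M`: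
pairs `(a, v)` in `E_x × T_u E*` with `σ(a) = T_u τ (v)`. -/
def Prolong (A : LieAlgebroid EB F E) (u : Dual F E) :
    Submodule ℝ (E u.proj × TangentSpace (dualModel EB F) u) where
  carrier := {p | A.anchor u.proj p.1 = dProj u p.2}
  zero_mem' :=
    ((A.anchor u.proj).map_zero).trans (dProj u).map_zero.symm
  add_mem' := fun {p q} hp hq =>
    ((A.anchor u.proj).map_add p.1 q.1).trans
      ((congrArg₂ (· + ·) hp hq).trans ((dProj u).map_add p.2 q.2).symm)
  smul_mem' := fun c p hp =>
    ((A.anchor u.proj).map_smul c p.1).trans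
      ((congrArg (c • ·) hp).trans ((dProj u).map_smul c p.2).symm)

/-- Not necessarily smooth sections of `𝒯E* → E*`. -/
abbrev PSec (A : LieAlgebroid EB F E) : Type _ := ∀ u : Dual F E, Prolong A u

/-- Fields of linear endomorphisms of the fibres of `𝒯E*`, not necessarily smooth. -/
abbrev PEnd (A : LieAlgebroid EB F E) : Type _ := ∀ u : Dual F E, Prolong A u →ₗ[ℝ] Prolong A u

variable {A : LieAlgebroid EB F E}

/-- The `E`-component of an element of the fibre of `𝒯E*`. -/
def PSec.base (ρ : PSec A) (u : Dual F E) : E u.proj := (ρ u).1.1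

/-- The vector field on `E*` associated with a section of `𝒯E*`, i.e. its image by the anchor
`σ¹(a, v) = v` of `𝒯E*`. -/
def PSec.field (ρ : PSec A) (u : Dual F E) : TangentSpace (dualModel EB F) u := (ρ u).1.2

/-- `ρ` is a smooth section of `𝒯E*` over `W`. -/
def PSec.SmoothOn (ρ : PSec A) (W : Set (Dual F E)) : Prop :=
  ContMDiffOn (dualModel EB F) (𝓘(ℝ, EB).prod 𝓘(ℝ, F)) ∞
      (fun u => (⟨u.proj, ρ.base u⟩ : TotalSpace F E)) W ∧
    ContMDiffOn (dualModel EB F) (dualModel EB F).tangent ∞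
      (fun u => (⟨u, ρ.field u⟩ : TangentBundle (dualModel EB F) (Dual F E))) W

/-- The derivative of a function `f` on `E*` along a section `ρ` of `𝒯E*`, i.e. `σ¹(ρ) f`. -/
def PSec.act (ρ : PSec A) (f : Dual F E → ℝ) (u : Dual F E) : ℝ :=
  mfderiv (dualModel EB F) 𝓘(ℝ, ℝ) f u (ρ.field u)

/-- The image of a section by a field of endomorphisms. -/
def PEnd.app (T : PEnd A) (ρ : PSec A) : PSec A := fun u => T u (ρ u)

/-- The field of endomorphisms `T` is smooth over `W`: it maps smooth sections to smooth ones. -/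
def PEnd.SmoothOn (T : PEnd A) (W : Set (Dual F E)) : Prop :=
  ∀ ρ : PSec A, ρ.SmoothOn W → (T.app ρ).SmoothOn W

variable (EB) in
/-- A global smooth section of `E` with value `a` at `x`. -/
def secThrough
    (x : M) (a : E x) : SmoothSec EB F E :=
  Classical.epsilon (fun s : SmoothSec EB F E => s x = a)

/-- For `Z` a section of `E` along `τ : E* → M`: derivative at `u` in the direction `w` of the
components of `Z` in the preferred trivialization of `E` at `τ u`. -/
def coordDeriv (Z : ∀ u : Dual F E, E u.proj) (u : Dual F E)
    (w : TangentSpace (dualModel EB F) u) : F :=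
  mfderiv (dualModel EB F) 𝓘(ℝ, F)
    (fun u' : Dual F E => (trivializationAt F E u.proj ⟨u'.proj, Z u'⟩).2) u w

/-- The `E`-component of the bracket of `ρ₁ = (X₁, U₁)` and `ρ₂ = (X₂, U₂)`. With sections `s`, `t`
of `E` such that `s(x) = X₁(u)` and `t(x) = X₂(u)`, where `x = τ u`, it is
`[s, t](x) + U₁ (X₂ - t ∘ τ) (u) - U₂ (X₁ - s ∘ τ) (u)`; the derivatives make sense in `E x`, since
`X₂ - t ∘ τ` and `X₁ - s ∘ τ` vanish at `u`. In a local frame `s_α` it is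
`(L^γ_{αβ} X₁^α X₂^β + U₁ (X₂^γ) - U₂ (X₁^γ)) s_γ`, whatever `s` and `t` are; it equals
`[s, t](x)` when `X₁ = s ∘ τ` and `X₂ = t ∘ τ`. -/
def bracketBase (ρ₁ ρ₂ : PSec A) (u : Dual F E) : E u.proj :=
  let s := secThrough (F := F) EB u.proj (ρ₁.base u)
  let t := secThrough (F := F) EB u.proj (ρ₂.base u)
  A.bracket s t u.proj +
    (trivializationAt F E u.proj).symm u.proj
      ((coordDeriv ρ₂.base u (ρ₁.field u) -
          coordDeriv (fun u' => t u'.proj) u (ρ₁.field u)) -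
        (coordDeriv ρ₁.base u (ρ₂.field u) -
          coordDeriv (fun u' => s u'.proj) u (ρ₂.field u)))

open Classical in
/-- The Lie algebroid bracket of `𝒯E*`: the unique one that satisfies the Leibniz rule
with respect to the anchor `σ¹` and equals `([X₁, X₂] ∘ τ, [U₁, U₂])` on projectable sections
`(X₁ ∘ τ, U₁)`, `(X₂ ∘ τ, U₂)`. (For smooth sections the pair below always lies in the fibre
of `𝒯E*`, because the anchor of `E` preserves brackets.) -/
def pbracket (ρ₁ ρ₂ : PSec A) : PSec A := fun u =>
  if h : (bracketBase ρ₁ ρ₂ u,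
      VectorField.mlieBracket (dualModel EB F) ρ₁.field ρ₂.field u) ∈ Prolong A u
  then ⟨_, h⟩ else 0

/-- The vertical subspace of the fibre of `𝒯E*`: the kernel of `(a, v) ↦ a`. -/
def vertical (A : LieAlgebroid EB F E) (u : Dual F E) : Submodule ℝ (Prolong A u) :=
  LinearMap.ker ((LinearMap.fst ℝ (E u.proj) (TangentSpace (dualModel EB F) u)).comp
    (Prolong A u).subtype)

/-- The Liouville section `θ(u)(a, v) = u(a)`, applied to a section. -/
def liouville (ρ : PSec A) (u : Dual F E) : ℝ := u.snd (ρ.base u)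

/-- The canonical symplectic section `ω = - dθ`, applied to two sections; `d` is the exterior
differential of the Lie algebroid `𝒯E*`. -/
def symplectic (ρ₁ ρ₂ : PSec A) (u : Dual F E) : ℝ :=
  -(ρ₁.act (liouville ρ₂) u - ρ₂.act (liouville ρ₁) u - liouville (pbracket ρ₁ ρ₂) u)

/-- The fibre Hessian of `H` at `u = (x, μ)`: the second derivative of `H` restricted to the vector
space `E*_x`, at `μ`, in the directions `ξ` and `η`. Its matrix in a frame is
`g^{αβ} = ∂²H / ∂μ_α ∂μ_β`. -/
def fibreHess (H : Dual F E → ℝ) (u : Dual F E) (ξ η : E u.proj →L[ℝ] ℝ) : ℝ :=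
  deriv (fun a : ℝ => deriv (fun b : ℝ => H ⟨u.proj, u.snd + a • ξ + b • η⟩) 0) 0

/-- `H` is regular over `W`: the fibre Hessian is nondegenerate at all points of `W`. -/
def RegularOn (H : Dual F E → ℝ) (W : Set (Dual F E)) : Prop :=
  ∀ u ∈ W, ∀ ξ : E u.proj →L[ℝ] ℝ,
    (∀ η : E u.proj →L[ℝ] ℝ, fibreHess H u ξ η = 0) → ξ = 0

variable (EB) in
/-- The canonical isomorphism from the vector space `E*_x` to the vertical tangent vectors at
`u = (x, μ)`: the velocity at `0` of the curve `r ↦ (x, μ + r ξ)`. -/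
def vertLift
    (u : Dual F E) (ξ : E u.proj →L[ℝ] ℝ) :
    TangentSpace (dualModel EB F) u :=
  (mfderiv 𝓘(ℝ, ℝ) (dualModel EB F)
    (fun r : ℝ => (⟨u.proj, u.snd + r • ξ⟩ : Dual F E)) 0 (1 : ℝ) :)

/-- The metric `g` on the vertical bundle of `𝒯E*` given by the fibre Hessian of `H`. Only its
values on vertical vectors `(0, ξ^v)`, `(0, η^v)` are meaningful: there it is the
fibre Hessian in the directions `ξ`, `η`. -/
def vmetric (H : Dual F E → ℝ) (ρ₁ ρ₂ : PSec A) (u : Dual F E) : ℝ :=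
  fibreHess H u (Function.invFun (vertLift EB u) (ρ₁.field u))
    (Function.invFun (vertLift EB u) (ρ₂.field u))

/-- `ρ` is the Hamilton section of `H` over `W`: `i_ρ ω = dH`. -/
def IsHamiltonSection (H : Dual F E → ℝ) (W : Set (Dual F E)) (ρ : PSec A) : Prop :=
  ρ.SmoothOn W ∧ ∀ ν : PSec A, ν.SmoothOn W → ∀ u ∈ W, symplectic ρ ν u = ν.act H u

/-- `J` is the adapted almost tangent structure over `W` induced by the metric of `H`: a
smooth field of endomorphisms whose kernel and image are the vertical subbundle, symmetric with
respect to `ω`, with `g (J ρ, J ν) = - ω (J ρ, ν)`. -/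
structure IsInducedTangentStructure (H : Dual F E → ℝ) (W : Set (Dual F E)) (J : PEnd A) :
    Prop where
  smooth : J.SmoothOn W
  ker_eq : ∀ u ∈ W, LinearMap.ker (J u) = vertical A u
  range_eq : ∀ u ∈ W, LinearMap.range (J u) = vertical A u
  symm : ∀ ρ ν : PSec A, ρ.SmoothOn W → ν.SmoothOn W → ∀ u ∈ W,
    symplectic (J.app ρ) ν u = symplectic (J.app ν) ρ u
  metric : ∀ ρ ν : PSec A, ρ.SmoothOn W → ν.SmoothOn W → ∀ u ∈ W,
    vmetric H (J.app ρ) (J.app ν) u = -symplectic (J.app ρ) ν u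

/-- The Lie derivative `(L_ρ J) ν = [ρ, J ν] - J [ρ, ν]`. -/
def lieDerivEnd (ρ : PSec A) (J : PEnd A) (ν : PSec A) : PSec A :=
  pbracket ρ (J.app ν) - J.app (pbracket ρ ν)

/-- `N` is a nonlinear (Ehresmann) connection over `W`: a smooth almost product structure
on `𝒯E*` with the vertical subbundle as its `-1`-eigenbundle. -/
structure IsNonlinearConnection (W : Set (Dual F E)) (N : PEnd A) : Prop where
  smooth : N.SmoothOn W
  sq : ∀ u ∈ W, N u ∘ₗ N u = LinearMap.id
  ker_eq : ∀ u ∈ W, LinearMap.ker (LinearMap.id + N u) = vertical A u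

/-- The horizontal projector of `N`. -/
def hproj (N : PEnd A) : PEnd A := fun u => (1 / 2 : ℝ) • (LinearMap.id + N u)

/-- The vertical projector of `N`. -/
def vproj (N : PEnd A) : PEnd A := fun u => (1 / 2 : ℝ) • (LinearMap.id - N u)

/-- The dynamical covariant derivative `∇_ρ X = h [ρ, h X] + v [ρ, v X]` of a section. -/
def dynCov (ρ : PSec A) (N : PEnd A) (X : PSec A) : PSec A :=
  (hproj N).app (pbracket ρ ((hproj N).app X)) + (vproj N).app (pbracket ρ ((vproj N).app X))

/-- The dynamical covariant derivative of the metric of `H`: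
`(∇_ρ g)(X, Y) = ρ (g (X, Y)) - g (∇_ρ X, Y) - g (X, ∇_ρ Y)`. -/
def dynCovMetric (H : Dual F E → ℝ) (ρ : PSec A) (N : PEnd A) (X Y : PSec A) (u : Dual F E) : ℝ :=
  ρ.act (vmetric H X Y) u - vmetric H (dynCov ρ N X) Y u - vmetric H X (dynCov ρ N Y) u

/-- A section is vertical over `W`. -/
def PSec.VerticalOn (X : PSec A) (W : Set (Dual F E)) : Prop := ∀ u ∈ W, X u ∈ vertical A u

end Definitions

end LieAlgd

end

/-! Over a trivializing chart of `M`, an element `(a, v)` of the prolongation has coordinates `(X,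
P)`: `X` is the component vector of `a`, and `P` is the derivative along `v` of the fibre momentum
`μ`. The rest of `v` is forced by `σ(a) = Tτ(v)` (`prolong_ext`). With the structure functions `C`
of the frame, a bracket has coordinates `X = C(X₁, X₂) + ρ₁X₂ - ρ₂X₁` and `P = ρ₁P₂ - ρ₂P₁`
(`X_pbracket`, `P_pbracket`), and `ω(ρ₁, ρ₂) = P₂(X₁) - P₁(X₂) + μ(C(X₁, X₂))` (`symplectic_eq`). So
`ω` is tensorial and nondegenerate, and the Hamilton section is the unique solution `X = ∂H/∂μ`, `P
= μ(C(X, ·)) - ∂H`, where `∂H` is the derivative along the frame. The conditions on `J` amount to `J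
p` being vertical with `Hess(P(J p), b) = b(X(p))`, which the regularity of `H` makes solvable.

Connection. Since `X(ρ) = ∂H/∂μ`, its derivative along a vertical `V` is `Hess(P(V), ·)`, so `[ρ,
Jν]` has the same `E`-component as `-ν`. Differentiating `Hess(P(Jν), ·) = X(ν)` along `ρ` shows
that all derivatives of `ν` drop out of `L_ρ J`, which is therefore a tensor. `N = -L_ρ J` preserves
the `E`-component and is `-Id` on vertical vectors. Hence `N p - p` is vertical, `N² = Id`, and the
kernel of `Id + N` is the vertical subbundle.

Metricity. From `dω = 0` and `i_ρ ω = dH` it follows that `ρ(ω(σ, τ)) = ω([ρ, σ], τ) + ω(σ, [ρ, τ])`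
(`act_symplectic`). For vertical `X` put `ν_X = -h[ρ, X]`; then `J ν_X = X` and `∇X = [ρ, X] + ν_X =
J[ρ, ν_X]` (`exists_horizontal_lift`). Hence `g(X, Y) = -ω(X, ν_Y)`, and expanding gives `(∇g)(X, Y)
= ω(ν_X, ν_Y)` (`dynCovMetric_eq`). The left side is symmetric in `X, Y` and the right side is skew,
so both vanish. -/

open Bundle Set VectorField
open scoped Manifold ContDiff Topology

set_option linter.unusedSectionVars false
set_option maxSynthPendingDepth 5

noncomputable section

namespace LieAlgd

universe uB uF uM uE

/-! ### Derivatives along vector fields, and the Lie bracket as a commutator. -/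

section Calculus

variable {EN : Type*} [NormedAddCommGroup EN] [NormedSpace ℝ EN]
  {HN : Type*} [TopologicalSpace HN] {I : ModelWithCorners ℝ EN HN}
  {N : Type*} [TopologicalSpace N] [ChartedSpace HN N]
  {G : Type*} [NormedAddCommGroup G] [NormedSpace ℝ G]
  {G' : Type*} [NormedAddCommGroup G'] [NormedSpace ℝ G']
  {G'' : Type*} [NormedAddCommGroup G''] [NormedSpace ℝ G'']

variable (I) in
/-- The derivative of a vector-valued function along a vector field. -/
def der (V : ∀ u : N, TangentSpace I u) (f : N → G) (u : N) : G :=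
  mfderiv I 𝓘(ℝ, G) f u (V u)

theorem der_congr {V V' : ∀ u : N, TangentSpace I u} {f f' : N → G} {u : N}
    (hV : V u = V' u) (hf : f =ᶠ[𝓝 u] f') : der I V f u = der I V' f' u := by
  unfold der
  rw [hV, hf.mfderiv_eq]
  rfl

theorem der_const (V : ∀ u : N, TangentSpace I u) (c : G) (u : N) :
    der I V (fun _ => c) u = 0 := by
  unfold der
  rw [mfderiv_const]
  rfl

theorem der_comp_fderiv {V : ∀ u : N, TangentSpace I u} {f : N → G} {u : N} {g : G → G'}
    (hg : DifferentiableAt ℝ g (f u)) (hf : MDifferentiableAt I 𝓘(ℝ, G) f u) :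
    der I V (fun y => g (f y)) u = fderiv ℝ g (f u) (der I V f u) := by
  unfold der
  have h := (hg.hasFDerivAt.hasMFDerivAt.comp u hf.hasMFDerivAt).mfderiv
  have h2 : (g ∘ f) = fun y => g (f y) := rfl
  rw [h2] at h
  rw [h]
  rfl

theorem der_clm {V : ∀ u : N, TangentSpace I u} {f : N → G} {u : N} (L : G →L[ℝ] G')
    (hf : MDifferentiableAt I 𝓘(ℝ, G) f u) :
    der I V (fun y => L (f y)) u = L (der I V f u) := by
  rw [der_comp_fderiv L.differentiableAt hf, L.fderiv]

theorem hasMFDerivAt_pair {f : N → G} {g : N → G'} {u : N}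
    (hf : MDifferentiableAt I 𝓘(ℝ, G) f u) (hg : MDifferentiableAt I 𝓘(ℝ, G') g u) :
    HasMFDerivAt I 𝓘(ℝ, G × G') (fun y => (f y, g y)) u
      ((mfderiv I 𝓘(ℝ, G) f u : EN →L[ℝ] G).prod (mfderiv I 𝓘(ℝ, G') g u : EN →L[ℝ] G')) :=
  ⟨hf.continuousAt.prodMk hg.continuousAt, hf.hasMFDerivAt.2.prodMk hg.hasMFDerivAt.2⟩

theorem der_prodMk {V : ∀ u : N, TangentSpace I u} {f : N → G} {g : N → G'} {u : N}
    (hf : MDifferentiableAt I 𝓘(ℝ, G) f u) (hg : MDifferentiableAt I 𝓘(ℝ, G') g u) :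
    der I V (fun y => (f y, g y)) u = (der I V f u, der I V g u) := by
  unfold der
  rw [(hasMFDerivAt_pair hf hg).mfderiv]
  rfl

theorem der_bilin {V : ∀ u : N, TangentSpace I u} {f : N → G} {g : N → G'} {u : N}
    (B : G →L[ℝ] G' →L[ℝ] G'')
    (hf : MDifferentiableAt I 𝓘(ℝ, G) f u) (hg : MDifferentiableAt I 𝓘(ℝ, G') g u) :
    der I V (fun y => B (f y) (g y)) u = B (der I V f u) (g u) + B (f u) (der I V g u) := by
  have h := der_comp_fderiv (V := V) (g := fun p : G × G' => B p.1 p.2)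
    (B.isBoundedBilinearMap.differentiableAt (f u, g u)) (hf.prodMk_space hg)
  rw [der_prodMk hf hg] at h
  rw [h]
  have h3 := B.isBoundedBilinearMap.fderiv (f u, g u)
  erw [h3]
  simp [add_comm]

theorem der_clm_apply {V : ∀ u : N, TangentSpace I u} {f : N → G →L[ℝ] G'} {g : N → G} {u : N}
    (hf : MDifferentiableAt I 𝓘(ℝ, G →L[ℝ] G') f u) (hg : MDifferentiableAt I 𝓘(ℝ, G) g u) :
    der I V (fun y => f y (g y)) u = der I V f u (g u) + f u (der I V g u) :=
  der_bilin (ContinuousLinearMap.id ℝ (G →L[ℝ] G')) hf hg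

theorem mdiff_clm_comp {f : N → G} {u : N} (L : G →L[ℝ] G')
    (hf : MDifferentiableAt I 𝓘(ℝ, G) f u) : MDifferentiableAt I 𝓘(ℝ, G') (fun y => L (f y)) u :=
  L.differentiableAt.mdifferentiableAt.comp u hf

theorem mdiff_apply_const {f : N → G →L[ℝ] G'} {u : N} (v : G)
    (hf : MDifferentiableAt I 𝓘(ℝ, G →L[ℝ] G') f u) :
    MDifferentiableAt I 𝓘(ℝ, G') (fun y => f y v) u :=
  mdiff_clm_comp (ContinuousLinearMap.apply ℝ G' v) hf

theorem der_apply_const {V : ∀ u : N, TangentSpace I u} {f : N → G →L[ℝ] G'} {u : N} (v : G)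
    (hf : MDifferentiableAt I 𝓘(ℝ, G →L[ℝ] G') f u) :
    der I V (fun y => f y v) u = der I V f u v :=
  der_clm (ContinuousLinearMap.apply ℝ G' v) hf

theorem der_add {V : ∀ u : N, TangentSpace I u} {f g : N → G} {u : N}
    (hf : MDifferentiableAt I 𝓘(ℝ, G) f u) (hg : MDifferentiableAt I 𝓘(ℝ, G) g u) :
    der I V (fun y => f y + g y) u = der I V f u + der I V g u := by
  have h := der_clm (V := V) (ContinuousLinearMap.fst ℝ G G + ContinuousLinearMap.snd ℝ G G)
    (hf.prodMk_space hg)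
  rw [der_prodMk hf hg] at h
  exact h

theorem der_sub {V : ∀ u : N, TangentSpace I u} {f g : N → G} {u : N}
    (hf : MDifferentiableAt I 𝓘(ℝ, G) f u) (hg : MDifferentiableAt I 𝓘(ℝ, G) g u) :
    der I V (fun y => f y - g y) u = der I V f u - der I V g u := by
  have h := der_clm (V := V) (ContinuousLinearMap.fst ℝ G G - ContinuousLinearMap.snd ℝ G G)
    (hf.prodMk_space hg)
  rw [der_prodMk hf hg] at h
  exact h

theorem der_neg {V : ∀ u : N, TangentSpace I u} {f : N → G} {u : N}
    (hf : MDifferentiableAt I 𝓘(ℝ, G) f u) :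
    der I V (fun y => -f y) u = -der I V f u :=
  der_clm (V := V) (-ContinuousLinearMap.id ℝ G) hf

theorem der_vec_add (V V' V'' : ∀ u : N, TangentSpace I u) {f : N → G} {u : N}
    (h : V u = V' u + V'' u) : der I V f u = der I V' f u + der I V'' f u := by
  unfold der
  rw [h]
  exact (mfderiv I 𝓘(ℝ, G) f u).map_add _ _

/-- The tangent map of `f` composed with the section `V` is smooth into `TG = G × G`, and the
derivative is its second component. -/
theorem contMDiffOn_der [IsManifold I ∞ N] {W : Set N} (hW : IsOpen W)
    {V : ∀ u : N, TangentSpace I u} {f : N → G}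
    (hV : ContMDiffOn I I.tangent ∞ (fun u => (⟨u, V u⟩ : TangentBundle I N)) W)
    (hf : ContMDiffOn I 𝓘(ℝ, G) ∞ f W) : ContMDiffOn I 𝓘(ℝ, G) ∞ (der I V f) W := by
  have h1 := hf.contMDiffOn_tangentMapWithin (m := ∞) (n := ∞) le_rfl hW.uniqueMDiffOn
  have h2 : ContMDiffOn I 𝓘(ℝ, G).tangent ∞
      (fun u => tangentMapWithin I 𝓘(ℝ, G) f W ⟨u, V u⟩) W :=
    h1.comp hV (fun u hu => hu)
  have h3 : ContMDiffOn I 𝓘(ℝ, G) ∞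
      (fun u => (tangentMapWithin I 𝓘(ℝ, G) f W ⟨u, V u⟩).2) W :=
    (contMDiff_snd_tangentBundle_modelSpace G 𝓘(ℝ, G)).comp_contMDiffOn h2
  refine h3.congr fun u hu => ?_
  simp only [der, tangentMapWithin]
  rw [mfderivWithin_of_isOpen hW hu]

theorem contMDiff_toMDiff {W : Set N} (hW : IsOpen W) {f : N → G}
    (hf : ContMDiffOn I 𝓘(ℝ, G) ∞ f W) {u : N} (hu : u ∈ W) : MDifferentiableAt I 𝓘(ℝ, G) f u :=
  ((hf u hu).contMDiffAt (hW.mem_nhds hu)).mdifferentiableAt (by simp)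

variable [IsManifold I ∞ N] [I.Boundaryless]

theorem der_eq_fderiv_chart {u₀ u : N} (hu : u ∈ (extChartAt I u₀).source)
    (V : ∀ u : N, TangentSpace I u) {f : N → G} (hf : MDifferentiableAt I 𝓘(ℝ, G) f u) :
    der I V f u = fderiv ℝ (f ∘ (extChartAt I u₀).symm) (extChartAt I u₀ u)
      (der I V (extChartAt I u₀) u) := by
  have hu' : u ∈ (chartAt HN u₀).source := by rwa [← extChartAt_source (I := I)]
  have h1 : MDifferentiableAt I 𝓘(ℝ, EN) (extChartAt I u₀) u := mdifferentiableAt_extChartAt hu'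
  have h2 : MDifferentiableAt 𝓘(ℝ, EN) 𝓘(ℝ, G) (f ∘ (extChartAt I u₀).symm)
      (extChartAt I u₀ u) := by
    have h3 := mdifferentiableWithinAt_extChartAt_symm (I := I) ((extChartAt I u₀).map_source hu)
    rw [I.range_eq_univ, mdifferentiableWithinAt_univ] at h3
    refine MDifferentiableAt.comp (I' := I) _ ?_ h3
    rwa [(extChartAt I u₀).left_inv hu]
  rw [← der_comp_fderiv h2.differentiableAt h1]
  refine der_congr rfl ?_
  filter_upwards [extChartAt_source_mem_nhds' hu] with y hy
  exact congrArg f ((extChartAt I u₀).left_inv hy).symm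

omit [I.Boundaryless] in
-- `mlieBracket` is defined by pulling fields back along the inverse chart, which involves the
-- inverse of the derivative of that map. This inverse is the derivative of the chart itself, so the
-- pulled-back field is `V` applied to the chart as a vector-valued function.
theorem mpullbackWithin_chart {u₀ u : N} (hu : u ∈ (extChartAt I u₀).source)
    (V : ∀ u : N, TangentSpace I u) :
    mpullbackWithin 𝓘(ℝ, EN) I (extChartAt I u₀).symm V (range I) (extChartAt I u₀ u) =
      der I V (extChartAt I u₀) u := by
  have h1 := mfderivWithin_extChartAt_symm_comp_mfderiv_extChartAt' hu
  have hinv := isInvertible_mfderivWithin_extChartAt_symm (I := I)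
    ((extChartAt I u₀).map_source hu)
  rw [mpullbackWithin_apply]
  have h2 := DFunLike.congr_fun h1 (V u)
  obtain ⟨e, he⟩ := hinv
  rw [← he] at h2 ⊢
  rw [ContinuousLinearMap.inverse_equiv]
  have h3 : e (mfderiv I 𝓘(ℝ, EN) (extChartAt I u₀) u (V u)) =
      V ((extChartAt I u₀).symm (extChartAt I u₀ u)) := by
    refine Eq.trans h2 ?_
    have : ∀ y, u = y → (V u : EN) = V y := by rintro y rfl; rfl
    exact this _ ((extChartAt I u₀).left_inv hu).symm
  rw [← h3]
  exact e.symm_apply_apply _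

variable (I) in
/-- The representation of a vector field in the preferred chart at a point. -/
def chartField (X : ∀ u : N, TangentSpace I u) (u : N) (z : EN) : EN :=
  der I X (extChartAt I u) ((extChartAt I u).symm z)

omit [IsManifold I ∞ N] [I.Boundaryless] in
theorem chartField_apply (X : ∀ u : N, TangentSpace I u) {u y : N}
    (hy : y ∈ (extChartAt I u).source) :
    chartField I X u (extChartAt I u y) = der I X (extChartAt I u) y := by
  rw [chartField, (extChartAt I u).left_inv hy]

theorem mpullbackWithin_eventuallyEq_chartField (X : ∀ u : N, TangentSpace I u) (u : N) :
    (mpullbackWithin 𝓘(ℝ, EN) I (extChartAt I u).symm X univ : EN → EN)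
      =ᶠ[𝓝 (extChartAt I u u)] chartField I X u := by
  filter_upwards [extChartAt_target_mem_nhds (I := I) u] with z hz
  have h := mpullbackWithin_chart ((extChartAt I u).map_target hz) X
  rw [(extChartAt I u).right_inv hz, I.range_eq_univ] at h
  exact h

theorem der_mlieBracket_chart (U V : ∀ u : N, TangentSpace I u) (u : N) :
    der I (mlieBracket I U V) (extChartAt I u) u =
      fderiv ℝ (chartField I V u) (extChartAt I u u) (chartField I U u (extChartAt I u u)) -
      fderiv ℝ (chartField I U u) (extChartAt I u u) (chartField I V u (extChartAt I u u)) := by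
  have hinv := isInvertible_mfderiv_extChartAt (I := I) (mem_extChartAt_source (I := I) u)
  have h1 := mpullbackWithin_eventuallyEq_chartField U u
  have h2 := mpullbackWithin_eventuallyEq_chartField V u
  have h3 : ∀ A B A' B' : EN → EN, A =ᶠ[𝓝 (extChartAt I u u)] A' →
      B =ᶠ[𝓝 (extChartAt I u u)] B' → lieBracketWithin ℝ A B univ (extChartAt I u u) =
        lieBracket ℝ A' B' (extChartAt I u u) := by
    intro A B A' B' hA hB
    rw [lieBracketWithin_univ]
    exact hA.lieBracket_vectorField_eq hB
  replace h3 := h3 _ _ _ _ h1 h2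
  rw [lieBracket_eq] at h3
  refine Eq.trans ?_ h3
  unfold der mlieBracket
  rw [mlieBracketWithin_apply]
  simp only [preimage_univ, univ_inter, I.range_eq_univ]
  obtain ⟨e, he⟩ := hinv
  rw [← he, ContinuousLinearMap.inverse_equiv]
  exact e.apply_symm_apply _

theorem der_eventuallyEq_chart {W : Set N} (hW : IsOpen W) {u : N} (hu : u ∈ W)
    (X : ∀ u : N, TangentSpace I u) {f : N → G} (hf : ContMDiffOn I 𝓘(ℝ, G) ∞ f W) :
    der I X f ∘ (extChartAt I u).symm =ᶠ[𝓝 (extChartAt I u u)] fun z =>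
      fderiv ℝ (f ∘ (extChartAt I u).symm) z (chartField I X u z) := by
  have h2 : Filter.Tendsto (extChartAt I u).symm (𝓝 (extChartAt I u u)) (𝓝 u) := by
    have := (continuousAt_extChartAt_symm (I := I) u).tendsto
    rwa [extChartAt_to_inv] at this
  filter_upwards [extChartAt_target_mem_nhds (I := I) u, h2.eventually (hW.mem_nhds hu)]
    with z hz hzW
  have h := der_eq_fderiv_chart ((extChartAt I u).map_target hz) X (contMDiff_toMDiff hW hf hzW)
  rw [(extChartAt I u).right_inv hz] at h
  exact h

theorem contDiffAt_chart {W : Set N} (hW : IsOpen W) {u : N} (hu : u ∈ W)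
    {f : N → G} (hf : ContMDiffOn I 𝓘(ℝ, G) ∞ f W) :
    ContDiffAt ℝ ∞ (f ∘ (extChartAt I u).symm) (extChartAt I u u) := by
  have h1 : ContMDiffAt 𝓘(ℝ, EN) I ∞ (extChartAt I u).symm (extChartAt I u u) := by
    have := contMDiffWithinAt_extChartAt_symm_range (I := I) (n := ∞) u
      (mem_extChartAt_target (I := I) u)
    rwa [I.range_eq_univ, contMDiffWithinAt_univ] at this
  have h2 : ContMDiffAt I 𝓘(ℝ, G) ∞ f ((extChartAt I u).symm (extChartAt I u u)) := by
    rw [extChartAt_to_inv]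
    exact (hf u hu).contMDiffAt (hW.mem_nhds hu)
  exact (h2.comp _ h1).contDiffAt

theorem differentiableAt_chartField {W : Set N} (hW : IsOpen W) {u : N} (hu : u ∈ W)
    {X : ∀ u : N, TangentSpace I u}
    (hX : ContMDiffOn I I.tangent ∞ (fun u => (⟨u, X u⟩ : TangentBundle I N)) W) :
    DifferentiableAt ℝ (chartField I X u) (extChartAt I u u) := by
  have hW' : IsOpen (W ∩ (chartAt HN u).source) := hW.inter (chartAt HN u).open_source
  have h1 : ContMDiffOn I 𝓘(ℝ, EN) ∞ (extChartAt I u) (W ∩ (chartAt HN u).source) :=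
    contMDiffOn_extChartAt.mono inter_subset_right
  exact (contDiffAt_chart hW' ⟨hu, mem_chart_source HN u⟩
    (contMDiffOn_der hW' (hX.mono inter_subset_left) h1)).differentiableAt (by simp)

theorem der_der_chart {W : Set N} (hW : IsOpen W) {X Y : ∀ u : N, TangentSpace I u} {f : N → G}
    (hY : ContMDiffOn I I.tangent ∞ (fun u => (⟨u, Y u⟩ : TangentBundle I N)) W)
    (hf : ContMDiffOn I 𝓘(ℝ, G) ∞ f W) {u : N} (hu : u ∈ W) :
    der I X (der I Y f) u =
      fderiv ℝ (fderiv ℝ (f ∘ (extChartAt I u).symm)) (extChartAt I u u)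
        (chartField I X u (extChartAt I u u)) (chartField I Y u (extChartAt I u u)) +
      fderiv ℝ (f ∘ (extChartAt I u).symm) (extChartAt I u u)
        (fderiv ℝ (chartField I Y u) (extChartAt I u u) (chartField I X u (extChartAt I u u))) := by
  have hus := mem_extChartAt_source (I := I) u
  have hd := contMDiff_toMDiff hW (contMDiffOn_der hW hY hf) hu
  have hf2 : DifferentiableAt ℝ (fderiv ℝ (f ∘ (extChartAt I u).symm)) (extChartAt I u u) :=
    ((contDiffAt_chart hW hu hf).fderiv_right (m := 1) (by norm_cast)).differentiableAt (by simp)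
  rw [der_eq_fderiv_chart hus X hd, ← chartField_apply X hus,
    (der_eventuallyEq_chart hW hu Y hf).fderiv_eq,
    fderiv_clm_apply hf2 (differentiableAt_chartField hW hu hY), add_comm]
  rfl

/-- In a chart, both iterated derivatives contain the second derivative of `f` on the pair of
fields; its symmetry cancels these terms and leaves `f'` applied to the bracket. All later
statements about brackets of vector fields on `M` and on `E*` go through this. -/
theorem der_mlieBracket {W : Set N} (hW : IsOpen W) {U V : ∀ u : N, TangentSpace I u} {f : N → G}
    (hU : ContMDiffOn I I.tangent ∞ (fun u => (⟨u, U u⟩ : TangentBundle I N)) W)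
    (hV : ContMDiffOn I I.tangent ∞ (fun u => (⟨u, V u⟩ : TangentBundle I N)) W)
    (hf : ContMDiffOn I 𝓘(ℝ, G) ∞ f W) {u : N} (hu : u ∈ W) :
    der I (mlieBracket I U V) f u = der I U (der I V f) u - der I V (der I U f) u := by
  have hs : IsSymmSndFDerivAt ℝ (f ∘ (extChartAt I u).symm) (extChartAt I u u) := by
    refine (contDiffAt_chart hW hu hf).isSymmSndFDerivAt ?_
    rw [minSmoothness_of_isRCLikeNormedField]
    norm_cast
  rw [der_der_chart hW hV hf hu, der_der_chart hW hU hf hu,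
    der_eq_fderiv_chart (mem_extChartAt_source (I := I) u) _ (contMDiff_toMDiff hW hf hu),
    der_mlieBracket_chart, hs _ (chartField I V u (extChartAt I u u)), map_sub]
  abel

end Calculus

/-- In finite dimension a linear map is the sum over a basis of (coordinate form) ⊗ (value on the
basis vector), so smoothness can be tested on vectors. -/
theorem contMDiffOn_clm_of_apply {EN : Type*} [NormedAddCommGroup EN] [NormedSpace ℝ EN]
    {HN : Type*} [TopologicalSpace HN] {I : ModelWithCorners ℝ EN HN}
    {N : Type*} [TopologicalSpace N] [ChartedSpace HN N]
    {F : Type*} [NormedAddCommGroup F] [NormedSpace ℝ F] [FiniteDimensional ℝ F]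
    {G : Type*} [NormedAddCommGroup G] [NormedSpace ℝ G] {f : N → F →L[ℝ] G} {W : Set N}
    (h : ∀ v, ContMDiffOn I 𝓘(ℝ, G) ∞ (fun y => f y v) W) :
    ContMDiffOn I 𝓘(ℝ, F →L[ℝ] G) ∞ f W := by
  set b := Module.finBasis ℝ F
  have h1 : ∀ y, f y = ∑ i, ContinuousLinearMap.smulRightL ℝ F G
      (LinearMap.toContinuousLinearMap (b.coord i)) (f y (b i)) := by
    intro y
    ext v
    conv_lhs => rw [← b.sum_repr v, map_sum]
    simp
  have h2 : ContMDiffOn I 𝓘(ℝ, F →L[ℝ] G) ∞ (fun y => ∑ i, ContinuousLinearMap.smulRightL ℝ F G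
      (LinearMap.toContinuousLinearMap (b.coord i)) (f y (b i))) W := by
    refine contMDiffOn_finsetSum fun i _ => ?_
    exact (ContinuousLinearMap.smulRightL ℝ F G
      (LinearMap.toContinuousLinearMap (b.coord i))).contMDiff.comp_contMDiffOn (h (b i))
  exact h2.congr fun y _ => h1 y

/-! ### The Lie algebroid in a local frame: locality, structure functions, anchor, Jacobi identity.
-/

section Base

variable {EB : Type uB} [NormedAddCommGroup EB] [NormedSpace ℝ EB]
  {F : Type uF} [NormedAddCommGroup F] [NormedSpace ℝ F]
  {M : Type uM} [TopologicalSpace M] [ChartedSpace EB M]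
  {E : M → Type uE} [TopologicalSpace (TotalSpace F E)]
  [∀ x, AddCommGroup (E x)] [∀ x, Module ℝ (E x)] [∀ x, TopologicalSpace (E x)]
  [FiberBundle F E] [VectorBundle ℝ F E]

variable (F E) in
/-- The components of an element of `E x` in the preferred trivialization at `x₀`. -/
def fibreCoord (x₀ x : M) : E x →L[ℝ] F := (trivializationAt F E x₀).continuousLinearMapAt ℝ x

variable (F E) in
/-- The element of `E x` with given components in the preferred trivialization at `x₀`. -/
def ofFibreCoord (x₀ x : M) : F →L[ℝ] E x := (trivializationAt F E x₀).symmL ℝ x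

theorem ofFibreCoord_fibreCoord {x₀ x : M} (hx : x ∈ (trivializationAt F E x₀).baseSet) (a : E x) :
    ofFibreCoord F E x₀ x (fibreCoord F E x₀ x a) = a :=
  (trivializationAt F E x₀).symmL_continuousLinearMapAt hx a

theorem fibreCoord_ofFibreCoord {x₀ x : M} (hx : x ∈ (trivializationAt F E x₀).baseSet) (w : F) :
    fibreCoord F E x₀ x (ofFibreCoord F E x₀ x w) = w :=
  (trivializationAt F E x₀).continuousLinearMapAt_symmL hx w

theorem fibreCoord_eq {x₀ x : M} (hx : x ∈ (trivializationAt F E x₀).baseSet) (a : E x) :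
    fibreCoord F E x₀ x a = (trivializationAt F E x₀ ⟨x, a⟩).2 :=
  Trivialization.continuousLinearMapAt_apply_of_mem ℝ (trivializationAt F E x₀) hx a

theorem fibreCoord_injective {x₀ x : M} (hx : x ∈ (trivializationAt F E x₀).baseSet) :
    Function.Injective (fibreCoord F E x₀ x) :=
  Function.LeftInverse.injective (ofFibreCoord_fibreCoord hx)

variable [IsManifold 𝓘(ℝ, EB) ∞ M]
  [∀ x, IsTopologicalAddGroup (E x)] [∀ x, ContinuousSMul ℝ (E x)]
  [ContMDiffVectorBundle ∞ F E 𝓘(ℝ, EB)]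

omit [IsManifold 𝓘(ℝ, EB) ∞ M] [∀ x, IsTopologicalAddGroup (E x)]
  [∀ x, ContinuousSMul ℝ (E x)] in
theorem contMDiffOn_section_iff_fibreCoord {x₀ : M} {s : ∀ x, E x} {O : Set M} (hO : IsOpen O)
    (hs : O ⊆ (trivializationAt F E x₀).baseSet) :
    ContMDiffOn 𝓘(ℝ, EB) (𝓘(ℝ, EB).prod 𝓘(ℝ, F)) ∞ (fun x => TotalSpace.mk' F x (s x)) O ↔
      ContMDiffOn 𝓘(ℝ, EB) 𝓘(ℝ, F) ∞ (fun x => fibreCoord F E x₀ x (s x)) O := by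
  rw [(trivializationAt F E x₀).contMDiffOn_section_iff hO hs]
  exact contMDiffOn_congr fun x hx => (fibreCoord_eq (hs hx) _).symm

/-- The product of a section with a function. -/
def smulSec (f : M → ℝ) (hf : ContMDiff 𝓘(ℝ, EB) 𝓘(ℝ, ℝ) ∞ f) (s : SmoothSec EB F E) :
    SmoothSec EB F E :=
  ⟨fun x => f x • s x, hf.smul_section s.contMDiff⟩

theorem sum_sec_apply {ι : Type*} (S : Finset ι) (s : ι → SmoothSec EB F E) (x : M) :
    (∑ i ∈ S, s i) x = ∑ i ∈ S, s i x :=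
  map_sum (⟨⟨fun s => s x, rfl⟩, fun _ _ => rfl⟩ : SmoothSec EB F E →+ E x) s S

/-- The bracket of `E` is only given on global sections; cut-off functions let local frames and
local coefficients enter it. -/
theorem exists_cut [FiniteDimensional ℝ EB] [T2Space M] {x : M} {O : Set M} (hO : O ∈ 𝓝 x) :
    ∃ h : M → ℝ, ContMDiff 𝓘(ℝ, EB) 𝓘(ℝ, ℝ) ∞ h ∧ h =ᶠ[𝓝 x] 1 ∧ tsupport h ⊆ O := by
  obtain ⟨f, hf, -⟩ := (SmoothBumpFunction.nhds_basis_support (I := 𝓘(ℝ, EB)) hO).mem_iff.1 hO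
  exact ⟨f, f.contMDiff, f.eventuallyEq_one, hf⟩

namespace LieAlgebroid

variable (A : LieAlgebroid EB F E)

theorem bracket_add_right (s t₁ t₂ : SmoothSec EB F E) :
    A.bracket s (t₁ + t₂) = A.bracket s t₁ + A.bracket s t₂ := by
  rw [A.bracket_skew, A.bracket_add_left, neg_add, ← A.bracket_skew, ← A.bracket_skew]

theorem bracket_smul_right (c : ℝ) (s t : SmoothSec EB F E) :
    A.bracket s (c • t) = c • A.bracket s t := by
  rw [A.bracket_skew, A.bracket_smul_left, ← smul_neg, ← A.bracket_skew]

/-- The bracket with a fixed section as a linear map. -/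
def ad (s : SmoothSec EB F E) : SmoothSec EB F E →ₗ[ℝ] SmoothSec EB F E where
  toFun := A.bracket s
  map_add' := A.bracket_add_right s
  map_smul' c := A.bracket_smul_right c s

/-- Locality of the bracket: if `h` is `1` near `x` and supported where `t` vanishes, then `h t = 0`
globally, and the Leibniz rule at `x` leaves only `[s, t](x)` because `t(x) = 0`. -/
theorem bracket_eq_zero_of_eventually [FiniteDimensional ℝ EB] [T2Space M]
    (s : SmoothSec EB F E) {t : SmoothSec EB F E} {x : M} (ht : ∀ᶠ y in 𝓝 x, t y = 0) :
    A.bracket s t x = 0 := by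
  obtain ⟨h, hsm, hone, hsupp⟩ := exists_cut (EB := EB) ht
  have h1 := A.leibniz h hsm s t 0 (fun y => by
    by_cases hy : y ∈ tsupport h
    · have : t y = 0 := hsupp hy
      simp [this]
    · simp [image_eq_zero_of_notMem_tsupport hy]) x
  have h2 : A.bracket s 0 = 0 := (A.ad s).map_zero
  have h3 : t x = 0 := ht.self_of_nhds
  rw [h2, h3, hone.eq_of_nhds] at h1
  simpa using h1.symm

/-- The vector field on `M` that is the image of a section by the anchor. -/
def vf (s : SmoothSec EB F E) (x : M) : TangentSpace 𝓘(ℝ, EB) x := A.anchor x (s x)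

theorem vf_smooth (s : SmoothSec EB F E) (O : Set M) :
    ContMDiffOn 𝓘(ℝ, EB) 𝓘(ℝ, EB).tangent ∞
      (fun x => (⟨x, A.vf s x⟩ : TangentBundle 𝓘(ℝ, EB) M)) O :=
  (A.anchor_smooth s).contMDiffOn

end LieAlgebroid

variable (EB F E) in
/-- A cut-off function that is `1` near `x₀` and supported in the domain of the preferred
trivialization and chart at `x₀`. -/
structure LocalFrame (x₀ : M) where
  cut : M → ℝ
  cut_smooth : ContMDiff 𝓘(ℝ, EB) 𝓘(ℝ, ℝ) ∞ cut
  tsupport_cut : tsupport cut ⊆ (trivializationAt F E x₀).baseSet ∩ (chartAt EB x₀).source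
  dom : Set M
  isOpen_dom : IsOpen dom
  mem_dom : x₀ ∈ dom
  cut_one : ∀ x ∈ dom, cut x = 1

theorem exists_localFrame [FiniteDimensional ℝ EB] [T2Space M] (x₀ : M) :
    Nonempty (LocalFrame EB F E x₀) := by
  have hO : (trivializationAt F E x₀).baseSet ∩ (chartAt EB x₀).source ∈ 𝓝 x₀ :=
    Filter.inter_mem ((trivializationAt F E x₀).open_baseSet.mem_nhds
      (mem_baseSet_trivializationAt F E x₀)) (chart_source_mem_nhds EB x₀)
  obtain ⟨h, hsm, hone, hsupp⟩ := exists_cut (EB := EB) hO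
  obtain ⟨O, hO1, hO2, hO3⟩ := eventually_nhds_iff.1 hone
  exact ⟨⟨h, hsm, hsupp, O, hO2, hO3, hO1⟩⟩

namespace LocalFrame

variable {x₀ : M} (fr : LocalFrame EB F E x₀)

theorem mem_tsupport {x : M} (hx : x ∈ fr.dom) : x ∈ tsupport fr.cut :=
  subset_tsupport _ (by simp [fr.cut_one x hx])

theorem mem_baseSet {x : M} (hx : x ∈ fr.dom) : x ∈ (trivializationAt F E x₀).baseSet :=
  (fr.tsupport_cut (fr.mem_tsupport hx)).1

theorem mem_source {x : M} (hx : x ∈ fr.dom) : x ∈ (chartAt EB x₀).source :=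
  (fr.tsupport_cut (fr.mem_tsupport hx)).2

/-- The global section of `E` that has constant components on the domain of the frame. -/
def sec : F →ₗ[ℝ] SmoothSec EB F E where
  toFun w := ⟨fun x => fr.cut x • ofFibreCoord F E x₀ x w, by
    have h : ContMDiffOn 𝓘(ℝ, EB) (𝓘(ℝ, EB).prod 𝓘(ℝ, F)) ∞
        (fun x => TotalSpace.mk' F x (ofFibreCoord F E x₀ x w))
        (trivializationAt F E x₀).baseSet := by
      rw [contMDiffOn_section_iff_fibreCoord (trivializationAt F E x₀).open_baseSet subset_rfl]
      exact contMDiffOn_const.congr fun x hx => fibreCoord_ofFibreCoord hx w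
    exact ContMDiffOn.smul_section_of_tsupport fr.cut_smooth.contMDiffOn
      (trivializationAt F E x₀).open_baseSet (fun x hx => (fr.tsupport_cut hx).1) h⟩
  map_add' v w := by
    ext x
    change fr.cut x • ofFibreCoord F E x₀ x (v + w) =
      fr.cut x • ofFibreCoord F E x₀ x v + fr.cut x • ofFibreCoord F E x₀ x w
    rw [map_add, smul_add]
  map_smul' c w := by
    ext x
    change fr.cut x • ofFibreCoord F E x₀ x (c • w) = c • fr.cut x • ofFibreCoord F E x₀ x w
    rw [map_smul, smul_comm]

theorem sec_apply (w : F) (x : M) : fr.sec w x = fr.cut x • ofFibreCoord F E x₀ x w := rfl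

theorem fibreCoord_sec {x : M} (hx : x ∈ fr.dom) (w : F) :
    fibreCoord F E x₀ x (fr.sec w x) = w := by
  rw [sec_apply, fr.cut_one x hx, one_smul, fibreCoord_ofFibreCoord (fr.mem_baseSet hx)]

theorem sec_fibreCoord {x : M} (hx : x ∈ fr.dom) (a : E x) :
    fr.sec (fibreCoord F E x₀ x a) x = a := by
  rw [sec_apply, fr.cut_one x hx, one_smul, ofFibreCoord_fibreCoord (fr.mem_baseSet hx)]

/-- The components of a section of `E`. -/
def hat (_fr : LocalFrame EB F E x₀) (s : SmoothSec EB F E) (x : M) : F :=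
  fibreCoord F E x₀ x (s x)

theorem hat_smooth (s : SmoothSec EB F E) :
    ContMDiffOn 𝓘(ℝ, EB) 𝓘(ℝ, F) ∞ (fr.hat s) (trivializationAt F E x₀).baseSet :=
  (contMDiffOn_section_iff_fibreCoord (trivializationAt F E x₀).open_baseSet subset_rfl).1
    s.contMDiff.contMDiffOn

theorem hat_smooth_dom (s : SmoothSec EB F E) : ContMDiffOn 𝓘(ℝ, EB) 𝓘(ℝ, F) ∞ (fr.hat s) fr.dom :=
  (fr.hat_smooth s).mono fun _ hx => fr.mem_baseSet hx

variable (A : LieAlgebroid EB F E)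

variable [FiniteDimensional ℝ EB] [T2Space M] [FiniteDimensional ℝ F]

/-- By locality `t` may be replaced near `x` by a finite combination of frame sections, to which the
Leibniz rule applies term by term. The first summand freezes the components of `t` at `x`; the
second collects the derivatives of the coefficients. -/
theorem hat_bracket_right (s t : SmoothSec EB F E) {x : M} (hx : x ∈ fr.dom) :
    fr.hat (A.bracket s t) x =
      fr.hat (A.bracket s (fr.sec (fr.hat t x))) x + der 𝓘(ℝ, EB) (A.vf s) (fr.hat t) x := by
  obtain ⟨h, hsm, hone, hsupp⟩ := exists_cut (EB := EB) (fr.isOpen_dom.mem_nhds hx)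
  set b := Module.finBasis ℝ F
  set L : (i : _) → F →L[ℝ] ℝ := fun i => LinearMap.toContinuousLinearMap (b.coord i)
  have hLf : ∀ i, ContMDiff 𝓘(ℝ, EB) 𝓘(ℝ, ℝ) ∞ (fun y => h y • L i (fr.hat t y)) := by
    intro i
    refine contMDiff_of_tsupport fun y hy => ?_
    have hy' : y ∈ fr.dom := hsupp (tsupport_smul_subset_left _ _ hy)
    refine hsm.contMDiffAt.smul ?_
    exact ((L i).contMDiff.comp_contMDiffOn (fr.hat_smooth_dom t)).contMDiffAt
      (fr.isOpen_dom.mem_nhds hy')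
  -- The coefficients of `t` are smooth only over the frame domain; the factor `h` makes them global
  -- without changing them near `x`.
  set T : SmoothSec EB F E := ∑ i, smulSec _ (hLf i) (fr.sec (b i))
  have hT : ∀ᶠ y in 𝓝 x, (t - T) y = 0 := by
    filter_upwards [hone, fr.isOpen_dom.mem_nhds hx] with y hy hyd
    apply fibreCoord_injective (F := F) (fr.mem_baseSet hyd)
    have h1 : T y = ∑ i, L i (fr.hat t y) • fr.sec (b i) y := by
      rw [sum_sec_apply]
      refine Finset.sum_congr rfl fun i _ => ?_
      change (h y • L i (fr.hat t y)) • fr.sec (b i) y = _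
      rw [hy]
      simp
    rw [ContMDiffSection.coe_sub, Pi.sub_apply, map_sub, h1, map_sum, map_zero, sub_eq_zero]
    simp only [map_smul, fr.fibreCoord_sec hyd]
    exact (b.sum_repr (fr.hat t y)).symm
  have h0 := A.bracket_eq_zero_of_eventually s hT
  have h1 : A.bracket s t x = A.bracket s T x := by
    have : A.bracket s (t - T) = A.bracket s t - A.bracket s T := (A.ad s).map_sub t T
    rw [this, ContMDiffSection.coe_sub, Pi.sub_apply, sub_eq_zero] at h0
    exact h0
  have hder : ∀ i, dirDeriv (fun y => h y • L i (fr.hat t y)) x (A.vf s x) =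
      L i (der 𝓘(ℝ, EB) (A.vf s) (fr.hat t) x) := by
    intro i
    rw [← der_clm (L i) (contMDiff_toMDiff fr.isOpen_dom (fr.hat_smooth_dom t) hx)]
    refine der_congr (I := 𝓘(ℝ, EB)) (V := A.vf s) rfl ?_
    filter_upwards [hone] with y hy
    rw [hy]
    simp
  have h2 : A.bracket s T x = ∑ i, (L i (fr.hat t x) • A.bracket s (fr.sec (b i)) x +
      L i (der 𝓘(ℝ, EB) (A.vf s) (fr.hat t) x) • fr.sec (b i) x) := by
    have : A.bracket s T = ∑ i, A.bracket s (smulSec _ (hLf i) (fr.sec (b i))) :=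
      map_sum (A.ad s) _ _
    rw [this, sum_sec_apply]
    refine Finset.sum_congr rfl fun i _ => ?_
    rw [A.leibniz _ (hLf i) s (fr.sec (b i)) _ (fun y => rfl) x]
    have h3 := hder i
    unfold LieAlgebroid.vf at h3 ⊢
    rw [h3, hone.eq_of_nhds]
    simp
  have h3 : A.bracket s (fr.sec (fr.hat t x)) x =
      ∑ i, L i (fr.hat t x) • A.bracket s (fr.sec (b i)) x := by
    conv_lhs => rw [← b.sum_repr (fr.hat t x)]
    rw [map_sum]
    have : A.bracket s (∑ i, fr.sec (b.repr (fr.hat t x) i • b i)) =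
        ∑ i, A.bracket s (fr.sec (b.repr (fr.hat t x) i • b i)) := map_sum (A.ad s) _ _
    rw [this, sum_sec_apply]
    refine Finset.sum_congr rfl fun i _ => ?_
    rw [map_smul, A.bracket_smul_right]
    rfl
  unfold hat at *
  rw [h1, h2, h3, Finset.sum_add_distrib, map_add]
  congr 1
  rw [map_sum]
  simp only [map_smul, fr.fibreCoord_sec hx]
  exact b.sum_repr _

/-- The structure functions of the bracket in a local frame. -/
def str (x : M) : F →L[ℝ] F →L[ℝ] F :=
  LinearMap.toContinuousLinearMap
    { toFun := fun v => LinearMap.toContinuousLinearMap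
        ((fibreCoord F E x₀ x).toLinearMap ∘ₗ
          (⟨⟨fun s => s x, fun _ _ => rfl⟩, fun _ _ => rfl⟩ : SmoothSec EB F E →ₗ[ℝ] E x) ∘ₗ
          A.ad (fr.sec v) ∘ₗ fr.sec)
      map_add' := fun v w => by
        ext z
        change fibreCoord F E x₀ x (A.bracket (fr.sec (v + w)) (fr.sec z) x) =
          fibreCoord F E x₀ x (A.bracket (fr.sec v) (fr.sec z) x) +
            fibreCoord F E x₀ x (A.bracket (fr.sec w) (fr.sec z) x)
        rw [map_add, A.bracket_add_left, ← map_add]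
        rfl
      map_smul' := fun c v => by
        ext z
        change fibreCoord F E x₀ x (A.bracket (fr.sec (c • v)) (fr.sec z) x) =
          c • fibreCoord F E x₀ x (A.bracket (fr.sec v) (fr.sec z) x)
        rw [map_smul, A.bracket_smul_left, ← map_smul]
        rfl }

theorem str_apply (x : M) (v w : F) :
    fr.str A x v w = fr.hat (A.bracket (fr.sec v) (fr.sec w)) x := rfl

theorem str_skew (x : M) (v w : F) : fr.str A x v w = -fr.str A x w v := by
  rw [str_apply, str_apply, A.bracket_skew]
  exact map_neg _ _

theorem str_smooth : ContMDiffOn 𝓘(ℝ, EB) 𝓘(ℝ, F →L[ℝ] F →L[ℝ] F) ∞ (fr.str A) fr.dom :=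
  contMDiffOn_clm_of_apply fun v => contMDiffOn_clm_of_apply fun w =>
    fr.hat_smooth_dom (A.bracket (fr.sec v) (fr.sec w))

theorem hat_neg (s : SmoothSec EB F E) (x : M) : fr.hat (-s) x = -fr.hat s x := map_neg _ _

theorem hat_sec {x : M} (hx : x ∈ fr.dom) (w : F) : fr.hat (fr.sec w) x = w :=
  fr.fibreCoord_sec hx w

theorem sec_hat {x : M} (hx : x ∈ fr.dom) (s : SmoothSec EB F E) :
    fr.sec (fr.hat s x) x = s x :=
  fr.sec_fibreCoord hx (s x)

/-- The expansion in the right argument is used twice, the second time after exchanging the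
arguments by skew symmetry, so that both sections are frozen at `x`. -/
theorem hat_bracket (s t : SmoothSec EB F E) {x : M} (hx : x ∈ fr.dom) :
    fr.hat (A.bracket s t) x = fr.str A x (fr.hat s x) (fr.hat t x) +
      der 𝓘(ℝ, EB) (A.vf s) (fr.hat t) x - der 𝓘(ℝ, EB) (A.vf t) (fr.hat s) x := by
  have h1 : der 𝓘(ℝ, EB) (A.vf (fr.sec (fr.hat t x))) (fr.hat s) x =
      der 𝓘(ℝ, EB) (A.vf t) (fr.hat s) x := by
    refine der_congr ?_ (Filter.EventuallyEq.refl _ _)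
    unfold LieAlgebroid.vf
    rw [fr.sec_hat hx]
  rw [fr.hat_bracket_right A s t hx, A.bracket_skew s, hat_neg,
    fr.hat_bracket_right A _ s hx, ← str_apply, fr.str_skew A, h1]
  abel

/-- The derivative along the vector field with constant components. -/
def conDer {G : Type*} [NormedAddCommGroup G] [NormedSpace ℝ G] (w : F) (f : M → G) (x : M) : G :=
  der 𝓘(ℝ, EB) (A.vf (fr.sec w)) f x

theorem der_vf_eq {G : Type*} [NormedAddCommGroup G] [NormedSpace ℝ G] (s : SmoothSec EB F E)
    (f : M → G) {x : M} (hx : x ∈ fr.dom) :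
    der 𝓘(ℝ, EB) (A.vf s) f x = fr.conDer A (fr.hat s x) f x := by
  refine der_congr ?_ (Filter.EventuallyEq.refl _ _)
  unfold LieAlgebroid.vf
  rw [fr.sec_hat hx]

theorem hat_sec_eventually {x : M} (hx : x ∈ fr.dom) (w : F) :
    fr.hat (fr.sec w) =ᶠ[𝓝 x] fun _ => w := by
  filter_upwards [fr.isOpen_dom.mem_nhds hx] with y hy using fr.hat_sec hy w

/-- Frame sections have constant components near `x`, so of the two derivative terms in
`hat_bracket` only the one that differentiates the inner bracket survives. -/
theorem jacobi_aux {x : M} (hx : x ∈ fr.dom) (v₁ v₂ v₃ : F) :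
    fr.hat (A.bracket (fr.sec v₁) (A.bracket (fr.sec v₂) (fr.sec v₃))) x =
      fr.str A x v₁ (fr.str A x v₂ v₃) + fr.conDer A v₁ (fr.str A) x v₂ v₃ := by
  have hd := contMDiff_toMDiff fr.isOpen_dom (fr.str_smooth A) hx
  have h1 : fr.conDer A v₁ (fr.str A) x v₂ v₃ =
      fr.conDer A v₁ (fun y => fr.str A y v₂ v₃) x := by
    have h2 := der_apply_const (V := A.vf (fr.sec v₁)) v₂ hd
    have h4 := der_apply_const (V := A.vf (fr.sec v₁)) v₃ (mdiff_apply_const v₂ hd)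
    exact ((h4.trans (congrArg (fun L => L v₃) h2))).symm
  have h3 : der 𝓘(ℝ, EB) (A.vf (A.bracket (fr.sec v₂) (fr.sec v₃))) (fr.hat (fr.sec v₁)) x = 0 :=
    (der_congr rfl (fr.hat_sec_eventually hx v₁)).trans (der_const _ v₁ x)
  rw [fr.hat_bracket A _ _ hx, h3, fr.hat_sec hx, h1]
  simp only [sub_zero]
  rfl

theorem jacobi {x : M} (hx : x ∈ fr.dom) (v₁ v₂ v₃ : F) :
    fr.str A x v₁ (fr.str A x v₂ v₃) + fr.conDer A v₁ (fr.str A) x v₂ v₃ +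
      (fr.str A x v₂ (fr.str A x v₃ v₁) + fr.conDer A v₂ (fr.str A) x v₃ v₁) +
      (fr.str A x v₃ (fr.str A x v₁ v₂) + fr.conDer A v₃ (fr.str A) x v₁ v₂) = 0 := by
  rw [← fr.jacobi_aux A hx, ← fr.jacobi_aux A hx, ← fr.jacobi_aux A hx]
  have h := congrArg (fun s => fr.hat s x) (A.bracket_jacobi (fr.sec v₁) (fr.sec v₂) (fr.sec v₃))
  have h0 : fr.hat (0 : SmoothSec EB F E) x = 0 := map_zero _
  rw [← h0, ← h]
  unfold hat
  simp only [ContMDiffSection.coe_add, Pi.add_apply, map_add]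

/-- The anchor in the local frame and the preferred chart. -/
def anc (x : M) : F →L[ℝ] EB :=
  LinearMap.toContinuousLinearMap
    { toFun := fun w => der 𝓘(ℝ, EB) (A.vf (fr.sec w)) (extChartAt 𝓘(ℝ, EB) x₀) x
      map_add' := fun v w => der_vec_add _ _ _ (by
        unfold LieAlgebroid.vf
        rw [map_add, ContMDiffSection.coe_add, Pi.add_apply, map_add])
      map_smul' := fun c v => by
        unfold der LieAlgebroid.vf
        rw [map_smul, ContMDiffSection.coe_smul, Pi.smul_apply, map_smul]
        exact (mfderiv 𝓘(ℝ, EB) 𝓘(ℝ, EB) (extChartAt 𝓘(ℝ, EB) x₀) x).map_smul c _ }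

theorem anc_apply (x : M) (w : F) :
    fr.anc A x w = der 𝓘(ℝ, EB) (A.vf (fr.sec w)) (extChartAt 𝓘(ℝ, EB) x₀) x := rfl

theorem chart_smooth :
    ContMDiffOn 𝓘(ℝ, EB) 𝓘(ℝ, EB) ∞ (extChartAt 𝓘(ℝ, EB) x₀) (chartAt EB x₀).source :=
  contMDiffOn_extChartAt

theorem anc_smooth : ContMDiffOn 𝓘(ℝ, EB) 𝓘(ℝ, F →L[ℝ] EB) ∞ (fr.anc A) fr.dom :=
  contMDiffOn_clm_of_apply fun _ => contMDiffOn_der fr.isOpen_dom (A.vf_smooth _ _)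
    (chart_smooth.mono fun _ hx => fr.mem_source hx)

theorem anc_fibreCoord {x : M} (hx : x ∈ fr.dom) (a : E x) :
    fr.anc A x (fibreCoord F E x₀ x a) =
      mfderiv 𝓘(ℝ, EB) 𝓘(ℝ, EB) (extChartAt 𝓘(ℝ, EB) x₀) x (A.anchor x a) := by
  rw [anc_apply]
  unfold der LieAlgebroid.vf
  rw [fr.sec_fibreCoord hx]

/-- The chart expression of the fact that the anchor preserves brackets: both sides of
`anchor_bracket` act on the chart map, and the bracket of vector fields acts as a commutator. -/
theorem anc_str {x : M} (hx : x ∈ fr.dom) (v w : F) :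
    fr.anc A x (fr.str A x v w) =
      fr.conDer A v (fr.anc A) x w - fr.conDer A w (fr.anc A) x v := by
  have hd := contMDiff_toMDiff fr.isOpen_dom (fr.anc_smooth A) hx
  have h1 : ∀ v w : F, fr.conDer A v (fr.anc A) x w =
      fr.conDer A v (fun y => fr.anc A y w) x := fun v w =>
    (der_apply_const (V := A.vf (fr.sec v)) w hd).symm
  have h2 : fr.anc A x (fr.str A x v w) = der 𝓘(ℝ, EB)
      (mlieBracket 𝓘(ℝ, EB) (A.vf (fr.sec v)) (A.vf (fr.sec w))) (extChartAt 𝓘(ℝ, EB) x₀) x := by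
    rw [str_apply, hat, fr.anc_fibreCoord A hx, A.anchor_bracket]
    rfl
  rw [h2, der_mlieBracket fr.isOpen_dom (A.vf_smooth _ _) (A.vf_smooth _ _)
    (chart_smooth.mono fun _ hx => fr.mem_source hx) hx, h1, h1]
  rfl

end LocalFrame

end Base

/-! ### Coordinates on `E*` and on the prolongation. -/

section DualBundle

variable {EB : Type uB} [NormedAddCommGroup EB] [NormedSpace ℝ EB]
  {F : Type uF} [NormedAddCommGroup F] [NormedSpace ℝ F]
  {M : Type uM} [TopologicalSpace M] [ChartedSpace EB M]
  [IsManifold 𝓘(ℝ, EB) ∞ M]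
  {E : M → Type uE} [TopologicalSpace (TotalSpace F E)]
  [∀ x, AddCommGroup (E x)] [∀ x, Module ℝ (E x)] [∀ x, TopologicalSpace (E x)]
  [∀ x, IsTopologicalAddGroup (E x)] [∀ x, ContinuousSMul ℝ (E x)]
  [FiberBundle F E] [VectorBundle ℝ F E] [ContMDiffVectorBundle ∞ F E 𝓘(ℝ, EB)]

theorem proj_smooth (W : Set (Dual F E)) :
    ContMDiffOn (dualModel EB F) 𝓘(ℝ, EB) ∞ (fun u : Dual F E => u.proj) W :=
  (contMDiff_proj _).contMDiffOn

theorem continuous_proj : Continuous (fun u : Dual F E => u.proj) :=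
  FiberBundle.continuous_proj _ _

/-- The fibre component of a covector in the preferred trivialization at `x₀`. -/
def mom (x₀ : M) (u : Dual F E) : F →L[ℝ] ℝ := u.snd ∘L ofFibreCoord F E x₀ u.proj

theorem mom_apply (x₀ : M) (u : Dual F E) (w : F) :
    mom x₀ u w = u.snd (ofFibreCoord F E x₀ u.proj w) := rfl

theorem mom_fibreCoord {x₀ : M} {u : Dual F E}
    (hu : u.proj ∈ (trivializationAt F E x₀).baseSet) (a : E u.proj) :
    mom x₀ u (fibreCoord F E x₀ u.proj a) = u.snd a := by
  rw [mom_apply, ofFibreCoord_fibreCoord hu]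

theorem mom_eq (x₀ : M) (u : Dual F E) :
    (trivializationAt (F →L[ℝ] ℝ) (fun x : M => E x →L[ℝ] Bundle.Trivial M ℝ x) x₀ u).2 =
      mom x₀ u := by
  rw [hom_trivializationAt_apply]
  ext w
  simp [ContinuousLinearMap.inCoordinates, mom_apply, ofFibreCoord]

theorem dual_baseSet (x₀ : M) :
    (trivializationAt (F →L[ℝ] ℝ) (fun x : M => E x →L[ℝ] Bundle.Trivial M ℝ x) x₀).baseSet =
      (trivializationAt F E x₀).baseSet := by
  rw [hom_trivializationAt_baseSet]
  simp

theorem mom_smooth (x₀ : M) :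
    ContMDiffOn (dualModel EB F) 𝓘(ℝ, F →L[ℝ] ℝ) ∞ (mom x₀ : Dual F E → F →L[ℝ] ℝ)
      {u | u.proj ∈ (trivializationAt F E x₀).baseSet} := by
  have h := ((trivializationAt (F →L[ℝ] ℝ)
    (fun x : M => E x →L[ℝ] Bundle.Trivial M ℝ x) x₀).contMDiffOn (IB := 𝓘(ℝ, EB)) (n := ∞))
  rw [Trivialization.source_eq, dual_baseSet] at h
  exact (contMDiff_snd.comp_contMDiffOn h).congr fun u _ => (mom_eq x₀ u).symm

/-- The zero covector at a point. -/
def zeroCovector (x₀ : M) : Dual F E := ⟨x₀, 0⟩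

/-- The preferred chart of `E*` at a point depends only on the projection of the point, so the zero
covector is a convenient base point for the chart over `x₀`. -/
theorem extChartAt_zeroCovector (x₀ : M) (u : Dual F E) :
    extChartAt (dualModel EB F) (zeroCovector x₀ : Dual F E) u =
      (extChartAt 𝓘(ℝ, EB) x₀ u.proj, mom x₀ u) := by
  rw [FiberBundle.extChartAt, ← mom_eq]
  rfl

theorem mem_source_zeroCovector {x₀ : M} {u : Dual F E} :
    u ∈ (chartAt (ModelProd EB (F →L[ℝ] ℝ)) (zeroCovector x₀ : Dual F E)).source ↔
      u.proj ∈ (trivializationAt F E x₀).baseSet ∩ (chartAt EB x₀).source := by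
  rw [FiberBundle.chartedSpace_chartAt]
  simp only [mfld_simps]
  exact ⟨fun h => ⟨h.1.1, h.2⟩, fun h => ⟨⟨h.1, mem_univ _⟩, h.2⟩⟩

variable {A : LieAlgebroid EB F E}

/-- The `F`-component of the coordinates of an element of the prolongation. -/
def crdX (x₀ : M) (u : Dual F E) : Prolong A u →ₗ[ℝ] F :=
  (fibreCoord F E x₀ u.proj).toLinearMap ∘ₗ
    (LinearMap.fst ℝ (E u.proj) (TangentSpace (dualModel EB F) u)) ∘ₗ (Prolong A u).subtype

/-- The momentum component of the coordinates of an element of the prolongation. -/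
def crdP (x₀ : M) (u : Dual F E) : Prolong A u →ₗ[ℝ] F →L[ℝ] ℝ :=
  (mfderiv (dualModel EB F) 𝓘(ℝ, F →L[ℝ] ℝ) (mom x₀) u).toLinearMap ∘ₗ
    (LinearMap.snd ℝ (E u.proj) (TangentSpace (dualModel EB F) u)) ∘ₗ (Prolong A u).subtype

/-- The derivative of a vector-valued function along a section of the prolongation. -/
def PSec.D {G : Type*} [NormedAddCommGroup G] [NormedSpace ℝ G] (ρ : PSec A) (f : Dual F E → G)
    (u : Dual F E) : G :=
  der (dualModel EB F) ρ.field f u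

/-- The `F`-component of a section of the prolongation. -/
def PSec.X (x₀ : M) (ρ : PSec A) (u : Dual F E) : F := crdX x₀ u (ρ u)

/-- The momentum component of a section of the prolongation. -/
def PSec.P (x₀ : M) (ρ : PSec A) (u : Dual F E) : F →L[ℝ] ℝ := crdP x₀ u (ρ u)

/-- The part of the dual bundle over the domain of a local frame. -/
def LocalFrame.ddom {x₀ : M} (fr : LocalFrame EB F E x₀) : Set (Dual F E) :=
  {u | u.proj ∈ fr.dom}

theorem LocalFrame.isOpen_ddom {x₀ : M} (fr : LocalFrame EB F E x₀) : IsOpen fr.ddom :=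
  fr.isOpen_dom.preimage continuous_proj

theorem LocalFrame.mom_smooth {x₀ : M} (fr : LocalFrame EB F E x₀) :
    ContMDiffOn (dualModel EB F) 𝓘(ℝ, F →L[ℝ] ℝ) ∞ (mom x₀ : Dual F E → F →L[ℝ] ℝ) fr.ddom :=
  (LieAlgd.mom_smooth x₀).mono fun _ hu => fr.mem_baseSet hu

theorem mfderiv_comp_proj {G : Type*} [NormedAddCommGroup G] [NormedSpace ℝ G] {f : M → G}
    {u : Dual F E} (hf : MDifferentiableAt 𝓘(ℝ, EB) 𝓘(ℝ, G) f u.proj)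
    (v : TangentSpace (dualModel EB F) u) :
    mfderiv (dualModel EB F) 𝓘(ℝ, G) (fun y : Dual F E => f y.proj) u v =
      mfderiv 𝓘(ℝ, EB) 𝓘(ℝ, G) f u.proj (dProj u v) := by
  have hp : MDifferentiableAt (dualModel EB F) 𝓘(ℝ, EB) (fun y : Dual F E => y.proj) u :=
    (contMDiff_proj _).mdifferentiableAt (n := ∞) (by simp)
  have h := mfderiv_comp u hf hp
  exact DFunLike.congr_fun h v

/-- This is where the defining relation `σ(a) = Tτ(v)` enters: functions pulled back from `M` are
differentiated along the anchor of the `E`-component. -/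
theorem PSec.D_comp_proj {G : Type*} [NormedAddCommGroup G] [NormedSpace ℝ G] (ρ : PSec A)
    {f : M → G} {u : Dual F E} (hf : MDifferentiableAt 𝓘(ℝ, EB) 𝓘(ℝ, G) f u.proj) :
    ρ.D (fun y => f y.proj) u =
      mfderiv 𝓘(ℝ, EB) 𝓘(ℝ, G) f u.proj (A.anchor u.proj (ρ.base u)) := by
  refine (mfderiv_comp_proj hf _).trans ?_
  rw [show A.anchor u.proj (ρ.base u) = dProj u (ρ.field u) from (ρ u).2]

theorem PSec.D_comp_proj_frame {G : Type*} [NormedAddCommGroup G] [NormedSpace ℝ G] {x₀ : M}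
    (fr : LocalFrame EB F E x₀) (ρ : PSec A) {f : M → G} {u : Dual F E} (hu : u ∈ fr.ddom)
    (hf : MDifferentiableAt 𝓘(ℝ, EB) 𝓘(ℝ, G) f u.proj) :
    ρ.D (fun y => f y.proj) u = fr.conDer A (ρ.X x₀ u) f u.proj := by
  rw [ρ.D_comp_proj hf]
  unfold LocalFrame.conDer der LieAlgebroid.vf
  rw [show ρ.X x₀ u = fibreCoord F E x₀ u.proj (ρ.base u) from rfl, fr.sec_fibreCoord hu]

theorem mfderiv_chart_zeroCovector {x₀ : M} {u : Dual F E}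
    (hu : u.proj ∈ (trivializationAt F E x₀).baseSet ∩ (chartAt EB x₀).source)
    (v : TangentSpace (dualModel EB F) u) :
    mfderiv (dualModel EB F) 𝓘(ℝ, EB × (F →L[ℝ] ℝ))
      (extChartAt (dualModel EB F) (zeroCovector x₀ : Dual F E)) u v =
      ((mfderiv 𝓘(ℝ, EB) 𝓘(ℝ, EB) (extChartAt 𝓘(ℝ, EB) x₀) u.proj (dProj u v) : EB),
        (mfderiv (dualModel EB F) 𝓘(ℝ, F →L[ℝ] ℝ) (mom x₀) u v : F →L[ℝ] ℝ)) := by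
  have h1 : MDifferentiableAt 𝓘(ℝ, EB) 𝓘(ℝ, EB) (extChartAt 𝓘(ℝ, EB) x₀) u.proj :=
    mdifferentiableAt_extChartAt hu.2
  have hp : MDifferentiableAt (dualModel EB F) 𝓘(ℝ, EB) (fun y : Dual F E => y.proj) u :=
    (contMDiff_proj _).mdifferentiableAt (n := ∞) (by simp)
  have h2 : MDifferentiableAt (dualModel EB F) 𝓘(ℝ, F →L[ℝ] ℝ)
      (mom x₀ : Dual F E → F →L[ℝ] ℝ) u :=
    contMDiff_toMDiff ((trivializationAt F E x₀).open_baseSet.preimage continuous_proj)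
      (mom_smooth x₀) hu.1
  have h3 : (extChartAt (dualModel EB F) (zeroCovector x₀ : Dual F E) :
      Dual F E → EB × (F →L[ℝ] ℝ)) = fun y => (extChartAt 𝓘(ℝ, EB) x₀ y.proj, mom x₀ y) :=
    funext (extChartAt_zeroCovector x₀)
  have h4 := (hasMFDerivAt_pair (f := fun y : Dual F E => extChartAt 𝓘(ℝ, EB) x₀ y.proj)
    (h1.comp u hp) h2).mfderiv
  rw [h3]
  refine (DFunLike.congr_fun h4 v).trans (Prod.ext ?_ rfl)
  exact mfderiv_comp_proj h1 v

/-- The `E`-component determines the projection of `v` to `TM` through the anchor, and the momentum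
component supplies the rest of `v` in the chart of `E*`. -/
theorem prolong_ext {x₀ : M} {u : Dual F E}
    (hu : u.proj ∈ (trivializationAt F E x₀).baseSet ∩ (chartAt EB x₀).source)
    {p q : Prolong A u} (h1 : crdX x₀ u p = crdX x₀ u q) (h2 : crdP x₀ u p = crdP x₀ u q) :
    p = q := by
  have ha : p.1.1 = q.1.1 := fibreCoord_injective (F := F) hu.1 h1
  have hd : dProj u p.1.2 = dProj u q.1.2 :=
    (show A.anchor u.proj p.1.1 = dProj u p.1.2 from p.2).symm.trans
      ((congrArg _ ha).trans (show A.anchor u.proj q.1.1 = dProj u q.1.2 from q.2))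
  have hinj : Function.Injective (mfderiv (dualModel EB F) 𝓘(ℝ, EB × (F →L[ℝ] ℝ))
      (extChartAt (dualModel EB F) (zeroCovector x₀ : Dual F E)) u) := by
    obtain ⟨e, he⟩ := isInvertible_mfderiv_extChartAt (I := dualModel EB F)
      (x := (zeroCovector x₀ : Dual F E)) (y := u)
      (by rw [extChartAt_source]; exact mem_source_zeroCovector.2 hu)
    rw [← he]
    exact e.injective
  have hv : p.1.2 = q.1.2 := by
    apply hinj
    rw [mfderiv_chart_zeroCovector hu, mfderiv_chart_zeroCovector hu, hd]
    congr 1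
  exact Subtype.ext (Prod.ext ha hv)

theorem PSec.SmoothOn.mono {ρ : PSec A} {W W' : Set (Dual F E)} (h : ρ.SmoothOn W) (hW : W' ⊆ W) :
    ρ.SmoothOn W' :=
  ⟨h.1.mono hW, h.2.mono hW⟩

theorem PSec.SmoothOn.congr {ρ ρ' : PSec A} {W : Set (Dual F E)} (h : ρ.SmoothOn W)
    (hW : ∀ u ∈ W, ρ' u = ρ u) : ρ'.SmoothOn W := by
  refine ⟨h.1.congr fun u hu => ?_, h.2.congr fun u hu => ?_⟩
  · simp only [PSec.base, hW u hu]
  · simp only [PSec.field, hW u hu]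

theorem PSec.smoothOn_of_local {ρ : PSec A} {W : Set (Dual F E)}
    (h : ∀ u ∈ W, ∃ O, IsOpen O ∧ u ∈ O ∧ ρ.SmoothOn (W ∩ O)) : ρ.SmoothOn W := by
  constructor
  · intro u hu
    obtain ⟨O, hO, huO, hs⟩ := h u hu
    exact (hs.1 u ⟨hu, huO⟩).mono_of_mem_nhdsWithin
      (Filter.inter_mem self_mem_nhdsWithin (mem_nhdsWithin_of_mem_nhds (hO.mem_nhds huO)))
  · intro u hu
    obtain ⟨O, hO, huO, hs⟩ := h u hu
    exact (hs.2 u ⟨hu, huO⟩).mono_of_mem_nhdsWithin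
      (Filter.inter_mem self_mem_nhdsWithin (mem_nhdsWithin_of_mem_nhds (hO.mem_nhds huO)))

theorem contMDiffOn_lift_iff {x₀ : M} {Z : ∀ u : Dual F E, E u.proj} {O : Set (Dual F E)}
    (hO : O ⊆ {u | u.proj ∈ (trivializationAt F E x₀).baseSet}) :
    ContMDiffOn (dualModel EB F) (𝓘(ℝ, EB).prod 𝓘(ℝ, F)) ∞
      (fun u => (⟨u.proj, Z u⟩ : TotalSpace F E)) O ↔
    ContMDiffOn (dualModel EB F) 𝓘(ℝ, F) ∞ (fun u => fibreCoord F E x₀ u.proj (Z u)) O := by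
  rw [(trivializationAt F E x₀).contMDiffOn_iff (IB := 𝓘(ℝ, EB))
    (f := fun u : Dual F E => (⟨u.proj, Z u⟩ : TotalSpace F E))
    (fun u hu => (trivializationAt F E x₀).mem_source.2 (hO hu))]
  have h := contMDiffOn_congr (I := dualModel EB F) (I' := 𝓘(ℝ, F)) (n := ∞) (s := O)
    (f := fun u => fibreCoord F E x₀ u.proj (Z u))
    (f₁ := fun u => (trivializationAt F E x₀ ⟨u.proj, Z u⟩).2)
    (fun u hu => (fibreCoord_eq (hO hu) (Z u)).symm)
  rw [h]
  exact ⟨fun h => h.2, fun h => ⟨proj_smooth O, h⟩⟩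

variable [FiniteDimensional ℝ EB] [T2Space M] [FiniteDimensional ℝ F]

theorem PSec.D_smooth {G : Type*} [NormedAddCommGroup G] [NormedSpace ℝ G] {ρ : PSec A}
    {W : Set (Dual F E)} (hW : IsOpen W) (hρ : ρ.SmoothOn W) {f : Dual F E → G}
    (hf : ContMDiffOn (dualModel EB F) 𝓘(ℝ, G) ∞ f W) :
    ContMDiffOn (dualModel EB F) 𝓘(ℝ, G) ∞ (ρ.D f) W :=
  contMDiffOn_der hW hρ.2 hf

theorem PSec.SmoothOn.X_smooth {x₀ : M} (fr : LocalFrame EB F E x₀) {ρ : PSec A}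
    {W : Set (Dual F E)} (hρ : ρ.SmoothOn W) :
    ContMDiffOn (dualModel EB F) 𝓘(ℝ, F) ∞ (ρ.X x₀) (W ∩ fr.ddom) :=
  (contMDiffOn_lift_iff fun _ hu => fr.mem_baseSet hu.2).1 (hρ.1.mono inter_subset_left)

theorem PSec.SmoothOn.P_smooth {x₀ : M} (fr : LocalFrame EB F E x₀) {ρ : PSec A}
    {W : Set (Dual F E)} (hW : IsOpen W) (hρ : ρ.SmoothOn W) :
    ContMDiffOn (dualModel EB F) 𝓘(ℝ, F →L[ℝ] ℝ) ∞ (ρ.P x₀) (W ∩ fr.ddom) :=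
  PSec.D_smooth (hW.inter fr.isOpen_ddom) (hρ.mono inter_subset_left)
    (fr.mom_smooth.mono inter_subset_right)

theorem contMDiffOn_field_iff {x₀ : M} {V : ∀ u : Dual F E, TangentSpace (dualModel EB F) u}
    {O : Set (Dual F E)} (hO : IsOpen O)
    (hO' : O ⊆ {u | u.proj ∈ (trivializationAt F E x₀).baseSet ∩ (chartAt EB x₀).source}) :
    ContMDiffOn (dualModel EB F) (dualModel EB F).tangent ∞
      (fun u => (⟨u, V u⟩ : TangentBundle (dualModel EB F) (Dual F E))) O ↔
    ContMDiffOn (dualModel EB F) 𝓘(ℝ, EB × (F →L[ℝ] ℝ)) ∞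
      (der (dualModel EB F) V
        (extChartAt (dualModel EB F) (zeroCovector x₀ : Dual F E))) O := by
  have h := (trivializationAt (EB × (F →L[ℝ] ℝ))
    (TangentSpace (dualModel EB F) : Dual F E → Type _)
    (zeroCovector x₀)).contMDiffOn_section_iff (IB := dualModel EB F) (n := ∞) (s := V) hO
    (fun u hu => mem_source_zeroCovector.2 (hO' hu))
  refine h.trans (contMDiffOn_congr fun u hu => ?_)
  have h1 := TangentBundle.continuousLinearMapAt_trivializationAt (I := dualModel EB F)
    (mem_source_zeroCovector.2 (hO' hu))
  have h2 := Trivialization.continuousLinearMapAt_apply_of_mem ℝ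
    (trivializationAt (EB × (F →L[ℝ] ℝ)) (TangentSpace (dualModel EB F) : Dual F E → Type _)
    (zeroCovector x₀)) (mem_source_zeroCovector.2 (hO' hu)) (V u)
  rw [h1] at h2
  exact h2.symm

theorem PSec.D_chart {x₀ : M} (fr : LocalFrame EB F E x₀) (ρ : PSec A) {u : Dual F E}
    (hu : u ∈ fr.ddom) :
    der (dualModel EB F) ρ.field (extChartAt (dualModel EB F) (zeroCovector x₀ : Dual F E)) u =
      (fr.anc A u.proj (ρ.X x₀ u), ρ.P x₀ u) := by
  refine (mfderiv_chart_zeroCovector ⟨fr.mem_baseSet hu, fr.mem_source hu⟩ _).trans ?_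
  refine Prod.ext ?_ rfl
  change _ = fr.anc A u.proj (fibreCoord F E x₀ u.proj (ρ.base u))
  rw [fr.anc_fibreCoord A hu, show A.anchor u.proj (ρ.base u) = dProj u (ρ.field u) from (ρ u).2]

/-- The chart components of the vector field are `(anc X, P)` by `PSec.D_chart`, so smooth
coordinates give a smooth field. -/
theorem PSec.smoothOn_of_coord {x₀ : M} (fr : LocalFrame EB F E x₀) {ρ : PSec A}
    {O : Set (Dual F E)} (hO : IsOpen O) (hO' : O ⊆ fr.ddom)
    (hX : ContMDiffOn (dualModel EB F) 𝓘(ℝ, F) ∞ (ρ.X x₀) O)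
    (hP : ContMDiffOn (dualModel EB F) 𝓘(ℝ, F →L[ℝ] ℝ) ∞ (ρ.P x₀) O) : ρ.SmoothOn O := by
  refine ⟨(contMDiffOn_lift_iff fun _ hu => fr.mem_baseSet (hO' hu)).2 hX,
    (contMDiffOn_field_iff (x₀ := x₀) hO
      fun u hu => ⟨fr.mem_baseSet (hO' hu), fr.mem_source (hO' hu)⟩).2 ?_⟩
  have h1 : ContMDiffOn (dualModel EB F) 𝓘(ℝ, F →L[ℝ] EB) ∞
      (fun u : Dual F E => fr.anc A u.proj) O :=
    (fr.anc_smooth A).comp (proj_smooth O) hO'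
  exact ((h1.clm_apply hX).prodMk_space hP).congr fun u hu => ρ.D_chart fr (hO' hu)

variable (EB) in
/-- The domain of the preferred trivialization and chart at a point, in the dual bundle. -/
def chartDom (x₀ : M) : Set (Dual F E) :=
  {u | u.proj ∈ (trivializationAt F E x₀).baseSet ∩ (chartAt EB x₀).source}

theorem isOpen_chartDom (x₀ : M) : IsOpen (chartDom EB x₀ : Set (Dual F E)) :=
  ((trivializationAt F E x₀).open_baseSet.inter (chartAt EB x₀).open_source).preimage
    continuous_proj

/-- The tangent vector at `u` with given components in the chart of the dual bundle at `x₀`. -/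
def ofChart (x₀ : M) (u : Dual F E) : EB × (F →L[ℝ] ℝ) →L[ℝ] TangentSpace (dualModel EB F) u :=
  (trivializationAt (EB × (F →L[ℝ] ℝ)) (TangentSpace (dualModel EB F) : Dual F E → Type _)
    (zeroCovector x₀)).symmL ℝ u

theorem mfderiv_chart_ofChart {x₀ : M} {u : Dual F E} (hu : u ∈ (chartDom EB x₀ : Set (Dual F E)))
    (z : EB × (F →L[ℝ] ℝ)) :
    mfderiv (dualModel EB F) 𝓘(ℝ, EB × (F →L[ℝ] ℝ))
      (extChartAt (dualModel EB F) (zeroCovector x₀ : Dual F E)) u (ofChart x₀ u z) = z := by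
  have h1 := TangentBundle.continuousLinearMapAt_trivializationAt (I := dualModel EB F)
    (mem_source_zeroCovector.2 hu)
  rw [← h1]
  exact Trivialization.continuousLinearMapAt_symmL _ (mem_source_zeroCovector.2 hu) z

theorem dProj_ofChart {x₀ : M} {u : Dual F E} (hu : u ∈ (chartDom EB x₀ : Set (Dual F E)))
    (z : EB × (F →L[ℝ] ℝ)) :
    mfderiv 𝓘(ℝ, EB) 𝓘(ℝ, EB) (extChartAt 𝓘(ℝ, EB) x₀) u.proj (dProj u (ofChart x₀ u z)) = z.1 :=
  congrArg Prod.fst ((mfderiv_chart_zeroCovector hu _).symm.trans (mfderiv_chart_ofChart hu z))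

theorem mfderiv_mom_ofChart {x₀ : M} {u : Dual F E} (hu : u ∈ (chartDom EB x₀ : Set (Dual F E)))
    (z : EB × (F →L[ℝ] ℝ)) :
    mfderiv (dualModel EB F) 𝓘(ℝ, F →L[ℝ] ℝ) (mom x₀) u (ofChart x₀ u z) = z.2 :=
  congrArg Prod.snd ((mfderiv_chart_zeroCovector hu _).symm.trans (mfderiv_chart_ofChart hu z))

theorem mfderiv_chart_injective {x₀ x : M} (hx : x ∈ (chartAt EB x₀).source) :
    Function.Injective (mfderiv 𝓘(ℝ, EB) 𝓘(ℝ, EB) (extChartAt 𝓘(ℝ, EB) x₀) x) := by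
  obtain ⟨e, he⟩ := isInvertible_mfderiv_extChartAt (I := 𝓘(ℝ, EB)) (x := x₀) (y := x)
    (by rwa [extChartAt_source])
  rw [← he]
  exact e.injective

namespace LocalFrame

variable {x₀ : M} (fr : LocalFrame EB F E x₀)

variable (A) in
/-- The global section of the prolongation with constant components over the domain of the
frame. -/
def ext (w : F) (b : F →L[ℝ] ℝ) : PSec A := fun u =>
  -- The sections behind `sec` and `anc` already carry one factor `cut`, which keeps the pair in the
  -- prolongation over the chart domain. The second factor, applied to both components, makes the
  -- pair vanish outside that domain, where `ofChart` has no meaning.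
  ⟨(fr.cut u.proj • fr.sec w u.proj,
    fr.cut u.proj • ofChart x₀ u (fr.anc A u.proj w, b)), by
    by_cases hu : u ∈ chartDom EB x₀
    · change A.anchor u.proj (fr.cut u.proj • fr.sec w u.proj) =
        dProj u (fr.cut u.proj • ofChart x₀ u (fr.anc A u.proj w, b))
      refine ((A.anchor u.proj).map_smul _ _).trans (Eq.trans ?_ ((dProj u).map_smul _ _).symm)
      refine congrArg (fr.cut u.proj • ·) ?_
      apply mfderiv_chart_injective hu.2
      rw [dProj_ofChart hu]
      rfl
    · have h0 : fr.cut u.proj = 0 :=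
        image_eq_zero_of_notMem_tsupport fun h => hu (fr.tsupport_cut h)
      rw [h0, zero_smul, zero_smul]
      exact (Prolong A u).zero_mem⟩

theorem mem_chartDom {u : Dual F E} (hu : u ∈ fr.ddom) : u ∈ (chartDom EB x₀ : Set (Dual F E)) :=
  ⟨fr.mem_baseSet hu, fr.mem_source hu⟩

theorem ext_X (w : F) (b : F →L[ℝ] ℝ) {u : Dual F E} (hu : u ∈ fr.ddom) :
    (fr.ext A w b).X x₀ u = w := by
  change fibreCoord F E x₀ u.proj (fr.cut u.proj • fr.sec w u.proj) = w
  rw [fr.cut_one _ hu, one_smul, fr.fibreCoord_sec hu]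

theorem ext_P (w : F) (b : F →L[ℝ] ℝ) {u : Dual F E} (hu : u ∈ fr.ddom) :
    (fr.ext A w b).P x₀ u = b := by
  change mfderiv (dualModel EB F) 𝓘(ℝ, F →L[ℝ] ℝ) (mom x₀) u
    (fr.cut u.proj • ofChart x₀ u (fr.anc A u.proj w, b)) = b
  rw [fr.cut_one _ hu, one_smul, mfderiv_mom_ofChart (fr.mem_chartDom hu)]

theorem ext_vertical (b : F →L[ℝ] ℝ) (u : Dual F E) : fr.ext A 0 b u ∈ vertical A u := by
  change fr.cut u.proj • fr.sec 0 u.proj = 0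
  rw [map_zero]
  exact smul_zero _

theorem ext_eq {u : Dual F E} (hu : u ∈ fr.ddom) (p : Prolong A u) :
    fr.ext A (crdX x₀ u p) (crdP x₀ u p) u = p :=
  prolong_ext (fr.mem_chartDom hu) (fr.ext_X _ _ hu) (fr.ext_P _ _ hu)

theorem ext_smooth (w : F) (b : F →L[ℝ] ℝ) (W : Set (Dual F E)) : (fr.ext A w b).SmoothOn W := by
  constructor
  · exact (smulSec fr.cut fr.cut_smooth (fr.sec w)).contMDiff.comp_contMDiffOn (proj_smooth W)
  · have h0 : ContMDiff (dualModel EB F) 𝓘(ℝ, ℝ) ∞ (fun u : Dual F E => fr.cut u.proj) :=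
      fr.cut_smooth.comp (contMDiff_proj _)
    have h1 : tsupport (fun u : Dual F E => fr.cut u.proj) ⊆ chartDom EB x₀ := by
      refine (tsupport_comp_subset_preimage fr.cut continuous_proj).trans ?_
      exact fun u hu => fr.tsupport_cut hu
    have h2 : ContMDiffOn (dualModel EB F) (dualModel EB F).tangent ∞
        (fun u : Dual F E => (⟨u, ofChart x₀ u (fr.anc A u.proj w, b)⟩ :
          TangentBundle (dualModel EB F) (Dual F E))) (chartDom EB x₀) := by
      rw [contMDiffOn_field_iff (isOpen_chartDom x₀) subset_rfl]
      have h3 : ContMDiffOn 𝓘(ℝ, EB) 𝓘(ℝ, EB) ∞ (fun x => fr.anc A x w)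
          (chartAt EB x₀).source :=
        contMDiffOn_der (chartAt EB x₀).open_source (A.vf_smooth _ _) chart_smooth
      have h4 : ContMDiffOn (dualModel EB F) 𝓘(ℝ, EB) ∞ (fun u : Dual F E => fr.anc A u.proj w)
          (chartDom EB x₀) := h3.comp (proj_smooth _) fun u hu => hu.2
      exact (h4.prodMk_space contMDiffOn_const).congr fun u hu => mfderiv_chart_ofChart hu _
    exact (ContMDiffOn.smul_section_of_tsupport h0.contMDiffOn (isOpen_chartDom x₀) h1
      h2).contMDiffOn

end LocalFrame

/-- `symplectic` and `pbracket` take sections as arguments; this lets identities between sections be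
read at a single element of a fibre. -/
theorem exists_smooth_through {u : Dual F E} (p : Prolong A u) :
    ∃ ρ : PSec A, (∀ W, ρ.SmoothOn W) ∧ ρ u = p := by
  obtain ⟨fr⟩ := exists_localFrame (EB := EB) (F := F) (E := E) u.proj
  exact ⟨fr.ext A _ _, fr.ext_smooth _ _, fr.ext_eq fr.mem_dom p⟩

end DualBundle

/-! ### The bracket and the symplectic section in coordinates. -/

section BracketCoordinates

variable {EB : Type uB} [NormedAddCommGroup EB] [NormedSpace ℝ EB]
  {F : Type uF} [NormedAddCommGroup F] [NormedSpace ℝ F]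
  {M : Type uM} [TopologicalSpace M] [ChartedSpace EB M]
  [IsManifold 𝓘(ℝ, EB) ∞ M]
  {E : M → Type uE} [TopologicalSpace (TotalSpace F E)]
  [∀ x, AddCommGroup (E x)] [∀ x, Module ℝ (E x)] [∀ x, TopologicalSpace (E x)]
  [∀ x, IsTopologicalAddGroup (E x)] [∀ x, ContinuousSMul ℝ (E x)]
  [FiberBundle F E] [VectorBundle ℝ F E] [ContMDiffVectorBundle ∞ F E 𝓘(ℝ, EB)]
  {A : LieAlgebroid EB F E}
  [FiniteDimensional ℝ EB] [T2Space M] [FiniteDimensional ℝ F]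
  {x₀ : M} (fr : LocalFrame EB F E x₀)

theorem secThrough_apply (x : M) (a : E x) : secThrough (F := F) EB x a x = a := by
  obtain ⟨fr⟩ := exists_localFrame (EB := EB) (F := F) (E := E) x
  exact Classical.epsilon_spec (p := fun s : SmoothSec EB F E => s x = a)
    ⟨fr.sec (fibreCoord F E x x a), fr.sec_fibreCoord fr.mem_dom a⟩

/-- The change of components from the trivialization at `x₀` to the one at `x`. -/
def transition (F : Type uF) [NormedAddCommGroup F] [NormedSpace ℝ F] (E : M → Type uE)
    [TopologicalSpace (TotalSpace F E)]
    [∀ x, AddCommGroup (E x)] [∀ x, Module ℝ (E x)] [∀ x, TopologicalSpace (E x)]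
    [FiberBundle F E] [VectorBundle ℝ F E] (x₀ x y : M) : F →L[ℝ] F :=
  fibreCoord F E x y ∘L ofFibreCoord F E x₀ y

namespace LocalFrame

theorem transition_smooth (x : M) :
    ContMDiffOn 𝓘(ℝ, EB) 𝓘(ℝ, F →L[ℝ] F) ∞ (transition F E x₀ x)
      ((trivializationAt F E x).baseSet ∩ fr.dom) := by
  refine contMDiffOn_clm_of_apply fun v => ?_
  have h := (contMDiffOn_section_iff_fibreCoord (EB := EB) (s := fr.sec v)
    (((trivializationAt F E x).open_baseSet).inter fr.isOpen_dom) inter_subset_left).1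
    (fr.sec v).contMDiff.contMDiffOn
  refine h.congr fun y hy => ?_
  rw [fr.sec_apply, fr.cut_one y hy.2, one_smul]
  rfl

/-- Product rule for the change from the trivialization at `x₀` to the one at `τ u`. The term with
the derivative of the transition map involves only the value `Z u`, so it cancels in the difference
of two lifts that agree at `u`. -/
theorem coordDeriv_eq {Z : ∀ u : Dual F E, E u.proj} {u : Dual F E} (hu : u ∈ fr.ddom)
    (ρ : PSec A)
    (hZ : MDifferentiableAt (dualModel EB F) 𝓘(ℝ, F)
      (fun y : Dual F E => fibreCoord F E x₀ y.proj (Z y)) u) :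
    coordDeriv Z u (ρ.field u) =
      ρ.D (fun y : Dual F E => transition F E x₀ u.proj y.proj) u
        (fibreCoord F E x₀ u.proj (Z u)) +
      transition F E x₀ u.proj u.proj
        (ρ.D (fun y : Dual F E => fibreCoord F E x₀ y.proj (Z y)) u) := by
  have hx : u.proj ∈ (trivializationAt F E u.proj).baseSet :=
    FiberBundle.mem_baseSet_trivializationAt' u.proj
  have hO : IsOpen {y : Dual F E | y.proj ∈ (trivializationAt F E u.proj).baseSet ∩ fr.dom} :=
    ((trivializationAt F E u.proj).open_baseSet.inter fr.isOpen_dom).preimage continuous_proj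
  have hg : MDifferentiableAt (dualModel EB F) 𝓘(ℝ, F →L[ℝ] F)
      (fun y : Dual F E => transition F E x₀ u.proj y.proj) u :=
    contMDiff_toMDiff hO ((fr.transition_smooth u.proj).comp (proj_smooth _) fun _ h => h)
      ⟨hx, hu⟩
  have h1 : (fun y : Dual F E => (trivializationAt F E u.proj ⟨y.proj, Z y⟩).2) =ᶠ[𝓝 u]
      fun y => transition F E x₀ u.proj y.proj (fibreCoord F E x₀ y.proj (Z y)) := by
    filter_upwards [hO.mem_nhds ⟨hx, hu⟩] with y hy
    rw [← fibreCoord_eq hy.1]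
    change _ = fibreCoord F E u.proj y.proj (ofFibreCoord F E x₀ y.proj _)
    rw [ofFibreCoord_fibreCoord (fr.mem_baseSet hy.2)]
  exact (der_congr (I := dualModel EB F) (V := ρ.field) rfl h1).trans (der_clm_apply hg hZ)

theorem fibreCoord_ofFibreCoord_transition {u : Dual F E} (hu : u ∈ fr.ddom) (v : F) :
    fibreCoord F E x₀ u.proj (ofFibreCoord F E u.proj u.proj
      (transition F E x₀ u.proj u.proj v)) = v := by
  change fibreCoord F E x₀ u.proj (ofFibreCoord F E u.proj u.proj
    (fibreCoord F E u.proj u.proj (ofFibreCoord F E x₀ u.proj v))) = v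
  rw [ofFibreCoord_fibreCoord (FiberBundle.mem_baseSet_trivializationAt' u.proj),
    fibreCoord_ofFibreCoord (fr.mem_baseSet hu)]

/-- The auxiliary sections `s`, `t` agree with the given `E`-components at `u`, and the derivatives
of their components in `bracketBase` cancel those in `hat_bracket`; the result does not depend on
their choice. -/
theorem fibreCoord_bracketBase {ρ₁ ρ₂ : PSec A} {u : Dual F E} (hu : u ∈ fr.ddom)
    (h₁ : MDifferentiableAt (dualModel EB F) 𝓘(ℝ, F) (ρ₁.X x₀) u)
    (h₂ : MDifferentiableAt (dualModel EB F) 𝓘(ℝ, F) (ρ₂.X x₀) u) :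
    fibreCoord F E x₀ u.proj (bracketBase ρ₁ ρ₂ u) =
      fr.str A u.proj (ρ₁.X x₀ u) (ρ₂.X x₀ u) + ρ₁.D (ρ₂.X x₀) u - ρ₂.D (ρ₁.X x₀) u := by
  obtain ⟨s, hs, hs'⟩ : ∃ s, s = secThrough (F := F) EB u.proj (ρ₁.base u) ∧
    s u.proj = ρ₁.base u := ⟨_, rfl, secThrough_apply _ _⟩
  obtain ⟨t, ht, ht'⟩ : ∃ t, t = secThrough (F := F) EB u.proj (ρ₂.base u) ∧
    t u.proj = ρ₂.base u := ⟨_, rfl, secThrough_apply _ _⟩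
  have hat_s : fr.hat s u.proj = ρ₁.X x₀ u := congrArg (fibreCoord F E x₀ u.proj) hs'
  have hat_t : fr.hat t u.proj = ρ₂.X x₀ u := congrArg (fibreCoord F E x₀ u.proj) ht'
  have ds : MDifferentiableAt 𝓘(ℝ, EB) 𝓘(ℝ, F) (fr.hat s) u.proj :=
    contMDiff_toMDiff fr.isOpen_dom (fr.hat_smooth_dom s) hu
  have dt : MDifferentiableAt 𝓘(ℝ, EB) 𝓘(ℝ, F) (fr.hat t) u.proj :=
    contMDiff_toMDiff fr.isOpen_dom (fr.hat_smooth_dom t) hu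
  have hp : MDifferentiableAt (dualModel EB F) 𝓘(ℝ, EB) (fun y : Dual F E => y.proj) u :=
    (contMDiff_proj _).mdifferentiableAt (n := ∞) (by simp)
  have e1 := fr.coordDeriv_eq (Z := ρ₂.base) hu ρ₁ h₂
  have e2 := fr.coordDeriv_eq (Z := fun u' => t u'.proj) hu ρ₁ (dt.comp u hp)
  have e3 := fr.coordDeriv_eq (Z := ρ₁.base) hu ρ₂ h₁
  have e4 := fr.coordDeriv_eq (Z := fun u' => s u'.proj) hu ρ₂ (ds.comp u hp)
  have d2 := ρ₁.D_comp_proj_frame fr hu dt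
  have d4 := ρ₂.D_comp_proj_frame fr hu ds
  rw [← hat_s, ← fr.der_vf_eq A s _ hu] at d2
  rw [← hat_t, ← fr.der_vf_eq A t _ hu] at d4
  have hb := fr.hat_bracket A s t hu
  have key : bracketBase ρ₁ ρ₂ u = A.bracket s t u.proj + ofFibreCoord F E u.proj u.proj
      (transition F E x₀ u.proj u.proj
        ((ρ₁.D (ρ₂.X x₀) u - ρ₁.D (fun y : Dual F E => fr.hat t y.proj) u) -
          (ρ₂.D (ρ₁.X x₀) u - ρ₂.D (fun y : Dual F E => fr.hat s y.proj) u))) := by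
    unfold bracketBase
    rw [← hs, ← ht]
    have e5 : (coordDeriv ρ₂.base u (ρ₁.field u) -
          coordDeriv (fun u' => t u'.proj) u (ρ₁.field u)) -
        (coordDeriv ρ₁.base u (ρ₂.field u) -
          coordDeriv (fun u' => s u'.proj) u (ρ₂.field u)) =
        transition F E x₀ u.proj u.proj
          ((ρ₁.D (ρ₂.X x₀) u - ρ₁.D (fun y : Dual F E => fr.hat t y.proj) u) -
          (ρ₂.D (ρ₁.X x₀) u - ρ₂.D (fun y : Dual F E => fr.hat s y.proj) u)) := by
      rw [e1, e2, e3, e4, hs', ht', map_sub, map_sub, map_sub]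
      exact congrArg₂ (· - ·) (add_sub_add_left_eq_sub _ _ _) (add_sub_add_left_eq_sub _ _ _)
    simp only [e5]
    rw [ofFibreCoord, Trivialization.symmL_apply _
      (FiberBundle.mem_baseSet_trivializationAt' u.proj)]
  rw [key, map_add, fr.fibreCoord_ofFibreCoord_transition hu, d2, d4]
  change fr.hat (A.bracket s t) u.proj + _ = _
  rw [hb, hat_s, hat_t]
  abel

end LocalFrame

theorem PSec.D_proj_chart (ρ : PSec A) {u : Dual F E} (hu : u ∈ fr.ddom) :
    ρ.D (fun y : Dual F E => extChartAt 𝓘(ℝ, EB) x₀ y.proj) u = fr.anc A u.proj (ρ.X x₀ u) := by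
  rw [ρ.D_comp_proj (mdifferentiableAt_extChartAt (fr.mem_source hu))]
  exact (fr.anc_fibreCoord A hu _).symm

section Smooth

variable {W : Set (Dual F E)} (hW : IsOpen W) {ρ₁ ρ₂ : PSec A} (h₁ : ρ₁.SmoothOn W)
  (h₂ : ρ₂.SmoothOn W)

include hW in
theorem PSec.SmoothOn.X_mdiff (h₁ : ρ₁.SmoothOn W) {u : Dual F E} (hu : u ∈ W)
    (hu' : u ∈ fr.ddom) : MDifferentiableAt (dualModel EB F) 𝓘(ℝ, F) (ρ₁.X x₀) u :=
  contMDiff_toMDiff (hW.inter fr.isOpen_ddom) (h₁.X_smooth fr) ⟨hu, hu'⟩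

include hW in
theorem PSec.SmoothOn.P_mdiff (h₁ : ρ₁.SmoothOn W) {u : Dual F E} (hu : u ∈ W)
    (hu' : u ∈ fr.ddom) : MDifferentiableAt (dualModel EB F) 𝓘(ℝ, F →L[ℝ] ℝ) (ρ₁.P x₀) u :=
  contMDiff_toMDiff (hW.inter fr.isOpen_ddom) (h₁.P_smooth fr hW) ⟨hu, hu'⟩

theorem LocalFrame.str_proj_smooth :
    ContMDiffOn (dualModel EB F) 𝓘(ℝ, F →L[ℝ] F →L[ℝ] F) ∞
      (fun y : Dual F E => fr.str A y.proj) fr.ddom :=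
  (fr.str_smooth A).comp (proj_smooth _) fun _ h => h

theorem LocalFrame.str_proj_mdiff {u : Dual F E} (hu : u ∈ fr.ddom) :
    MDifferentiableAt (dualModel EB F) 𝓘(ℝ, F →L[ℝ] F →L[ℝ] F)
      (fun y : Dual F E => fr.str A y.proj) u :=
  contMDiff_toMDiff fr.isOpen_ddom fr.str_proj_smooth hu

theorem LocalFrame.anc_proj_mdiff {u : Dual F E} (hu : u ∈ fr.ddom) :
    MDifferentiableAt (dualModel EB F) 𝓘(ℝ, F →L[ℝ] EB)
      (fun y : Dual F E => fr.anc A y.proj) u :=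
  contMDiff_toMDiff fr.isOpen_ddom ((fr.anc_smooth A).comp (proj_smooth _) fun _ h => h) hu

include hW h₁ h₂

/-- The projected bracket is tested on the chart of `M`, where it is a commutator. Its terms with
derivatives of the anchor are matched by `anc_str`. Consequently `pbracket` never takes its default
value on smooth sections. -/
theorem bracket_mem {u : Dual F E} (hu : u ∈ W) :
    (bracketBase ρ₁ ρ₂ u, mlieBracket (dualModel EB F) ρ₁.field ρ₂.field u) ∈ Prolong A u := by
  obtain ⟨fr⟩ := exists_localFrame (EB := EB) (F := F) (E := E) u.proj
  have hu' : u ∈ fr.ddom := fr.mem_dom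
  have hO := hW.inter fr.isOpen_ddom
  change A.anchor u.proj (bracketBase ρ₁ ρ₂ u) =
    dProj u (mlieBracket (dualModel EB F) ρ₁.field ρ₂.field u)
  apply mfderiv_chart_injective (fr.mem_source hu')
  have d₁ := h₁.X_mdiff fr hW hu hu'
  have d₂ := h₂.X_mdiff fr hW hu hu'
  have hφ : MDifferentiableAt 𝓘(ℝ, EB) 𝓘(ℝ, EB) (extChartAt 𝓘(ℝ, EB) u.proj) u.proj :=
    mdifferentiableAt_extChartAt (fr.mem_source hu')
  have hφ' : ContMDiffOn (dualModel EB F) 𝓘(ℝ, EB) ∞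
      (fun y : Dual F E => extChartAt 𝓘(ℝ, EB) u.proj y.proj) (W ∩ fr.ddom) :=
    LocalFrame.chart_smooth.comp (proj_smooth _) fun y hy => fr.mem_source hy.2
  rw [← mfderiv_comp_proj hφ]
  refine (fr.anc_fibreCoord A hu' _).symm.trans ?_
  rw [fr.fibreCoord_bracketBase hu' d₁ d₂]
  have key : ∀ ρ σ : PSec A, MDifferentiableAt (dualModel EB F) 𝓘(ℝ, F) (σ.X u.proj) u →
      der (dualModel EB F) ρ.field (der (dualModel EB F) σ.field
        (fun y : Dual F E => extChartAt 𝓘(ℝ, EB) u.proj y.proj)) u =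
      fr.conDer A (ρ.X u.proj u) (fr.anc A) u.proj (σ.X u.proj u) +
        fr.anc A u.proj (ρ.D (σ.X u.proj) u) := by
    intro ρ σ hσ
    have e : der (dualModel EB F) σ.field
        (fun y : Dual F E => extChartAt 𝓘(ℝ, EB) u.proj y.proj) =ᶠ[𝓝 u]
        fun y => fr.anc A y.proj (σ.X u.proj y) := by
      filter_upwards [fr.isOpen_ddom.mem_nhds hu'] with y hy
      exact σ.D_proj_chart fr hy
    refine (der_congr rfl e).trans ((der_clm_apply (fr.anc_proj_mdiff hu') hσ).trans ?_)
    have := ρ.D_comp_proj_frame fr hu'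
      (contMDiff_toMDiff fr.isOpen_dom (fr.anc_smooth A) hu')
    exact congrArg (fun L : F →L[ℝ] EB => L (σ.X u.proj u) + fr.anc A u.proj (ρ.D (σ.X u.proj) u))
      this
  refine Eq.trans ?_ (der_mlieBracket hO (h₁.mono inter_subset_left).2
    (h₂.mono inter_subset_left).2 hφ' ⟨hu, hu'⟩).symm
  rw [key ρ₁ ρ₂ d₂, key ρ₂ ρ₁ d₁, map_sub, map_add, fr.anc_str A hu']
  abel

theorem pbracket_base {u : Dual F E} (hu : u ∈ W) :
    (pbracket ρ₁ ρ₂).base u = bracketBase ρ₁ ρ₂ u := by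
  simp only [PSec.base, pbracket, dif_pos (bracket_mem hW h₁ h₂ hu)]

theorem pbracket_field {u : Dual F E} (hu : u ∈ W) :
    (pbracket ρ₁ ρ₂).field u = mlieBracket (dualModel EB F) ρ₁.field ρ₂.field u := by
  simp only [PSec.field, pbracket, dif_pos (bracket_mem hW h₁ h₂ hu)]

theorem X_pbracket {u : Dual F E} (hu : u ∈ W) (hu' : u ∈ fr.ddom) :
    (pbracket ρ₁ ρ₂).X x₀ u =
      fr.str A u.proj (ρ₁.X x₀ u) (ρ₂.X x₀ u) + ρ₁.D (ρ₂.X x₀) u - ρ₂.D (ρ₁.X x₀) u := by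
  refine Eq.trans ?_ (fr.fibreCoord_bracketBase hu' (h₁.X_mdiff fr hW hu hu')
    (h₂.X_mdiff fr hW hu hu'))
  rw [← pbracket_base hW h₁ h₂ hu]
  rfl

theorem D_pbracket {G : Type*} [NormedAddCommGroup G] [NormedSpace ℝ G] {f : Dual F E → G}
    {O : Set (Dual F E)} (hO : IsOpen O) (hf : ContMDiffOn (dualModel EB F) 𝓘(ℝ, G) ∞ f O)
    {u : Dual F E} (hu : u ∈ W) (huO : u ∈ O) :
    (pbracket ρ₁ ρ₂).D f u = ρ₁.D (ρ₂.D f) u - ρ₂.D (ρ₁.D f) u := by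
  refine Eq.trans ?_ (der_mlieBracket (hW.inter hO) (h₁.mono inter_subset_left).2
    (h₂.mono inter_subset_left).2 (hf.mono inter_subset_right) ⟨hu, huO⟩)
  exact der_congr (pbracket_field hW h₁ h₂ hu) (Filter.EventuallyEq.refl _ _)

theorem P_pbracket {u : Dual F E} (hu : u ∈ W) (hu' : u ∈ fr.ddom) :
    (pbracket ρ₁ ρ₂).P x₀ u = ρ₁.D (ρ₂.P x₀) u - ρ₂.D (ρ₁.P x₀) u :=
  D_pbracket hW h₁ h₂ fr.isOpen_ddom fr.mom_smooth hu hu'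

theorem pbracket_smooth : (pbracket ρ₁ ρ₂).SmoothOn W := by
  refine PSec.smoothOn_of_local fun u hu => ?_
  obtain ⟨fr⟩ := exists_localFrame (EB := EB) (F := F) (E := E) u.proj
  have hO := hW.inter fr.isOpen_ddom
  have k₁ := h₁.mono (W' := W ∩ fr.ddom) inter_subset_left
  have k₂ := h₂.mono (W' := W ∩ fr.ddom) inter_subset_left
  refine ⟨fr.ddom, fr.isOpen_ddom, fr.mem_dom,
    PSec.smoothOn_of_coord fr hO inter_subset_right ?_ ?_⟩
  · have e : ContMDiffOn (dualModel EB F) 𝓘(ℝ, F) ∞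
        (fun y => fr.str A y.proj (ρ₁.X u.proj y) (ρ₂.X u.proj y) + ρ₁.D (ρ₂.X u.proj) y -
          ρ₂.D (ρ₁.X u.proj) y) (W ∩ fr.ddom) :=
      ((((fr.str_proj_smooth.mono inter_subset_right).clm_apply (h₁.X_smooth fr)).clm_apply
        (h₂.X_smooth fr)).add (PSec.D_smooth hO k₁ (h₂.X_smooth fr))).sub
        (PSec.D_smooth hO k₂ (h₁.X_smooth fr))
    exact e.congr fun y hy => X_pbracket fr hW h₁ h₂ hy.1 hy.2
  · have e : ContMDiffOn (dualModel EB F) 𝓘(ℝ, F →L[ℝ] ℝ) ∞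
        (fun y => ρ₁.D (ρ₂.P u.proj) y - ρ₂.D (ρ₁.P u.proj) y) (W ∩ fr.ddom) :=
      (PSec.D_smooth hO k₁ (h₂.P_smooth fr hW)).sub (PSec.D_smooth hO k₂ (h₁.P_smooth fr hW))
    exact e.congr fun y hy => P_pbracket fr hW h₁ h₂ hy.1 hy.2

end Smooth

theorem liouville_eq (ρ : PSec A) {u : Dual F E} (hu : u ∈ fr.ddom) :
    liouville ρ u = mom x₀ u (ρ.X x₀ u) :=
  (mom_fibreCoord (fr.mem_baseSet hu) _).symm

theorem liouville_smooth {W : Set (Dual F E)} {ρ : PSec A} (h : ρ.SmoothOn W) :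
    ContMDiffOn (dualModel EB F) 𝓘(ℝ, ℝ) ∞ (liouville ρ) W := by
  intro u hu
  obtain ⟨fr⟩ := exists_localFrame (EB := EB) (F := F) (E := E) u.proj
  have h1 : ContMDiffOn (dualModel EB F) 𝓘(ℝ, ℝ) ∞
      (fun y => mom u.proj y (ρ.X u.proj y)) (W ∩ fr.ddom) :=
    (fr.mom_smooth.mono inter_subset_right).clm_apply (h.X_smooth fr)
  exact ((h1.congr fun y hy => liouville_eq fr ρ hy.2) u ⟨hu, fr.mem_dom⟩).mono_of_mem_nhdsWithin
    (Filter.inter_mem self_mem_nhdsWithin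
      (mem_nhdsWithin_of_mem_nhds (fr.isOpen_ddom.mem_nhds fr.mem_dom)))

theorem act_liouville {W : Set (Dual F E)} (hW : IsOpen W) {ρ₁ ρ₂ : PSec A}
    (h₂ : ρ₂.SmoothOn W) {u : Dual F E} (hu : u ∈ W) (hu' : u ∈ fr.ddom) :
    ρ₁.act (liouville ρ₂) u = ρ₁.P x₀ u (ρ₂.X x₀ u) + mom x₀ u (ρ₁.D (ρ₂.X x₀) u) := by
  have e : liouville ρ₂ =ᶠ[𝓝 u] fun y => mom x₀ y (ρ₂.X x₀ y) := by
    filter_upwards [fr.isOpen_ddom.mem_nhds hu'] with y hy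
    exact liouville_eq fr ρ₂ hy
  exact (der_congr (V := ρ₁.field) rfl e).trans (der_clm_apply
    (contMDiff_toMDiff fr.isOpen_ddom fr.mom_smooth hu') (h₂.X_mdiff fr hW hu hu'))

/-- The derivatives of `X₁` and `X₂` cancel between the Liouville terms and the bracket, so `ω`
depends only on the values of the sections at `u`. -/
theorem symplectic_eq {W : Set (Dual F E)} (hW : IsOpen W) {ρ₁ ρ₂ : PSec A}
    (h₁ : ρ₁.SmoothOn W) (h₂ : ρ₂.SmoothOn W) {u : Dual F E} (hu : u ∈ W) (hu' : u ∈ fr.ddom) :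
    symplectic ρ₁ ρ₂ u = ρ₂.P x₀ u (ρ₁.X x₀ u) - ρ₁.P x₀ u (ρ₂.X x₀ u) +
      mom x₀ u (fr.str A u.proj (ρ₁.X x₀ u) (ρ₂.X x₀ u)) := by
  unfold symplectic
  rw [act_liouville fr hW h₂ hu hu', act_liouville fr hW h₁ hu hu', liouville_eq fr _ hu',
    X_pbracket fr hW h₁ h₂ hu hu', map_sub, map_add]
  ring

end BracketCoordinates

/-! ### The symplectic section is closed. -/

section Closed

variable {EB : Type uB} [NormedAddCommGroup EB] [NormedSpace ℝ EB]
  {F : Type uF} [NormedAddCommGroup F] [NormedSpace ℝ F]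
  {M : Type uM} [TopologicalSpace M] [ChartedSpace EB M]
  [IsManifold 𝓘(ℝ, EB) ∞ M]
  {E : M → Type uE} [TopologicalSpace (TotalSpace F E)]
  [∀ x, AddCommGroup (E x)] [∀ x, Module ℝ (E x)] [∀ x, TopologicalSpace (E x)]
  [∀ x, IsTopologicalAddGroup (E x)] [∀ x, ContinuousSMul ℝ (E x)]
  [FiberBundle F E] [VectorBundle ℝ F E] [ContMDiffVectorBundle ∞ F E 𝓘(ℝ, EB)]
  {A : LieAlgebroid EB F E}
  [FiniteDimensional ℝ EB] [T2Space M] [FiniteDimensional ℝ F]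
  {x₀ : M} (fr : LocalFrame EB F E x₀)
  {W : Set (Dual F E)} (hW : IsOpen W) {ρ₁ ρ₂ ρ₃ : PSec A} (h₁ : ρ₁.SmoothOn W)
  (h₂ : ρ₂.SmoothOn W) (h₃ : ρ₃.SmoothOn W)

theorem PSec.D_congr {G : Type*} [NormedAddCommGroup G] [NormedSpace ℝ G] (ρ : PSec A)
    {f g : Dual F E → G} {u : Dual F E} (h : f =ᶠ[𝓝 u] g) : ρ.D f u = ρ.D g u :=
  der_congr rfl h

/-- The derivative of the structure functions along a section of the prolongation. -/
def LocalFrame.Dstr (ρ : PSec A) (u : Dual F E) : F →L[ℝ] F →L[ℝ] F :=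
  fr.conDer A (ρ.X x₀ u) (fr.str A) u.proj

include hW h₁ h₂ h₃

theorem D_X_pbracket {u : Dual F E} (hu : u ∈ W) (hu' : u ∈ fr.ddom) :
    ρ₃.D ((pbracket ρ₁ ρ₂).X x₀) u =
      fr.Dstr ρ₃ u (ρ₁.X x₀ u) (ρ₂.X x₀ u) +
      fr.str A u.proj (ρ₃.D (ρ₁.X x₀) u) (ρ₂.X x₀ u) +
      fr.str A u.proj (ρ₁.X x₀ u) (ρ₃.D (ρ₂.X x₀) u) +
      ρ₃.D (ρ₁.D (ρ₂.X x₀)) u - ρ₃.D (ρ₂.D (ρ₁.X x₀)) u := by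
  have hO := hW.inter fr.isOpen_ddom
  have k₁ := h₁.mono (W' := W ∩ fr.ddom) inter_subset_left
  have k₂ := h₂.mono (W' := W ∩ fr.ddom) inter_subset_left
  have d₁ := h₁.X_mdiff fr hW hu hu'
  have d₂ := h₂.X_mdiff fr hW hu hu'
  have d₁₂ := contMDiff_toMDiff hO (PSec.D_smooth hO k₁ (h₂.X_smooth fr)) ⟨hu, hu'⟩
  have d₂₁ := contMDiff_toMDiff hO (PSec.D_smooth hO k₂ (h₁.X_smooth fr)) ⟨hu, hu'⟩
  have ds := fr.str_proj_mdiff (A := A) hu'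
  have ds₁ : MDifferentiableAt (dualModel EB F) 𝓘(ℝ, F →L[ℝ] F)
      (fun y : Dual F E => fr.str A y.proj (ρ₁.X x₀ y)) u :=
    contMDiff_toMDiff hO ((fr.str_proj_smooth.mono inter_subset_right).clm_apply
      (h₁.X_smooth fr)) ⟨hu, hu'⟩
  have ds₂ : MDifferentiableAt (dualModel EB F) 𝓘(ℝ, F)
      (fun y : Dual F E => fr.str A y.proj (ρ₁.X x₀ y) (ρ₂.X x₀ y)) u :=
    contMDiff_toMDiff hO (((fr.str_proj_smooth.mono inter_subset_right).clm_apply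
      (h₁.X_smooth fr)).clm_apply (h₂.X_smooth fr)) ⟨hu, hu'⟩
  have e : (pbracket ρ₁ ρ₂).X x₀ =ᶠ[𝓝 u] fun y =>
      fr.str A y.proj (ρ₁.X x₀ y) (ρ₂.X x₀ y) + ρ₁.D (ρ₂.X x₀) y - ρ₂.D (ρ₁.X x₀) y := by
    filter_upwards [hO.mem_nhds ⟨hu, hu'⟩] with y hy
    exact X_pbracket fr hW h₁ h₂ hy.1 hy.2
  have e0 : ρ₃.D (fun y : Dual F E => fr.str A y.proj) u = fr.Dstr ρ₃ u :=
    ρ₃.D_comp_proj_frame fr hu' (contMDiff_toMDiff fr.isOpen_dom (fr.str_smooth A) hu')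
  have e1 : ρ₃.D (fun y : Dual F E => fr.str A y.proj (ρ₁.X x₀ y)) u =
      fr.Dstr ρ₃ u (ρ₁.X x₀ u) + fr.str A u.proj (ρ₃.D (ρ₁.X x₀) u) := by
    rw [← e0]
    exact der_clm_apply ds d₁
  have e2 : ρ₃.D (fun y : Dual F E => fr.str A y.proj (ρ₁.X x₀ y) (ρ₂.X x₀ y)) u =
      ρ₃.D (fun y : Dual F E => fr.str A y.proj (ρ₁.X x₀ y)) u (ρ₂.X x₀ u) +
        fr.str A u.proj (ρ₁.X x₀ u) (ρ₃.D (ρ₂.X x₀) u) :=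
    der_clm_apply ds₁ d₂
  rw [ρ₃.D_congr e]
  refine (der_sub (ds₂.add d₁₂) d₂₁).trans ?_
  refine congrArg (· - ρ₃.D (ρ₂.D (ρ₁.X x₀)) u) ?_
  refine (der_add ds₂ d₁₂).trans ?_
  refine congrArg (· + ρ₃.D (ρ₁.D (ρ₂.X x₀)) u) ?_
  refine e2.trans ?_
  rw [e1, add_apply]

theorem X_pbracket_pbracket {u : Dual F E} (hu : u ∈ W) (hu' : u ∈ fr.ddom) :
    (pbracket (pbracket ρ₁ ρ₂) ρ₃).X x₀ u =
      fr.str A u.proj (fr.str A u.proj (ρ₁.X x₀ u) (ρ₂.X x₀ u) + ρ₁.D (ρ₂.X x₀) u -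
        ρ₂.D (ρ₁.X x₀) u) (ρ₃.X x₀ u) +
      (ρ₁.D (ρ₂.D (ρ₃.X x₀)) u - ρ₂.D (ρ₁.D (ρ₃.X x₀)) u) -
      (fr.Dstr ρ₃ u (ρ₁.X x₀ u) (ρ₂.X x₀ u) +
        fr.str A u.proj (ρ₃.D (ρ₁.X x₀) u) (ρ₂.X x₀ u) +
        fr.str A u.proj (ρ₁.X x₀ u) (ρ₃.D (ρ₂.X x₀) u) +
        ρ₃.D (ρ₁.D (ρ₂.X x₀)) u - ρ₃.D (ρ₂.D (ρ₁.X x₀)) u) := by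
  rw [X_pbracket fr hW (pbracket_smooth hW h₁ h₂) h₃ hu hu', X_pbracket fr hW h₁ h₂ hu hu',
    D_X_pbracket fr hW h₁ h₂ h₃ hu hu',
    D_pbracket hW h₁ h₂ (hW.inter fr.isOpen_ddom) (h₃.X_smooth fr) hu ⟨hu, hu'⟩]

/-- In the cyclic sum the second derivatives cancel in pairs, the products of `C` with first
derivatives cancel by skewness of `C`, and what remains is the Jacobi identity for the structure
functions. -/
theorem liouville_jacobi {u : Dual F E} (hu : u ∈ W) :
    liouville (pbracket (pbracket ρ₁ ρ₂) ρ₃) u + liouville (pbracket (pbracket ρ₂ ρ₃) ρ₁) u +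
      liouville (pbracket (pbracket ρ₃ ρ₁) ρ₂) u = 0 := by
  obtain ⟨fr⟩ := exists_localFrame (EB := EB) (F := F) (E := E) u.proj
  have hu' : u ∈ fr.ddom := fr.mem_dom
  rw [liouville_eq fr _ hu', liouville_eq fr _ hu', liouville_eq fr _ hu', ← map_add, ← map_add,
    X_pbracket_pbracket fr hW h₁ h₂ h₃ hu hu', X_pbracket_pbracket fr hW h₂ h₃ h₁ hu hu',
    X_pbracket_pbracket fr hW h₃ h₁ h₂ hu hu']
  have hj := fr.jacobi A hu' (ρ₁.X u.proj u) (ρ₂.X u.proj u) (ρ₃.X u.proj u)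
  have sk := fun v w => fr.str_skew A u.proj v w
  refine (congrArg _ ?_).trans (map_zero _)
  simp only [map_add, map_sub, add_apply, sub_apply]
  rw [sk (fr.str A u.proj (ρ₁.X u.proj u) (ρ₂.X u.proj u)),
    sk (fr.str A u.proj (ρ₂.X u.proj u) (ρ₃.X u.proj u)),
    sk (fr.str A u.proj (ρ₃.X u.proj u) (ρ₁.X u.proj u)),
    sk (ρ₁.D (ρ₂.X u.proj) u), sk (ρ₂.D (ρ₁.X u.proj) u),
    sk (ρ₁.D (ρ₃.X u.proj) u), sk (ρ₃.D (ρ₁.X u.proj) u),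
    sk (ρ₂.D (ρ₃.X u.proj) u), sk (ρ₃.D (ρ₂.X u.proj) u)]
  rw [← neg_eq_zero, ← hj]
  unfold LocalFrame.Dstr
  abel

/-- This is `dω = 0` in Koszul form. Since `ω = -dθ`, it is an instance of `d² = 0`, and only the
Jacobi identity evaluated by `θ` is needed. -/
theorem symplectic_closed {u : Dual F E} (hu : u ∈ W) :
    ρ₁.act (symplectic ρ₂ ρ₃) u + ρ₂.act (symplectic ρ₃ ρ₁) u + ρ₃.act (symplectic ρ₁ ρ₂) u =
      symplectic (pbracket ρ₁ ρ₂) ρ₃ u + symplectic (pbracket ρ₂ ρ₃) ρ₁ u +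
        symplectic (pbracket ρ₃ ρ₁) ρ₂ u := by
  have key : ∀ {ρ σ τ : PSec A}, ρ.SmoothOn W → σ.SmoothOn W → τ.SmoothOn W →
      ρ.act (symplectic σ τ) u = -(ρ.D (σ.D (liouville τ)) u - ρ.D (τ.D (liouville σ)) u -
        ρ.D (liouville (pbracket σ τ)) u) := by
    intro ρ σ τ _ hσ hτ
    have c1 := contMDiff_toMDiff hW (PSec.D_smooth hW hσ (liouville_smooth hτ)) hu
    have c2 := contMDiff_toMDiff hW (PSec.D_smooth hW hτ (liouville_smooth hσ)) hu
    have c3 := contMDiff_toMDiff hW (liouville_smooth (pbracket_smooth hW hσ hτ)) hu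
    refine (der_neg (V := ρ.field) ((c1.sub c2).sub c3)).trans (congrArg Neg.neg ?_)
    exact (der_sub (c1.sub c2) c3).trans
      (congrArg (· - ρ.D (liouville (pbracket σ τ)) u) (der_sub c1 c2))
  have key' : ∀ {ρ σ τ : PSec A}, ρ.SmoothOn W → σ.SmoothOn W → τ.SmoothOn W →
      symplectic (pbracket ρ σ) τ u = -(ρ.D (σ.D (liouville τ)) u - σ.D (ρ.D (liouville τ)) u -
        τ.D (liouville (pbracket ρ σ)) u - liouville (pbracket (pbracket ρ σ) τ) u) := by
    intro ρ σ τ hρ hσ hτ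
    rw [← D_pbracket hW hρ hσ hW (liouville_smooth hτ) hu hu]
    rfl
  rw [key h₁ h₂ h₃, key h₂ h₃ h₁, key h₃ h₁ h₂, key' h₁ h₂ h₃, key' h₂ h₃ h₁, key' h₃ h₁ h₂]
  linarith [liouville_jacobi hW h₁ h₂ h₃ hu]

end Closed

/-! ### Vertical lifts and the fibre Hessian in a frame. -/

section Hessian

variable {EB : Type uB} [NormedAddCommGroup EB] [NormedSpace ℝ EB]
  {F : Type uF} [NormedAddCommGroup F] [NormedSpace ℝ F]
  {M : Type uM} [TopologicalSpace M] [ChartedSpace EB M]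
  [IsManifold 𝓘(ℝ, EB) ∞ M]
  {E : M → Type uE} [TopologicalSpace (TotalSpace F E)]
  [∀ x, AddCommGroup (E x)] [∀ x, Module ℝ (E x)] [∀ x, TopologicalSpace (E x)]
  [∀ x, IsTopologicalAddGroup (E x)] [∀ x, ContinuousSMul ℝ (E x)]
  [FiberBundle F E] [VectorBundle ℝ F E] [ContMDiffVectorBundle ∞ F E 𝓘(ℝ, EB)]
  {A : LieAlgebroid EB F E}
  [FiniteDimensional ℝ EB] [T2Space M] [FiniteDimensional ℝ F]
  {x₀ : M} (fr : LocalFrame EB F E x₀)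
  {W : Set (Dual F E)} (hW : IsOpen W)

theorem vertCurve_smooth (u : Dual F E) (ξ : E u.proj →L[ℝ] ℝ) :
    ContMDiff 𝓘(ℝ, ℝ) (dualModel EB F) ∞
      (fun r : ℝ => (⟨u.proj, u.snd + r • ξ⟩ : Dual F E)) := by
  have hx : u.proj ∈ (trivializationAt F E u.proj).baseSet :=
    FiberBundle.mem_baseSet_trivializationAt' u.proj
  rw [← contMDiffOn_univ, (trivializationAt (F →L[ℝ] ℝ)
    (fun x : M => E x →L[ℝ] Bundle.Trivial M ℝ x) u.proj).contMDiffOn_iff (IB := 𝓘(ℝ, EB))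
    (fun r _ => by rw [Trivialization.mem_source, dual_baseSet]; exact hx)]
  refine ⟨contMDiffOn_const, ?_⟩
  have h : ContMDiffOn 𝓘(ℝ, ℝ) 𝓘(ℝ, F →L[ℝ] ℝ) ∞ (fun r : ℝ => mom u.proj u +
      r • (ξ ∘L ofFibreCoord F E u.proj u.proj : F →L[ℝ] ℝ)) univ :=
    (contDiff_const.add (contDiff_id.smul contDiff_const)).contMDiff.contMDiffOn
  refine h.congr fun r _ => ?_
  rw [mom_eq]
  rfl

theorem mfderiv_vertLift {G : Type*} [NormedAddCommGroup G] [NormedSpace ℝ G] {f : Dual F E → G}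
    {u : Dual F E} (hf : MDifferentiableAt (dualModel EB F) 𝓘(ℝ, G) f u)
    (ξ : E u.proj →L[ℝ] ℝ) :
    mfderiv (dualModel EB F) 𝓘(ℝ, G) f u (vertLift EB u ξ) =
      deriv (fun r : ℝ => f ⟨u.proj, u.snd + r • ξ⟩) 0 := by
  have hc : MDifferentiableAt 𝓘(ℝ, ℝ) (dualModel EB F)
      (fun r : ℝ => (⟨u.proj, u.snd + r • ξ⟩ : Dual F E)) 0 :=
    (vertCurve_smooth u ξ).mdifferentiableAt (by simp)
  -- The curve starts at `u` only up to this equation, so the chain rule has to be stated at the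
  -- unsimplified point.
  have h0 : (⟨u.proj, u.snd + (0 : ℝ) • ξ⟩ : Dual F E) = u := by
    rw [zero_smul, add_zero]
  have hf' : MDifferentiableAt (dualModel EB F) 𝓘(ℝ, G) f
      (⟨u.proj, u.snd + (0 : ℝ) • ξ⟩ : Dual F E) := by rwa [h0]
  have h1 := mfderiv_comp_apply (0 : ℝ) hf' hc (1 : ℝ)
  rw [mfderiv_eq_fderiv] at h1
  have h2 : fderiv ℝ (fun r : ℝ => f ⟨u.proj, u.snd + r • ξ⟩) 0 1 =
      deriv (fun r : ℝ => f ⟨u.proj, u.snd + r • ξ⟩) 0 := fderiv_apply_one_eq_deriv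
  refine Eq.trans ?_ (h1.symm.trans h2)
  unfold vertLift
  congr 1
  rw [h0]

theorem dProj_vertLift (u : Dual F E) (ξ : E u.proj →L[ℝ] ℝ) :
    dProj u (vertLift EB u ξ) = 0 := by
  have hφ : MDifferentiableAt 𝓘(ℝ, EB) 𝓘(ℝ, EB) (extChartAt 𝓘(ℝ, EB) u.proj) u.proj :=
    mdifferentiableAt_extChartAt (mem_chart_source EB u.proj)
  have hp : MDifferentiableAt (dualModel EB F) 𝓘(ℝ, EB) (fun y : Dual F E => y.proj) u :=
    (contMDiff_proj _).mdifferentiableAt (n := ∞) (by simp)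
  apply mfderiv_chart_injective (mem_chart_source EB u.proj)
  have h : mfderiv (dualModel EB F) 𝓘(ℝ, EB)
      (fun y : Dual F E => extChartAt 𝓘(ℝ, EB) u.proj y.proj) u (vertLift EB u ξ) = 0 :=
    (mfderiv_vertLift (hφ.comp u hp) ξ).trans
      (deriv_const (0 : ℝ) (extChartAt 𝓘(ℝ, EB) u.proj u.proj))
  exact (mfderiv_comp_proj hφ _).symm.trans (h.trans (ContinuousLinearMap.map_zero _).symm)

variable (A) in
/-- The vertical element `(0, ξ^v)` of the prolongation. -/
def vertElem (u : Dual F E) (ξ : E u.proj →L[ℝ] ℝ) : Prolong A u :=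
  ⟨(0, vertLift EB u ξ), ((A.anchor u.proj).map_zero).trans (dProj_vertLift u ξ).symm⟩

theorem crdX_vertElem (x₀ : M) (u : Dual F E) (ξ : E u.proj →L[ℝ] ℝ) :
    crdX x₀ u (vertElem A u ξ) = 0 := (fibreCoord F E x₀ u.proj).map_zero

theorem crdP_vertElem {u : Dual F E} (hu : u.proj ∈ (trivializationAt F E x₀).baseSet)
    (ξ : E u.proj →L[ℝ] ℝ) :
    crdP x₀ u (vertElem A u ξ) = ξ ∘L ofFibreCoord F E x₀ u.proj := by
  have hm : MDifferentiableAt (dualModel EB F) 𝓘(ℝ, F →L[ℝ] ℝ)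
      (mom x₀ : Dual F E → F →L[ℝ] ℝ) u :=
    contMDiff_toMDiff ((trivializationAt F E x₀).open_baseSet.preimage continuous_proj)
      (mom_smooth x₀) hu
  refine (mfderiv_vertLift hm ξ).trans ?_
  have h := ((hasDerivAt_id (0 : ℝ)).smul_const
    (ξ ∘L ofFibreCoord F E x₀ u.proj : F →L[ℝ] ℝ)).const_add (mom x₀ u)
  exact h.deriv.trans (one_smul _ _)

theorem mem_vertical_iff {u : Dual F E} (hu : u ∈ fr.ddom) {p : Prolong A u} :
    p ∈ vertical A u ↔ crdX x₀ u p = 0 := by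
  refine ⟨fun h => ?_, fun h => ?_⟩
  · exact (congrArg (fibreCoord F E x₀ u.proj) (show p.1.1 = 0 from h)).trans (map_zero _)
  · exact fibreCoord_injective (F := F) (fr.mem_baseSet hu)
      (Eq.trans (show fibreCoord F E x₀ u.proj p.1.1 = 0 from h) (map_zero _).symm)

theorem eq_vertElem {u : Dual F E} (hu : u ∈ fr.ddom) {p : Prolong A u} (hp : p ∈ vertical A u) :
    p = vertElem A u (crdP x₀ u p ∘L fibreCoord F E x₀ u.proj) := by
  refine prolong_ext (fr.mem_chartDom hu) ?_ ?_
  · rw [(mem_vertical_iff fr hu).1 hp, crdX_vertElem]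
  · rw [crdP_vertElem (fr.mem_baseSet hu)]
    ext w
    exact congrArg (crdP x₀ u p) (fibreCoord_ofFibreCoord (fr.mem_baseSet hu) w).symm

include A in
theorem vertLift_injective (u : Dual F E) :
    Function.Injective (vertLift EB u : (E u.proj →L[ℝ] ℝ) → _) := by
  intro ξ η h
  have hx : u.proj ∈ (trivializationAt F E u.proj).baseSet :=
    FiberBundle.mem_baseSet_trivializationAt' u.proj
  have h1 : vertElem A u ξ = vertElem A u η := Subtype.ext (Prod.ext rfl h)
  have h2 := congrArg (crdP u.proj u) h1
  rw [crdP_vertElem hx, crdP_vertElem hx] at h2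
  ext a
  have h3 := DFunLike.congr_fun h2 (fibreCoord F E u.proj u.proj a)
  change ξ (ofFibreCoord F E u.proj u.proj (fibreCoord F E u.proj u.proj a)) =
    η (ofFibreCoord F E u.proj u.proj (fibreCoord F E u.proj u.proj a)) at h3
  rwa [ofFibreCoord_fibreCoord hx] at h3

/-- The metric is defined through `Function.invFun`. As the vertical lift is injective and every
vertical element is a lift, this yields the true covector, given by the momentum component. -/
theorem invFun_vertLift {u : Dual F E} (hu : u ∈ fr.ddom) {p : Prolong A u}
    (hp : p ∈ vertical A u) :
    Function.invFun (vertLift EB u) p.1.2 = crdP x₀ u p ∘L fibreCoord F E x₀ u.proj := by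
  have h : p.1.2 = vertLift EB u (crdP x₀ u p ∘L fibreCoord F E x₀ u.proj) :=
    congrArg (fun q : Prolong A u => q.1.2) (eq_vertElem fr hu hp)
  rw [h]
  exact Function.leftInverse_invFun (vertLift_injective (A := A) u) _

section Partial

variable {G : Type*} [NormedAddCommGroup G] [NormedSpace ℝ G]

/-- The derivative of a function at a point, as a linear map on the prolongation. -/
def prolongDeriv (A : LieAlgebroid EB F E) (f : Dual F E → G) (u : Dual F E) :
    Prolong A u →ₗ[ℝ] G :=
  (mfderiv (dualModel EB F) 𝓘(ℝ, G) f u).toLinearMap ∘ₗ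
    (LinearMap.snd ℝ (E u.proj) (TangentSpace (dualModel EB F) u)) ∘ₗ (Prolong A u).subtype

theorem PSec.D_eq_prolongDeriv (ρ : PSec A) (f : Dual F E → G) (u : Dual F E) :
    ρ.D f u = prolongDeriv A f u (ρ u) := rfl

namespace LocalFrame

theorem ext_add {u : Dual F E} (hu : u ∈ fr.ddom) (w w' : F) (b b' : F →L[ℝ] ℝ) :
    fr.ext A (w + w') (b + b') u = fr.ext A w b u + fr.ext A w' b' u := by
  refine prolong_ext (fr.mem_chartDom hu) ?_ ?_
  · rw [map_add]
    exact (fr.ext_X _ _ hu).trans (congrArg₂ (· + ·) (fr.ext_X _ _ hu) (fr.ext_X _ _ hu)).symm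
  · rw [map_add]
    exact (fr.ext_P _ _ hu).trans (congrArg₂ (· + ·) (fr.ext_P _ _ hu) (fr.ext_P _ _ hu)).symm

theorem ext_smul {u : Dual F E} (hu : u ∈ fr.ddom) (c : ℝ) (w : F) (b : F →L[ℝ] ℝ) :
    fr.ext A (c • w) (c • b) u = c • fr.ext A w b u := by
  refine prolong_ext (fr.mem_chartDom hu) ?_ ?_
  · rw [map_smul]
    exact (fr.ext_X _ _ hu).trans (congrArg (c • ·) (fr.ext_X _ _ hu)).symm
  · rw [map_smul]
    exact (fr.ext_P _ _ hu).trans (congrArg (c • ·) (fr.ext_P _ _ hu)).symm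

open Classical in
variable (A) in
/-- The inverse of the coordinates on the fibre of the prolongation. -/
def ofCrd (u : Dual F E) : F × (F →L[ℝ] ℝ) →ₗ[ℝ] Prolong A u :=
  if hu : u ∈ fr.ddom then
    { toFun := fun z => fr.ext A z.1 z.2 u
      map_add' := fun z z' => fr.ext_add hu z.1 z'.1 z.2 z'.2
      map_smul' := fun c z => fr.ext_smul hu c z.1 z.2 }
  else 0

theorem ofCrd_apply {u : Dual F E} (hu : u ∈ fr.ddom) (w : F) (b : F →L[ℝ] ℝ) :
    fr.ofCrd A u (w, b) = fr.ext A w b u := by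
  rw [ofCrd, dif_pos hu]
  rfl

variable (A) in
/-- The derivative of a function in the directions of the frame. -/
def dX (f : Dual F E → G) (u : Dual F E) : F →L[ℝ] G :=
  LinearMap.toContinuousLinearMap
    (prolongDeriv A f u ∘ₗ fr.ofCrd A u ∘ₗ LinearMap.inl ℝ F (F →L[ℝ] ℝ))

variable (A) in
/-- The derivative of a function in the fibre directions. -/
def dP (f : Dual F E → G) (u : Dual F E) : (F →L[ℝ] ℝ) →L[ℝ] G :=
  LinearMap.toContinuousLinearMap
    (prolongDeriv A f u ∘ₗ fr.ofCrd A u ∘ₗ LinearMap.inr ℝ F (F →L[ℝ] ℝ))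

theorem dX_apply (f : Dual F E → G) {u : Dual F E} (hu : u ∈ fr.ddom) (w : F) :
    fr.dX A f u w = (fr.ext A w 0).D f u :=
  congrArg (prolongDeriv A f u) (fr.ofCrd_apply hu w 0)

theorem dP_apply (f : Dual F E → G) {u : Dual F E} (hu : u ∈ fr.ddom) (b : F →L[ℝ] ℝ) :
    fr.dP A f u b = (fr.ext A 0 b).D f u :=
  congrArg (prolongDeriv A f u) (fr.ofCrd_apply hu 0 b)

/-- The total differential of `f` split into its frame part and its fibre part, the form in which
`dH` is compared with `i_ρ ω`. -/
theorem D_eq (ρ : PSec A) (f : Dual F E → G) {u : Dual F E} (hu : u ∈ fr.ddom) :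
    ρ.D f u = fr.dX A f u (ρ.X x₀ u) + fr.dP A f u (ρ.P x₀ u) := by
  rw [fr.dX_apply f hu, fr.dP_apply f hu, PSec.D_eq_prolongDeriv, PSec.D_eq_prolongDeriv,
    PSec.D_eq_prolongDeriv, ← map_add, ← fr.ext_add hu, add_zero, zero_add]
  exact congrArg _ (fr.ext_eq hu (ρ u)).symm

theorem dX_smooth (hW : IsOpen W) {f : Dual F E → G}
    (hf : ContMDiffOn (dualModel EB F) 𝓘(ℝ, G) ∞ f W) :
    ContMDiffOn (dualModel EB F) 𝓘(ℝ, F →L[ℝ] G) ∞ (fr.dX A f) (W ∩ fr.ddom) :=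
  contMDiffOn_clm_of_apply fun w =>
    ((PSec.D_smooth hW (fr.ext_smooth w 0 W) hf).mono inter_subset_left).congr
      fun _ hu => fr.dX_apply f hu.2 w

theorem dP_smooth (hW : IsOpen W) {f : Dual F E → G}
    (hf : ContMDiffOn (dualModel EB F) 𝓘(ℝ, G) ∞ f W) :
    ContMDiffOn (dualModel EB F) 𝓘(ℝ, (F →L[ℝ] ℝ) →L[ℝ] G) ∞ (fr.dP A f) (W ∩ fr.ddom) :=
  contMDiffOn_clm_of_apply fun b =>
    ((PSec.D_smooth hW (fr.ext_smooth 0 b W) hf).mono inter_subset_left).congr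
      fun _ hu => fr.dP_apply f hu.2 b

end LocalFrame

end Partial

namespace LocalFrame

theorem vertElem_eq_ext {u : Dual F E} (hu : u ∈ fr.ddom) (b : F →L[ℝ] ℝ) :
    vertElem A u (b ∘L fibreCoord F E x₀ u.proj) = fr.ext A 0 b u := by
  refine Eq.trans ?_ (eq_vertElem fr hu (fr.ext_vertical b u)).symm
  rw [show crdP x₀ u (fr.ext A 0 b u) = b from fr.ext_P _ _ hu]

variable (A) in
/-- The Hessian of a function in the fibre directions. -/
def hess (H : Dual F E → ℝ) : Dual F E → (F →L[ℝ] ℝ) →L[ℝ] (F →L[ℝ] ℝ) →L[ℝ] ℝ :=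
  fr.dP A (fr.dP A H)

variable {H : Dual F E → ℝ} (hH : ContMDiffOn (dualModel EB F) 𝓘(ℝ, ℝ) ∞ H W)

include hW hH

theorem hess_smooth :
    ContMDiffOn (dualModel EB F) 𝓘(ℝ, (F →L[ℝ] ℝ) →L[ℝ] (F →L[ℝ] ℝ) →L[ℝ] ℝ) ∞
      (fr.hess A H) (W ∩ fr.ddom) := by
  have h1 := fr.dP_smooth (A := A) hW hH
  have h2 := fr.dP_smooth (A := A) (hW.inter fr.isOpen_ddom) h1
  exact h2.mono fun _ h => ⟨h, h.2⟩

theorem hess_apply {u : Dual F E} (hu : u ∈ W) (hu' : u ∈ fr.ddom) (b b' : F →L[ℝ] ℝ) :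
    fr.hess A H u b b' = (fr.ext A 0 b).D ((fr.ext A 0 b').D H) u := by
  have hO := hW.inter fr.isOpen_ddom
  have h1 : (fr.ext A 0 b).D (fun y => fr.dP A H y b') u = (fr.ext A 0 b).D (fr.dP A H) u b' :=
    der_apply_const b' (contMDiff_toMDiff hO (fr.dP_smooth hW hH) ⟨hu, hu'⟩)
  rw [hess, fr.dP_apply _ hu', ← h1]
  refine PSec.D_congr _ ?_
  filter_upwards [fr.isOpen_ddom.mem_nhds hu'] with y hy
  exact fr.dP_apply H hy b'

/-- The two orders of differentiation differ by the action of the bracket of two vertical frame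
sections. This bracket vanishes at `u`, since their coordinates are constant nearby and their
`E`-components are zero. -/
theorem hess_symm {u : Dual F E} (hu : u ∈ W) (hu' : u ∈ fr.ddom) (b b' : F →L[ℝ] ℝ) :
    fr.hess A H u b b' = fr.hess A H u b' b := by
  rw [fr.hess_apply hW hH hu hu', fr.hess_apply hW hH hu hu', ← sub_eq_zero,
    ← D_pbracket hW (fr.ext_smooth 0 b W) (fr.ext_smooth 0 b' W) hW hH hu hu]
  have e : ∀ c c' : F →L[ℝ] ℝ, (fr.ext A 0 c).D ((fr.ext A 0 c').X x₀) u = 0 := fun c c' => by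
    refine (PSec.D_congr _ (g := fun _ => 0) ?_).trans (der_const _ _ _)
    filter_upwards [fr.isOpen_ddom.mem_nhds hu'] with y hy
    exact fr.ext_X _ _ hy
  have e' : ∀ c c' : F →L[ℝ] ℝ, (fr.ext A 0 c).D ((fr.ext A 0 c').P x₀) u = 0 := fun c c' => by
    refine (PSec.D_congr _ (g := fun _ => c') ?_).trans (der_const _ _ _)
    filter_upwards [fr.isOpen_ddom.mem_nhds hu'] with y hy
    exact fr.ext_P _ _ hy
  have h0 : pbracket (fr.ext A 0 b) (fr.ext A 0 b') u = 0 := by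
    refine prolong_ext (fr.mem_chartDom hu') ?_ ?_
    · refine (X_pbracket fr hW (fr.ext_smooth 0 b W) (fr.ext_smooth 0 b' W) hu hu').trans ?_
      rw [e, e, fr.ext_X _ _ hu', map_zero, map_zero]
      simp
    · refine (P_pbracket fr hW (fr.ext_smooth 0 b W) (fr.ext_smooth 0 b' W) hu hu').trans ?_
      rw [e', e', sub_zero, map_zero]
  rw [PSec.D_eq_prolongDeriv, h0, map_zero]

theorem fibreHess_eq {u : Dual F E} (hu : u ∈ W) (hu' : u ∈ fr.ddom) (b b' : F →L[ℝ] ℝ) :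
    fibreHess H u (b ∘L fibreCoord F E x₀ u.proj) (b' ∘L fibreCoord F E x₀ u.proj) =
      fr.hess A H u b b' := by
  have key : ∀ (c : F →L[ℝ] ℝ) (f : Dual F E → ℝ) (y : Dual F E), y ∈ fr.ddom →
      MDifferentiableAt (dualModel EB F) 𝓘(ℝ, ℝ) f y →
      (fr.ext A 0 c).D f y =
        deriv (fun r : ℝ => f ⟨y.proj, y.snd + r • (c ∘L fibreCoord F E x₀ y.proj)⟩) 0 := by
    intro c f y hy hf
    rw [PSec.D_eq_prolongDeriv, ← fr.vertElem_eq_ext hy]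
    exact mfderiv_vertLift hf _
  rw [fr.hess_apply hW hH hu hu', key b _ u hu' (contMDiff_toMDiff hW
    (PSec.D_smooth hW (fr.ext_smooth 0 b' W) hH) hu)]
  refine Filter.EventuallyEq.deriv_eq ?_
  have hc : ContinuousAt (fun r : ℝ => (⟨u.proj, u.snd + r • (b ∘L fibreCoord F E x₀ u.proj)⟩ :
      Dual F E)) 0 := (vertCurve_smooth (EB := EB) u _).continuous.continuousAt
  have h0 : (⟨u.proj, u.snd + (0 : ℝ) • (b ∘L fibreCoord F E x₀ u.proj)⟩ : Dual F E) = u := by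
    rw [zero_smul, add_zero]
  have hW' : ∀ᶠ r : ℝ in 𝓝 0,
      (⟨u.proj, u.snd + r • (b ∘L fibreCoord F E x₀ u.proj)⟩ : Dual F E) ∈ W :=
    hc.eventually_mem (hW.mem_nhds (by rw [h0]; exact hu))
  filter_upwards [hW'] with r hr
  -- Moving along the fibre does not change the projection, so `hu'` also serves at the displaced
  -- point.
  exact (key b' H ⟨u.proj, u.snd + r • (b ∘L fibreCoord F E x₀ u.proj)⟩ hu'
    (contMDiff_toMDiff hW hH hr)).symm

theorem vmetric_eq {ρ₁ ρ₂ : PSec A} {u : Dual F E} (hu : u ∈ W) (hu' : u ∈ fr.ddom)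
    (h₁ : ρ₁ u ∈ vertical A u) (h₂ : ρ₂ u ∈ vertical A u) :
    vmetric H ρ₁ ρ₂ u = fr.hess A H u (ρ₁.P x₀ u) (ρ₂.P x₀ u) := by
  rw [← fr.fibreHess_eq hW hH hu hu']
  exact congrArg₂ (fibreHess H u) (invFun_vertLift fr hu' h₁) (invFun_vertLift fr hu' h₂)

theorem hess_nondegenerate (hreg : RegularOn H W) {u : Dual F E} (hu : u ∈ W) (hu' : u ∈ fr.ddom)
    {b : F →L[ℝ] ℝ} (hb : ∀ b', fr.hess A H u b b' = 0) : b = 0 := by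
  have h : b ∘L fibreCoord F E x₀ u.proj = 0 := by
    refine hreg u hu _ fun η => ?_
    have e : (η ∘L ofFibreCoord F E x₀ u.proj) ∘L fibreCoord F E x₀ u.proj = η := by
      ext a
      exact congrArg η (ofFibreCoord_fibreCoord (fr.mem_baseSet hu') a)
    rw [← e, fr.fibreHess_eq (A := A) hW hH hu hu', hb]
  ext w
  have := DFunLike.congr_fun h (ofFibreCoord F E x₀ u.proj w)
  change b (fibreCoord F E x₀ u.proj (ofFibreCoord F E x₀ u.proj w)) = 0 at this
  rwa [fibreCoord_ofFibreCoord (fr.mem_baseSet hu')] at this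

end LocalFrame

end Hessian

/-! ### Existence of the Hamilton section and of the tangent structure. -/

section Existence

variable {EB : Type uB} [NormedAddCommGroup EB] [NormedSpace ℝ EB]
  {F : Type uF} [NormedAddCommGroup F] [NormedSpace ℝ F]
  {M : Type uM} [TopologicalSpace M] [ChartedSpace EB M]
  [IsManifold 𝓘(ℝ, EB) ∞ M]
  {E : M → Type uE} [TopologicalSpace (TotalSpace F E)]
  [∀ x, AddCommGroup (E x)] [∀ x, Module ℝ (E x)] [∀ x, TopologicalSpace (E x)]
  [∀ x, IsTopologicalAddGroup (E x)] [∀ x, ContinuousSMul ℝ (E x)]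
  [FiberBundle F E] [VectorBundle ℝ F E] [ContMDiffVectorBundle ∞ F E 𝓘(ℝ, EB)]
  {A : LieAlgebroid EB F E}
  [FiniteDimensional ℝ EB] [T2Space M] [FiniteDimensional ℝ F]
  {x₀ : M} (fr : LocalFrame EB F E x₀)
  {W : Set (Dual F E)} (hW : IsOpen W)

theorem finrank_continuousDual (V : Type*) [NormedAddCommGroup V] [NormedSpace ℝ V]
    [FiniteDimensional ℝ V] : Module.finrank ℝ (V →L[ℝ] ℝ) = Module.finrank ℝ V :=
  (LinearMap.toContinuousLinearMap (𝕜 := ℝ) (E := V) (F' := ℝ)).finrank_eq.symm.trans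
    Subspace.dual_finrank_eq

/-- A finite-dimensional normed space is isomorphic to its bidual. -/
def bidual (V : Type*) [NormedAddCommGroup V] [NormedSpace ℝ V] [FiniteDimensional ℝ V] :
    V ≃L[ℝ] ((V →L[ℝ] ℝ) →L[ℝ] ℝ) :=
  (LinearMap.linearEquivOfInjective (ContinuousLinearMap.apply ℝ ℝ : V →L[ℝ] _).toLinearMap
    (fun _ _ h => (SeparatingDual.eq_iff_forall_dual_eq (R := ℝ)).2
      fun b => DFunLike.congr_fun h b)
    (by rw [finrank_continuousDual, finrank_continuousDual])).toContinuousLinearEquiv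

theorem bidual_apply {V : Type*} [NormedAddCommGroup V] [NormedSpace ℝ V] [FiniteDimensional ℝ V]
    (v : V) (b : V →L[ℝ] ℝ) : bidual V v b = b v := rfl

theorem contMDiffOn_clm_inverse {EN : Type*} [NormedAddCommGroup EN] [NormedSpace ℝ EN]
    {HN : Type*} [TopologicalSpace HN] {I : ModelWithCorners ℝ EN HN}
    {N : Type*} [TopologicalSpace N] [ChartedSpace HN N]
    {V V' : Type*} [NormedAddCommGroup V] [NormedSpace ℝ V] [CompleteSpace V]
    [NormedAddCommGroup V'] [NormedSpace ℝ V'] {f : N → V →L[ℝ] V'} {O : Set N}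
    (hf : ContMDiffOn I 𝓘(ℝ, V →L[ℝ] V') ∞ f O) (he : ∀ u ∈ O, ∃ e : V ≃L[ℝ] V', e = f u) :
    ContMDiffOn I 𝓘(ℝ, V' →L[ℝ] V) ∞ (fun u => (f u).inverse) O := by
  intro u hu
  obtain ⟨e, hu'⟩ := he u hu
  have h := contDiffAt_map_inverse (𝕜 := ℝ) (n := ∞) e
  rw [hu'] at h
  exact h.contMDiffAt.comp_contMDiffWithinAt u (hf u hu)

namespace LocalFrame

section Hamilton

variable (A) in
/-- The `F`-component of the Hamilton section. -/
def hamX (H : Dual F E → ℝ) (u : Dual F E) : F := (bidual F).symm (fr.dP A H u)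

variable (A) in
/-- The momentum component of the Hamilton section. -/
def hamP (H : Dual F E → ℝ) (u : Dual F E) : F →L[ℝ] ℝ :=
  mom x₀ u ∘L fr.str A u.proj (fr.hamX A H u) - fr.dX A H u

theorem apply_hamX (H : Dual F E → ℝ) (u : Dual F E) (b : F →L[ℝ] ℝ) :
    b (fr.hamX A H u) = fr.dP A H u b := by
  rw [← bidual_apply, hamX, ContinuousLinearEquiv.apply_symm_apply]

theorem hamP_apply (H : Dual F E → ℝ) (u : Dual F E) (w : F) :
    fr.hamP A H u w = mom x₀ u (fr.str A u.proj (fr.hamX A H u) w) - fr.dX A H u w := rfl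

include hW in
-- Testing on the vertical frame sections `(0, b)` determines the `F`-component, then testing on
-- `(w, 0)` determines the momentum. Uniqueness makes the local solutions agree on overlaps.
theorem symplectic_eq_act_iff {H : Dual F E → ℝ} {σ : PSec A} (hσ : σ.SmoothOn W) {u : Dual F E}
    (hu : u ∈ W) (hu' : u ∈ fr.ddom) :
    (∀ ν : PSec A, ν.SmoothOn W → symplectic σ ν u = ν.act H u) ↔
      σ.X x₀ u = fr.hamX A H u ∧ σ.P x₀ u = fr.hamP A H u := by
  constructor
  · intro h
    have hX : σ.X x₀ u = fr.hamX A H u := by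
      apply (bidual F).injective
      ext b
      rw [bidual_apply, bidual_apply, apply_hamX, fr.dP_apply H hu']
      refine Eq.trans ?_ (h (fr.ext A 0 b) (fr.ext_smooth 0 b W))
      rw [symplectic_eq fr hW hσ (fr.ext_smooth 0 b W) hu hu', fr.ext_X _ _ hu', fr.ext_P _ _ hu']
      simp
    refine ⟨hX, ?_⟩
    ext w
    have hw : symplectic σ (fr.ext A w 0) u = fr.dX A H u w :=
      (h (fr.ext A w 0) (fr.ext_smooth w 0 W)).trans (fr.dX_apply H hu' w).symm
    rw [symplectic_eq fr hW hσ (fr.ext_smooth w 0 W) hu hu', fr.ext_X _ _ hu', fr.ext_P _ _ hu',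
      zero_apply] at hw
    rw [hamP_apply, ← hX]
    linarith
  · rintro ⟨hX, hP⟩ ν hν
    rw [symplectic_eq fr hW hσ hν hu hu', hX, hP, hamP_apply, apply_hamX]
    refine Eq.trans ?_ (fr.D_eq ν H hu').symm
    ring

variable {H : Dual F E → ℝ} (hH : ContMDiffOn (dualModel EB F) 𝓘(ℝ, ℝ) ∞ H W)

include hW hH

theorem hamX_smooth : ContMDiffOn (dualModel EB F) 𝓘(ℝ, F) ∞ (fr.hamX A H) (W ∩ fr.ddom) :=
  (ContinuousLinearMap.contMDiff (n := ∞)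
    ((bidual F).symm : ((F →L[ℝ] ℝ) →L[ℝ] ℝ) →L[ℝ] F)).comp_contMDiffOn
      (fr.dP_smooth (A := A) hW hH)

theorem hamP_smooth :
    ContMDiffOn (dualModel EB F) 𝓘(ℝ, F →L[ℝ] ℝ) ∞ (fr.hamP A H) (W ∩ fr.ddom) :=
  ((fr.mom_smooth.mono inter_subset_right).clm_comp ((fr.str_proj_smooth.mono
    inter_subset_right).clm_apply (fr.hamX_smooth hW hH))).sub (fr.dX_smooth hW hH)

end Hamilton

end LocalFrame

theorem exists_hamiltonSection (A : LieAlgebroid EB F E) (hW : IsOpen W) {H : Dual F E → ℝ}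
    (hH : ContMDiffOn (dualModel EB F) 𝓘(ℝ, ℝ) ∞ H W) :
    ∃ ρ : PSec A, IsHamiltonSection H W ρ := by
  -- The condition on the value at `u` quantifies over all smooth sections through it. Pointwise
  -- choice then gives a section not yet known to be smooth; its coordinates in every frame are
  -- forced, and smoothness follows from them.
  have h : ∀ u : Dual F E, ∃ p : Prolong A u, u ∈ W → ∀ σ : PSec A, σ.SmoothOn W → σ u = p →
      ∀ ν : PSec A, ν.SmoothOn W → symplectic σ ν u = ν.act H u := by
    intro u
    obtain ⟨fr⟩ := exists_localFrame (EB := EB) (F := F) (E := E) u.proj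
    have hu' : u ∈ fr.ddom := fr.mem_dom
    refine ⟨fr.ext A (fr.hamX A H u) (fr.hamP A H u) u, fun hu σ hσ h => ?_⟩
    refine (fr.symplectic_eq_act_iff hW hσ hu hu').2 ⟨?_, ?_⟩
    · exact (congrArg (crdX u.proj u) h).trans (fr.ext_X _ _ hu')
    · exact (congrArg (crdP u.proj u) h).trans (fr.ext_P _ _ hu')
  choose ρ hρ using h
  have key : ∀ {x₀ : M} (fr : LocalFrame EB F E x₀) (u : Dual F E), u ∈ W → u ∈ fr.ddom →
      PSec.X x₀ ρ u = fr.hamX A H u ∧ PSec.P x₀ ρ u = fr.hamP A H u := by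
    intro x₀ fr u hu hu'
    obtain ⟨σ, hσ, hσu⟩ := exists_smooth_through (ρ u)
    have := (fr.symplectic_eq_act_iff hW (hσ W) hu hu').1 (hρ u hu σ (hσ W) hσu)
    unfold PSec.X PSec.P at this ⊢
    rwa [hσu] at this
  have hs : PSec.SmoothOn ρ W := by
    refine PSec.smoothOn_of_local fun u hu => ?_
    obtain ⟨fr⟩ := exists_localFrame (EB := EB) (F := F) (E := E) u.proj
    refine ⟨fr.ddom, fr.isOpen_ddom, fr.mem_dom,
      PSec.smoothOn_of_coord fr (hW.inter fr.isOpen_ddom) inter_subset_right ?_ ?_⟩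
    · exact (fr.hamX_smooth (A := A) hW hH).congr fun y hy => (key fr y hy.1 hy.2).1
    · exact (fr.hamP_smooth (A := A) hW hH).congr fun y hy => (key fr y hy.1 hy.2).2
  exact ⟨ρ, hs, fun ν hν u hu => hρ u hu ρ hs rfl ν hν⟩

namespace LocalFrame

variable {H : Dual F E → ℝ} (hH : ContMDiffOn (dualModel EB F) 𝓘(ℝ, ℝ) ∞ H W)
  (hreg : RegularOn H W)

variable (A) in
/-- The inverse of the fibre Hessian. -/
def tang (H : Dual F E → ℝ) (u : Dual F E) : F →L[ℝ] F →L[ℝ] ℝ :=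
  (fr.hess A H u).inverse ∘L (bidual F : F →L[ℝ] _)

include hW hH

theorem fibreHess_invFun {u : Dual F E} (hu : u ∈ W) (hu' : u ∈ fr.ddom) {q : Prolong A u}
    (hq : q ∈ vertical A u) (b : F →L[ℝ] ℝ) :
    fibreHess H u (Function.invFun (vertLift EB u) q.1.2) (b ∘L fibreCoord F E x₀ u.proj) =
      fr.hess A H u (crdP x₀ u q) b := by
  rw [← fr.fibreHess_eq hW hH hu hu']
  exact congrArg (fun ξ => fibreHess H u ξ (b ∘L fibreCoord F E x₀ u.proj))
    (invFun_vertLift fr hu' hq)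

include hreg

theorem hess_injective {u : Dual F E} (hu : u ∈ W) (hu' : u ∈ fr.ddom) :
    Function.Injective (fr.hess A H u) := by
  rw [injective_iff_map_eq_zero]
  exact fun b hb => fr.hess_nondegenerate (A := A) hW hH hreg hu hu' fun b' => by
    rw [hb]; rfl

theorem exists_hess_equiv {u : Dual F E} (hu : u ∈ W) (hu' : u ∈ fr.ddom) :
    ∃ e : (F →L[ℝ] ℝ) ≃L[ℝ] ((F →L[ℝ] ℝ) →L[ℝ] ℝ),
      (e : (F →L[ℝ] ℝ) →L[ℝ] ((F →L[ℝ] ℝ) →L[ℝ] ℝ)) = fr.hess A H u :=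
  ⟨(LinearMap.linearEquivOfInjective (fr.hess A H u).toLinearMap
    (fr.hess_injective hW hH hreg hu hu')
    (finrank_continuousDual (F →L[ℝ] ℝ)).symm).toContinuousLinearEquiv, rfl⟩

theorem hess_tang {u : Dual F E} (hu : u ∈ W) (hu' : u ∈ fr.ddom) (x : F) (b : F →L[ℝ] ℝ) :
    fr.hess A H u (fr.tang A H u x) b = b x := by
  obtain ⟨e, he⟩ := fr.exists_hess_equiv (A := A) hW hH hreg hu hu'
  rw [tang, ← he, ContinuousLinearMap.inverse_equiv, ← bidual_apply]
  exact DFunLike.congr_fun (e.apply_symm_apply (bidual F x)) b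

theorem tang_smooth :
    ContMDiffOn (dualModel EB F) 𝓘(ℝ, F →L[ℝ] F →L[ℝ] ℝ) ∞ (fr.tang A H) (W ∩ fr.ddom) := by
  have h := contMDiffOn_clm_inverse (fr.hess_smooth (A := A) hW hH)
    fun u hu => fr.exists_hess_equiv (A := A) hW hH hreg hu.1 hu.2
  exact h.clm_comp contMDiffOn_const

end LocalFrame

theorem exists_inducedTangentStructure (A : LieAlgebroid EB F E) (hW : IsOpen W)
    {H : Dual F E → ℝ} (hH : ContMDiffOn (dualModel EB F) 𝓘(ℝ, ℝ) ∞ H W) (hreg : RegularOn H W) :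
    ∃ J : PEnd A, IsInducedTangentStructure H W J := by
  -- Frame-free description of `J`: the image of `(a, v)` is the vertical lift of the covector whose
  -- Hessian pairing with each `η` is `η(a)`. Pointwise choices thus have prescribed coordinates in
  -- every frame at once.
  have h : ∀ u : Dual F E, ∃ L : Prolong A u →ₗ[ℝ] Prolong A u, u ∈ W → ∀ p,
      L p ∈ vertical A u ∧ ∀ η : E u.proj →L[ℝ] ℝ,
        fibreHess H u (Function.invFun (vertLift EB u) (L p).1.2) η = η p.1.1 := by
    intro u
    obtain ⟨fr⟩ := exists_localFrame (EB := EB) (F := F) (E := E) u.proj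
    have hu' : u ∈ fr.ddom := fr.mem_dom
    refine ⟨fr.ofCrd A u ∘ₗ LinearMap.inr ℝ F (F →L[ℝ] ℝ) ∘ₗ (fr.tang A H u).toLinearMap ∘ₗ
      crdX u.proj u, fun hu p => ?_⟩
    have e : (fr.ofCrd A u ∘ₗ LinearMap.inr ℝ F (F →L[ℝ] ℝ) ∘ₗ (fr.tang A H u).toLinearMap ∘ₗ
        crdX u.proj u) p = fr.ext A 0 (fr.tang A H u (crdX u.proj u p)) u :=
      fr.ofCrd_apply hu' _ _
    rw [e]
    refine ⟨fr.ext_vertical _ u, fun η => ?_⟩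
    have hη : (η ∘L ofFibreCoord F E u.proj u.proj) ∘L fibreCoord F E u.proj u.proj = η := by
      ext a
      exact congrArg η (ofFibreCoord_fibreCoord (fr.mem_baseSet hu') a)
    rw [← hη, fr.fibreHess_invFun hW hH hu hu' (fr.ext_vertical _ u)]
    rw [show crdP u.proj u (fr.ext A 0 (fr.tang A H u (crdX u.proj u p)) u) = _ from
      fr.ext_P _ _ hu', fr.hess_tang hW hH hreg hu hu']
    rfl
  choose J hJ using h
  have vert : ∀ u ∈ W, ∀ p, J u p ∈ vertical A u := fun u hu p => (hJ u hu p).1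
  have key : ∀ {x₀ : M} (fr : LocalFrame EB F E x₀) (u : Dual F E), u ∈ W → u ∈ fr.ddom →
      ∀ p b, fr.hess A H u (crdP x₀ u (J u p)) b = b (crdX x₀ u p) := by
    intro x₀ fr u hu hu' p b
    rw [← fr.fibreHess_invFun hW hH hu hu' (vert u hu p), (hJ u hu p).2]
    rfl
  have crdX_J : ∀ {x₀ : M} (fr : LocalFrame EB F E x₀) (u : Dual F E), u ∈ W → u ∈ fr.ddom →
      ∀ p, crdX x₀ u (J u p) = 0 := fun fr u hu hu' p =>
    (mem_vertical_iff fr hu').1 (vert u hu p)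
  have hsm : PEnd.SmoothOn J W := by
    intro ρ hρ
    refine PSec.smoothOn_of_local fun u hu => ?_
    obtain ⟨fr⟩ := exists_localFrame (EB := EB) (F := F) (E := E) u.proj
    refine ⟨fr.ddom, fr.isOpen_ddom, fr.mem_dom,
      PSec.smoothOn_of_coord fr (hW.inter fr.isOpen_ddom) inter_subset_right ?_ ?_⟩
    · exact contMDiffOn_const.congr fun y hy => crdX_J fr y hy.1 hy.2 (ρ y)
    · refine ((fr.tang_smooth (A := A) hW hH hreg).clm_apply (hρ.X_smooth fr)).congr
        fun y hy => ?_
      apply fr.hess_injective (A := A) hW hH hreg hy.1 hy.2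
      ext b
      rw [fr.hess_tang hW hH hreg hy.1 hy.2]
      exact key fr y hy.1 hy.2 (ρ y) b
  have hω : ∀ {x₀ : M} (fr : LocalFrame EB F E x₀) (ρ ν : PSec A), ρ.SmoothOn W →
      ν.SmoothOn W → ∀ u ∈ W, u ∈ fr.ddom → symplectic (PEnd.app J ρ) ν u =
        -fr.hess A H u (crdP x₀ u (J u (ν u))) (crdP x₀ u (J u (ρ u))) := by
    intro x₀ fr ρ ν hρ hν u hu hu'
    rw [symplectic_eq fr hW (hsm ρ hρ) hν hu hu',
      show PSec.X x₀ (PEnd.app J ρ) u = 0 from crdX_J fr u hu hu' (ρ u), map_zero, map_zero,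
      zero_apply, map_zero, zero_sub, add_zero, key fr u hu hu']
    rfl
  refine ⟨J, hsm, fun u hu => ?_, fun u hu => ?_, fun ρ ν hρ hν u hu => ?_,
    fun ρ ν hρ hν u hu => ?_⟩
  all_goals
    obtain ⟨fr⟩ := exists_localFrame (EB := EB) (F := F) (E := E) u.proj
    have hu' : u ∈ fr.ddom := fr.mem_dom
  · ext p
    rw [LinearMap.mem_ker, mem_vertical_iff fr hu']
    constructor
    · intro h0
      apply (bidual F).injective
      ext b
      rw [bidual_apply, ← key fr u hu hu', h0]
      simp
    · intro h0
      refine prolong_ext (fr.mem_chartDom hu') ?_ ?_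
      · rw [crdX_J fr u hu hu', map_zero]
      · rw [map_zero]
        refine fr.hess_nondegenerate (A := A) hW hH hreg hu hu' fun b => ?_
        rw [key fr u hu hu', h0, map_zero]
  · ext q
    constructor
    · rintro ⟨p, rfl⟩
      exact vert u hu p
    · intro hq
      -- A preimage of `q` must have as `F`-component the vector representing `Hess(P(q), ·)`; its
      -- momentum is irrelevant and is taken to be zero.
      refine ⟨fr.ext A ((bidual F).symm (fr.hess A H u (crdP u.proj u q))) 0 u, ?_⟩
      refine prolong_ext (fr.mem_chartDom hu') ?_ ?_
      · rw [crdX_J fr u hu hu', (mem_vertical_iff fr hu').1 hq]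
      · apply fr.hess_injective (A := A) hW hH hreg hu hu'
        ext b
        rw [key fr u hu hu', show crdX u.proj u (fr.ext A _ 0 u) = _ from fr.ext_X _ _ hu',
          ← bidual_apply, ContinuousLinearEquiv.apply_symm_apply]
  · rw [hω fr ρ ν hρ hν u hu hu', hω fr ν ρ hν hρ u hu hu', fr.hess_symm hW hH hu hu']
  · rw [hω fr ρ ν hρ hν u hu hu', neg_neg,
      fr.vmetric_eq (A := A) hW hH hu hu' (vert u hu _) (vert u hu _), fr.hess_symm hW hH hu hu']
    rfl

end Existence

/-! ### Invariance of the symplectic section, and tensoriality of the Lie derivative of `J`. -/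

section Connection

variable {EB : Type uB} [NormedAddCommGroup EB] [NormedSpace ℝ EB]
  {F : Type uF} [NormedAddCommGroup F] [NormedSpace ℝ F]
  {M : Type uM} [TopologicalSpace M] [ChartedSpace EB M]
  [IsManifold 𝓘(ℝ, EB) ∞ M]
  {E : M → Type uE} [TopologicalSpace (TotalSpace F E)]
  [∀ x, AddCommGroup (E x)] [∀ x, Module ℝ (E x)] [∀ x, TopologicalSpace (E x)]
  [∀ x, IsTopologicalAddGroup (E x)] [∀ x, ContinuousSMul ℝ (E x)]
  [FiberBundle F E] [VectorBundle ℝ F E] [ContMDiffVectorBundle ∞ F E 𝓘(ℝ, EB)]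
  {A : LieAlgebroid EB F E}
  [FiniteDimensional ℝ EB] [T2Space M] [FiniteDimensional ℝ F]
  {x₀ : M} (fr : LocalFrame EB F E x₀)
  {W : Set (Dual F E)} (hW : IsOpen W) {ρ₁ ρ₂ : PSec A} (h₁ : ρ₁.SmoothOn W)

section Algebra

variable (h₂ : ρ₂.SmoothOn W)

include hW h₁ h₂ in
theorem PSec.SmoothOn.lin (a b : ℝ) : PSec.SmoothOn (fun u => a • ρ₁ u + b • ρ₂ u) W := by
  refine PSec.smoothOn_of_local fun u hu => ?_
  obtain ⟨fr⟩ := exists_localFrame (EB := EB) (F := F) (E := E) u.proj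
  refine ⟨fr.ddom, fr.isOpen_ddom, fr.mem_dom,
    PSec.smoothOn_of_coord fr (hW.inter fr.isOpen_ddom) inter_subset_right ?_ ?_⟩
  · refine ((contMDiffOn_const (I' := 𝓘(ℝ, ℝ)) (c := a)).smul (h₁.X_smooth fr)).add
      ((contMDiffOn_const (I' := 𝓘(ℝ, ℝ)) (c := b)).smul (h₂.X_smooth fr)) |>.congr fun y _ => ?_
    refine (map_add (crdX u.proj y) _ _).trans ?_
    rw [map_smul, map_smul]
    rfl
  · refine ((contMDiffOn_const (I' := 𝓘(ℝ, ℝ)) (c := a)).smul (h₁.P_smooth fr hW)).add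
      ((contMDiffOn_const (I' := 𝓘(ℝ, ℝ)) (c := b)).smul (h₂.P_smooth fr hW)) |>.congr fun y _ => ?_
    refine (map_add (crdP u.proj y) _ _).trans ?_
    rw [map_smul, map_smul]
    rfl

include hW h₁ h₂

theorem pbracket_skew {u : Dual F E} (hu : u ∈ W) :
    pbracket ρ₁ ρ₂ u = -pbracket ρ₂ ρ₁ u := by
  obtain ⟨fr⟩ := exists_localFrame (EB := EB) (F := F) (E := E) u.proj
  have hu' : u ∈ fr.ddom := fr.mem_dom
  refine prolong_ext (fr.mem_chartDom hu') ?_ ?_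
  · rw [map_neg]
    refine (X_pbracket fr hW h₁ h₂ hu hu').trans ?_
    rw [show crdX u.proj u (pbracket ρ₂ ρ₁ u) = _ from X_pbracket fr hW h₂ h₁ hu hu',
      fr.str_skew A u.proj (ρ₁.X u.proj u)]
    abel
  · rw [map_neg]
    refine (P_pbracket fr hW h₁ h₂ hu hu').trans ?_
    rw [show crdP u.proj u (pbracket ρ₂ ρ₁ u) = _ from P_pbracket fr hW h₂ h₁ hu hu']
    abel

theorem symplectic_skew {u : Dual F E} (hu : u ∈ W) :
    symplectic ρ₁ ρ₂ u = -symplectic ρ₂ ρ₁ u := by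
  obtain ⟨fr⟩ := exists_localFrame (EB := EB) (F := F) (E := E) u.proj
  have hu' : u ∈ fr.ddom := fr.mem_dom
  rw [symplectic_eq fr hW h₁ h₂ hu hu', symplectic_eq fr hW h₂ h₁ hu hu',
    fr.str_skew A u.proj (ρ₁.X u.proj u), map_neg]
  ring

theorem pbracket_congr {ρ₂' : PSec A} (h : ∀ y ∈ W, ρ₂' y = ρ₂ y) {u : Dual F E} (hu : u ∈ W) :
    pbracket ρ₁ ρ₂' u = pbracket ρ₁ ρ₂ u := by
  obtain ⟨fr⟩ := exists_localFrame (EB := EB) (F := F) (E := E) u.proj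
  have hu' : u ∈ fr.ddom := fr.mem_dom
  have h₂' : ρ₂'.SmoothOn W := h₂.congr h
  have eX : ρ₂'.X u.proj =ᶠ[𝓝 u] ρ₂.X u.proj := by
    filter_upwards [hW.mem_nhds hu] with y hy
    exact congrArg (crdX u.proj y) (h y hy)
  have eP : ρ₂'.P u.proj =ᶠ[𝓝 u] ρ₂.P u.proj := by
    filter_upwards [hW.mem_nhds hu] with y hy
    exact congrArg (crdP u.proj y) (h y hy)
  refine prolong_ext (fr.mem_chartDom hu') ?_ ?_
  · refine (X_pbracket fr hW h₁ h₂' hu hu').trans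
      (Eq.trans ?_ (X_pbracket fr hW h₁ h₂ hu hu').symm)
    rw [ρ₁.D_congr eX, eX.eq_of_nhds, ρ₂'.D_eq_prolongDeriv, ρ₂.D_eq_prolongDeriv, h u hu]
  · refine (P_pbracket fr hW h₁ h₂' hu hu').trans
      (Eq.trans ?_ (P_pbracket fr hW h₁ h₂ hu hu').symm)
    rw [ρ₁.D_congr eP, ρ₂'.D_eq_prolongDeriv, ρ₂.D_eq_prolongDeriv, h u hu]

omit h₂ in
theorem pbracket_zero {u : Dual F E} (hu : u ∈ W) (h : ∀ y ∈ W, ρ₂ y = 0) :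
    pbracket ρ₁ ρ₂ u = 0 := by
  have hz : PSec.SmoothOn (fun _ => 0 : PSec A) W :=
    (h₁.lin hW h₁ 0 0).congr fun y _ => by simp
  obtain ⟨fr⟩ := exists_localFrame (EB := EB) (F := F) (E := E) u.proj
  have hu' : u ∈ fr.ddom := fr.mem_dom
  have hX : PSec.X (A := A) u.proj (fun _ => 0) = fun _ => 0 := funext fun y => map_zero _
  have hP : PSec.P (A := A) u.proj (fun _ => 0) = fun _ => 0 := funext fun y => map_zero _
  rw [pbracket_congr hW h₁ hz h hu]
  refine prolong_ext (fr.mem_chartDom hu') ?_ ?_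
  · refine (X_pbracket fr hW h₁ hz hu hu').trans ?_
    rw [PSec.D_eq_prolongDeriv (fun _ => 0), map_zero, hX, map_zero, map_zero, sub_zero, zero_add]
    exact der_const _ _ _
  · refine (P_pbracket fr hW h₁ hz hu hu').trans ?_
    rw [PSec.D_eq_prolongDeriv (fun _ => 0), map_zero, hP, map_zero, sub_zero]
    exact der_const _ _ _

theorem symplectic_add_left {σ τ : PSec A} (hσ : σ.SmoothOn W) (hτ : τ.SmoothOn W) {u : Dual F E}
    (hu : u ∈ W) (h : σ u = ρ₁ u + ρ₂ u) :
    symplectic σ τ u = symplectic ρ₁ τ u + symplectic ρ₂ τ u := by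
  obtain ⟨fr⟩ := exists_localFrame (EB := EB) (F := F) (E := E) u.proj
  have hu' : u ∈ fr.ddom := fr.mem_dom
  have hX : σ.X u.proj u = ρ₁.X u.proj u + ρ₂.X u.proj u :=
    (congrArg (crdX u.proj u) h).trans (map_add _ _ _)
  have hP : σ.P u.proj u = ρ₁.P u.proj u + ρ₂.P u.proj u :=
    (congrArg (crdP u.proj u) h).trans (map_add _ _ _)
  rw [symplectic_eq fr hW hσ hτ hu hu', symplectic_eq fr hW h₁ hτ hu hu',
    symplectic_eq fr hW h₂ hτ hu hu', hX, hP]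
  simp only [map_add, add_apply]
  ring

theorem symplectic_congr_neg {σ : PSec A} (hσ : σ.SmoothOn W) {u : Dual F E}
    (hu : u ∈ W) (h : σ u = -ρ₁ u) : symplectic σ ρ₂ u = -symplectic ρ₁ ρ₂ u := by
  obtain ⟨fr⟩ := exists_localFrame (EB := EB) (F := F) (E := E) u.proj
  have hu' : u ∈ fr.ddom := fr.mem_dom
  have hX : σ.X u.proj u = -ρ₁.X u.proj u :=
    (congrArg (crdX u.proj u) h).trans (map_neg _ _)
  have hP : σ.P u.proj u = -ρ₁.P u.proj u :=
    (congrArg (crdP u.proj u) h).trans (map_neg _ _)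
  rw [symplectic_eq fr hW hσ h₂ hu hu', symplectic_eq fr hW h₁ h₂ hu hu', hX, hP]
  simp only [map_neg, neg_apply]
  ring

end Algebra

variable {H : Dual F E → ℝ} (hH : ContMDiffOn (dualModel EB F) 𝓘(ℝ, ℝ) ∞ H W)
  (hreg : RegularOn H W) {ρ : PSec A} (hρ : IsHamiltonSection H W ρ)
  {J : PEnd A} (hJ : IsInducedTangentStructure H W J)

include hW hρ in
/-- The flow of the Hamilton section preserves the symplectic section. -/
theorem act_symplectic (hH : ContMDiffOn (dualModel EB F) 𝓘(ℝ, ℝ) ∞ H W) {σ τ : PSec A}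
    (hσ : σ.SmoothOn W) (hτ : τ.SmoothOn W) {u : Dual F E} (hu : u ∈ W) :
    ρ.act (symplectic σ τ) u =
      symplectic (pbracket ρ σ) τ u + symplectic σ (pbracket ρ τ) u := by
  -- In the closedness identity for `ρ, σ, τ`, every term that pairs `ρ` itself with another section
  -- is an action on `H`. These terms add up to the commutator of `σ` and `τ` on `H` minus the
  -- action of their bracket, hence to zero.
  have hc := symplectic_closed hW hρ.1 hσ hτ hu
  have e1 : σ.act (symplectic τ ρ) u = -σ.D (τ.D H) u := by
    have e : symplectic τ ρ =ᶠ[𝓝 u] fun y => -τ.D H y := by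
      filter_upwards [hW.mem_nhds hu] with y hy
      rw [symplectic_skew hW hτ hρ.1 hy, hρ.2 τ hτ y hy]
      rfl
    exact (der_congr (V := σ.field) rfl e).trans
      (der_neg (contMDiff_toMDiff hW (PSec.D_smooth hW hτ hH) hu))
  have e2 : τ.act (symplectic ρ σ) u = τ.D (σ.D H) u := by
    refine der_congr (V := τ.field) rfl ?_
    filter_upwards [hW.mem_nhds hu] with y hy
    exact hρ.2 σ hσ y hy
  have e3 : symplectic (pbracket σ τ) ρ u = -(σ.D (τ.D H) u - τ.D (σ.D H) u) := by
    rw [symplectic_skew hW (pbracket_smooth hW hσ hτ) hρ.1 hu,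
      hρ.2 _ (pbracket_smooth hW hσ hτ) u hu, ← D_pbracket hW hσ hτ hW hH hu hu]
    rfl
  have e4 : symplectic (pbracket τ ρ) σ u = symplectic σ (pbracket ρ τ) u := by
    rw [symplectic_congr_neg hW (pbracket_smooth hW hρ.1 hτ) hσ (pbracket_smooth hW hτ hρ.1) hu
      (pbracket_skew hW hτ hρ.1 hu), symplectic_skew hW hσ (pbracket_smooth hW hρ.1 hτ) hu]
  rw [e1, e2, e3, e4] at hc
  linarith

include hW hJ in
theorem crdX_tangent {u : Dual F E} (hu : u ∈ W) (hu' : u ∈ fr.ddom) (p : Prolong A u) :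
    crdX x₀ u (J u p) = 0 :=
  (mem_vertical_iff fr hu').1 (by rw [← hJ.range_eq u hu]; exact ⟨p, rfl⟩)

include hW hJ hH

/-- As `J` is onto the vertical subspace, `b` is the momentum of some `J ν'`. The condition `g(J ν',
J ν) = -ω(J ν', ν)` then reads `Hess(b, P(J ν)) = b(X(ν))`, so any admissible `J` is the one built
above. -/
theorem hess_tangent {u : Dual F E} (hu : u ∈ W) (hu' : u ∈ fr.ddom) (p : Prolong A u)
    (b : F →L[ℝ] ℝ) : fr.hess A H u (crdP x₀ u (J u p)) b = b (crdX x₀ u p) := by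
  obtain ⟨ν, hν, rfl⟩ := exists_smooth_through p
  have hb := fr.ext_vertical (A := A) b u
  rw [← hJ.range_eq u hu] at hb
  obtain ⟨q, hq⟩ := hb
  obtain ⟨ν', hν', rfl⟩ := exists_smooth_through q
  have hq' : (J.app ν').P x₀ u = b := (congrArg (crdP x₀ u) hq).trans (fr.ext_P _ _ hu')
  have hm := hJ.metric ν' ν (hν' W) (hν W) u hu
  rw [symplectic_eq fr hW (hJ.smooth ν' (hν' W)) (hν W) hu hu', fr.vmetric_eq hW hH hu hu'
      (by rw [← hJ.range_eq u hu]; exact ⟨ν' u, rfl⟩)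
      (by rw [← hJ.range_eq u hu]; exact ⟨ν u, rfl⟩),
    show (J.app ν').X x₀ u = 0 from crdX_tangent fr hW hJ hu hu' _, hq', map_zero, map_zero,
    zero_apply, map_zero, zero_sub, add_zero, neg_neg, fr.hess_symm hW hH hu hu'] at hm
  exact hm

omit hJ
include hρ

theorem hamiltonSection_X {u : Dual F E} (hu : u ∈ W) (hu' : u ∈ fr.ddom) (b : F →L[ℝ] ℝ) :
    b (ρ.X x₀ u) = fr.dP A H u b := by
  rw [((fr.symplectic_eq_act_iff hW hρ.1 hu hu').1 fun ν hν => hρ.2 ν hν u hu).1, fr.apply_hamX]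

/-- The `F`-component of `ρ` is the fibre derivative of `H`, so differentiating it once more along
the fibre yields the Hessian. -/
theorem vertical_deriv_hamiltonSection {u : Dual F E} (hu : u ∈ W) (hu' : u ∈ fr.ddom)
    {V : PSec A} (hV : V u ∈ vertical A u) (b : F →L[ℝ] ℝ) :
    b (V.D (ρ.X x₀) u) = fr.hess A H u (V.P x₀ u) b := by
  have hO := hW.inter fr.isOpen_ddom
  have e1 : V.D (fun y => b (ρ.X x₀ y)) u = b (V.D (ρ.X x₀) u) :=
    der_clm b (hρ.1.X_mdiff fr hW hu hu')
  have e2 : V.D (fun y => fr.dP A H y b) u = V.D (fr.dP A H) u b :=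
    der_apply_const b (contMDiff_toMDiff hO (fr.dP_smooth hW hH) ⟨hu, hu'⟩)
  have e3 : V.D (fun y => b (ρ.X x₀ y)) u = V.D (fun y => fr.dP A H y b) u := by
    refine V.D_congr ?_
    filter_upwards [hO.mem_nhds ⟨hu, hu'⟩] with y hy
    exact hamiltonSection_X fr hW hH hρ hy.1 hy.2 b
  rw [← e1, e3, e2, fr.D_eq V _ hu', show V.X x₀ u = 0 from (mem_vertical_iff fr hu').1 hV,
    map_zero, zero_add]
  rfl

include hJ

/-- Analogue of the semispray property `J[ρ, Jν] = -Jν`: as `Jν` is vertical, only the derivative of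
`X(ρ)` along `Jν` remains, and its Hessian expression is inverted by `J`. -/
theorem X_pbracket_tangent {ν : PSec A} (hν : ν.SmoothOn W) {u : Dual F E} (hu : u ∈ W)
    (hu' : u ∈ fr.ddom) : (pbracket ρ (J.app ν)).X x₀ u = -ν.X x₀ u := by
  have hz : ∀ y ∈ W ∩ fr.ddom, (J.app ν).X x₀ y = 0 :=
    fun y hy => crdX_tangent fr hW hJ hy.1 hy.2 _
  have e : ρ.D ((J.app ν).X x₀) u = 0 := by
    refine (PSec.D_congr _ (g := fun _ => 0) ?_).trans (der_const _ _ _)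
    filter_upwards [(hW.inter fr.isOpen_ddom).mem_nhds ⟨hu, hu'⟩] with y hy
    exact hz y hy
  rw [X_pbracket fr hW hρ.1 (hJ.smooth ν hν) hu hu', hz u ⟨hu, hu'⟩, e, map_zero, zero_add,
    zero_sub]
  congr 1
  apply (bidual F).injective
  ext b
  rw [bidual_apply, bidual_apply, vertical_deriv_hamiltonSection fr hW hH hρ hu hu'
    (by rw [← hJ.range_eq u hu]; exact ⟨ν u, rfl⟩)]
  exact hess_tangent fr hW hH hJ hu hu' (ν u) b

theorem X_lieDerivEnd {ν : PSec A} (hν : ν.SmoothOn W) {u : Dual F E} (hu : u ∈ W)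
    (hu' : u ∈ fr.ddom) : (lieDerivEnd ρ J ν).X x₀ u = -ν.X x₀ u := by
  rw [← X_pbracket_tangent fr hW hH hρ hJ hν hu hu']
  refine (map_sub (crdX x₀ u) _ _).trans ?_
  rw [show crdX x₀ u ((J.app (pbracket ρ ν)) u) = 0 from crdX_tangent fr hW hJ hu hu' _, sub_zero]
  rfl

omit hH hJ in
variable (ρ J) (H) in
/-- The image by the fibre Hessian of the momentum component of `-L_ρ J`. -/
def lieDerivForm (u : Dual F E) : Prolong A u →ₗ[ℝ] (F →L[ℝ] ℝ) →L[ℝ] ℝ :=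
  (ρ.D (fr.hess A H) u).toLinearMap ∘ₗ crdP x₀ u ∘ₗ J u +
    (fr.hess A H u).toLinearMap ∘ₗ prolongDeriv A (ρ.P x₀) u ∘ₗ J u +
    (bidual F).toLinearMap ∘ₗ ((fr.str A u.proj (ρ.X x₀ u)).toLinearMap ∘ₗ crdX x₀ u -
      prolongDeriv A (ρ.X x₀) u)

/-- Differentiating `Hess(P(Jν), ·) = X(ν)` along `ρ` rewrites the derivative of `P(Jν)`. The
derivative of `X(ν)` so produced cancels the one in `J[ρ, ν]`, and the remaining expression depends
only on the value of `ν` at `u`. -/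
theorem hess_lieDerivEnd {ν : PSec A} (hν : ν.SmoothOn W) {u : Dual F E} (hu : u ∈ W)
    (hu' : u ∈ fr.ddom) :
    fr.hess A H u ((lieDerivEnd ρ J ν).P x₀ u) = -lieDerivForm fr H ρ J u (ν u) := by
  have hO := hW.inter fr.isOpen_ddom
  have hJν := hJ.smooth ν hν
  have dh : MDifferentiableAt (dualModel EB F) 𝓘(ℝ, (F →L[ℝ] ℝ) →L[ℝ] (F →L[ℝ] ℝ) →L[ℝ] ℝ)
      (fr.hess A H) u := contMDiff_toMDiff hO (fr.hess_smooth hW hH) ⟨hu, hu'⟩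
  have dJ := hJν.P_mdiff fr hW hu hu'
  have dX := hν.X_mdiff fr hW hu hu'
  have e1 : ρ.D (fun y => fr.hess A H y ((J.app ν).P x₀ y)) u =
      ρ.D (fr.hess A H) u ((J.app ν).P x₀ u) + fr.hess A H u (ρ.D ((J.app ν).P x₀) u) :=
    der_clm_apply dh dJ
  have e2 : ρ.D (fun y => bidual F (ν.X x₀ y)) u = bidual F (ρ.D (ν.X x₀) u) :=
    der_clm (bidual F : F →L[ℝ] ((F →L[ℝ] ℝ) →L[ℝ] ℝ)) dX
  have e3 : ρ.D (fun y => fr.hess A H y ((J.app ν).P x₀ y)) u =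
      ρ.D (fun y => bidual F (ν.X x₀ y)) u := by
    refine ρ.D_congr ?_
    filter_upwards [hO.mem_nhds ⟨hu, hu'⟩] with y hy
    ext b
    exact hess_tangent fr hW hH hJ hy.1 hy.2 (ν y) b
  have e4 : fr.hess A H u (crdP x₀ u (J u (pbracket ρ ν u))) =
      bidual F ((pbracket ρ ν).X x₀ u) := by
    ext b
    exact hess_tangent fr hW hH hJ hu hu' _ b
  have e5 : (lieDerivEnd ρ J ν).P x₀ u =
      (pbracket ρ (J.app ν)).P x₀ u - crdP x₀ u (J u (pbracket ρ ν u)) :=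
    map_sub (crdP x₀ u) _ _
  have e6 : fr.hess A H u (ρ.D ((J.app ν).P x₀) u) =
      bidual F (ρ.D (ν.X x₀) u) - ρ.D (fr.hess A H) u ((J.app ν).P x₀ u) := by
    rw [← e2, ← e3, e1]
    abel
  have e7 : lieDerivForm fr H ρ J u (ν u) = ρ.D (fr.hess A H) u ((J.app ν).P x₀ u) +
      fr.hess A H u ((J.app ν).D (ρ.P x₀) u) +
      bidual F (fr.str A u.proj (ρ.X x₀ u) (ν.X x₀ u) - ν.D (ρ.X x₀) u) := rfl
  rw [e5, map_sub, e4, P_pbracket fr hW hρ.1 hJν hu hu', map_sub, e6,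
    X_pbracket fr hW hρ.1 hν hu hu', e7, map_sub, map_sub, map_add]
  abel

/-- For vertical `ν(u)` every term of `lieDerivForm` vanishes except `-ν(X(ρ))`, and that derivative
is `Hess(P(ν), ·)`; injectivity of the Hessian concludes. -/
theorem lieDerivEnd_vertical (hreg : RegularOn H W) {ν : PSec A} (hν : ν.SmoothOn W)
    {u : Dual F E} (hu : u ∈ W) (hv : ν u ∈ vertical A u) :
    lieDerivEnd ρ J ν u = ν u := by
  obtain ⟨fr⟩ := exists_localFrame (EB := EB) (F := F) (E := E) u.proj
  have hu' : u ∈ fr.ddom := fr.mem_dom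
  have hX : ν.X u.proj u = 0 := (mem_vertical_iff fr hu').1 hv
  have hJ0 : J u (ν u) = 0 := by
    rw [← LinearMap.mem_ker, hJ.ker_eq u hu]
    exact hv
  refine prolong_ext (fr.mem_chartDom hu') ?_ ?_
  · refine (X_lieDerivEnd fr hW hH hρ hJ hν hu hu').trans ?_
    rw [hX, neg_zero]
    exact hX.symm
  · apply fr.hess_injective (A := A) hW hH hreg hu hu'
    refine (hess_lieDerivEnd fr hW hH hρ hJ hν hu hu').trans ?_
    ext b
    have e : lieDerivForm fr H ρ J u (ν u) =
        ρ.D (fr.hess A H) u (crdP u.proj u (J u (ν u))) +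
        fr.hess A H u (prolongDeriv A (ρ.P u.proj) u (J u (ν u))) +
        bidual F (fr.str A u.proj (ρ.X u.proj u) (ν.X u.proj u) - ν.D (ρ.X u.proj) u) := rfl
    rw [e, hJ0, hX]
    simp only [map_zero, zero_add, zero_sub, map_neg, neg_neg]
    exact vertical_deriv_hamiltonSection fr hW hH hρ hu hu' hv b

/-- Both coordinates of `L_ρ J ν` at `u` are linear in `ν(u)`, so the operator on sections comes
from endomorphisms of the fibres. -/
theorem exists_lieDerivEnd_tensor (hreg : RegularOn H W) : ∃ N : PEnd A, ∀ ν : PSec A,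
    ν.SmoothOn W → ∀ u ∈ W, N u (ν u) = -lieDerivEnd ρ J ν u := by
  have h : ∀ u : Dual F E, ∃ L : Prolong A u →ₗ[ℝ] Prolong A u, ∀ ν : PSec A,
      ν.SmoothOn W → u ∈ W → L (ν u) = -lieDerivEnd ρ J ν u := by
    intro u
    obtain ⟨fr⟩ := exists_localFrame (EB := EB) (F := F) (E := E) u.proj
    have hu' : u ∈ fr.ddom := fr.mem_dom
    refine ⟨fr.ofCrd A u ∘ₗ (crdX u.proj u).prod
      ((fr.hess A H u).inverse.toLinearMap ∘ₗ lieDerivForm fr H ρ J u), fun ν hν hu => ?_⟩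
    obtain ⟨e, he⟩ := fr.exists_hess_equiv (A := A) hW hH hreg hu hu'
    refine (fr.ofCrd_apply hu' _ _).trans ?_
    refine prolong_ext (fr.mem_chartDom hu') ?_ ?_
    · refine (fr.ext_X _ _ hu').trans ?_
      rw [map_neg, show crdX u.proj u (lieDerivEnd ρ J ν u) = _ from
        X_lieDerivEnd fr hW hH hρ hJ hν hu hu', neg_neg]
      rfl
    · refine (fr.ext_P _ _ hu').trans ?_
      apply e.injective
      have e1 := hess_lieDerivEnd fr hW hH hρ hJ hν hu hu'
      rw [← he] at e1
      rw [map_neg, map_neg]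
      refine Eq.trans ?_ ((neg_eq_iff_eq_neg.2 e1).symm)
      rw [← he, ContinuousLinearMap.inverse_equiv]
      exact e.apply_symm_apply _
  choose N hN using h
  exact ⟨N, fun ν hν u hu => hN u ν hν hu⟩

end Connection

/-! ### The nonlinear connection and its metricity. -/

section Metric

variable {EB : Type uB} [NormedAddCommGroup EB] [NormedSpace ℝ EB]
  {F : Type uF} [NormedAddCommGroup F] [NormedSpace ℝ F]
  {M : Type uM} [TopologicalSpace M] [ChartedSpace EB M]
  [IsManifold 𝓘(ℝ, EB) ∞ M]
  {E : M → Type uE} [TopologicalSpace (TotalSpace F E)]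
  [∀ x, AddCommGroup (E x)] [∀ x, Module ℝ (E x)] [∀ x, TopologicalSpace (E x)]
  [∀ x, IsTopologicalAddGroup (E x)] [∀ x, ContinuousSMul ℝ (E x)]
  [FiberBundle F E] [VectorBundle ℝ F E] [ContMDiffVectorBundle ∞ F E 𝓘(ℝ, EB)]
  {A : LieAlgebroid EB F E}
  [FiniteDimensional ℝ EB] [T2Space M] [FiniteDimensional ℝ F]
  {x₀ : M} (fr : LocalFrame EB F E x₀)
  {W : Set (Dual F E)} (hW : IsOpen W)

  {H : Dual F E → ℝ} (hH : ContMDiffOn (dualModel EB F) 𝓘(ℝ, ℝ) ∞ H W)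
  (hreg : RegularOn H W) {ρ : PSec A} (hρ : IsHamiltonSection H W ρ)
  {J : PEnd A} (hJ : IsInducedTangentStructure H W J)

include hW hH hJ in
-- A form of the metric condition whose first argument need not be presented as `J` of a smooth
-- section, and whose second agrees with `J ν` at `u` only.
theorem vmetric_tangent {V τ ν : PSec A} (hV : V.SmoothOn W) (hν : ν.SmoothOn W) {u : Dual F E}
    (hu : u ∈ W) (hVu : V u ∈ vertical A u) (hτ : τ u = J u (ν u)) :
    vmetric H V τ u = -symplectic V ν u := by
  obtain ⟨fr⟩ := exists_localFrame (EB := EB) (F := F) (E := E) u.proj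
  have hu' : u ∈ fr.ddom := fr.mem_dom
  have hτv : τ u ∈ vertical A u := by rw [hτ, ← hJ.range_eq u hu]; exact ⟨_, rfl⟩
  have e := hess_tangent fr hW hH hJ hu hu' (ν u) (V.P u.proj u)
  rw [symplectic_eq fr hW hV hν hu hu', fr.vmetric_eq hW hH hu hu' hVu hτv,
    show V.X u.proj u = 0 from (mem_vertical_iff fr hu').1 hVu, map_zero, map_zero, zero_apply,
    map_zero, zero_sub, add_zero, neg_neg, fr.hess_symm hW hH hu hu',
    show τ.P u.proj u = crdP u.proj u (J u (ν u)) from congrArg (crdP u.proj u) hτ, e]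
  rfl

include hW hH in
theorem vmetric_symm {V τ : PSec A} {u : Dual F E} (hu : u ∈ W) (hV : V u ∈ vertical A u)
    (hτ : τ u ∈ vertical A u) : vmetric H V τ u = vmetric H τ V u := by
  obtain ⟨fr⟩ := exists_localFrame (EB := EB) (F := F) (E := E) u.proj
  have hu' : u ∈ fr.ddom := fr.mem_dom
  rw [fr.vmetric_eq hW hH hu hu' hV hτ, fr.vmetric_eq hW hH hu hu' hτ hV,
    fr.hess_symm hW hH hu hu']

variable {N : PEnd A}
  (hN : ∀ ν : PSec A, ν.SmoothOn W → ∀ u ∈ W, N u (ν u) = -lieDerivEnd ρ J ν u)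

include hW hH hρ hJ hN

theorem crdX_connection {u : Dual F E} (hu : u ∈ W) (hu' : u ∈ fr.ddom) (p : Prolong A u) :
    crdX x₀ u (N u p) = crdX x₀ u p := by
  obtain ⟨ν, hν, rfl⟩ := exists_smooth_through p
  rw [hN ν (hν W) u hu, map_neg, show crdX x₀ u (lieDerivEnd ρ J ν u) = _ from
    X_lieDerivEnd fr hW hH hρ hJ (hν W) hu hu', neg_neg]
  rfl

include hreg

theorem connection_vertical {u : Dual F E} (hu : u ∈ W) {p : Prolong A u}
    (hp : p ∈ vertical A u) : N u p = -p := by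
  obtain ⟨ν, hν, rfl⟩ := exists_smooth_through p
  rw [hN ν (hν W) u hu, lieDerivEnd_vertical hW hH hρ hJ hreg (hν W) hu hp]

theorem connection_sub_mem {u : Dual F E} (hu : u ∈ W) (p : Prolong A u) :
    N u p - p ∈ vertical A u := by
  obtain ⟨fr⟩ := exists_localFrame (EB := EB) (F := F) (E := E) u.proj
  rw [mem_vertical_iff fr fr.mem_dom, map_sub, crdX_connection fr hW hH hρ hJ hN hu fr.mem_dom,
    sub_self]

/-- `N p - p` is vertical, so `N` maps it to its opposite. -/
theorem connection_connection {u : Dual F E} (hu : u ∈ W) (p : Prolong A u) :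
    N u (N u p) = p := by
  have h := connection_vertical hW hH hreg hρ hJ hN hu
    (connection_sub_mem hW hH hreg hρ hJ hN hu p)
  rw [map_sub] at h
  have := sub_eq_iff_eq_add.1 h
  rw [this]
  abel

omit hH hreg in
theorem lieDerivEnd_smooth {ν : PSec A} (hν : ν.SmoothOn W) : (lieDerivEnd ρ J ν).SmoothOn W :=
  ((pbracket_smooth hW hρ.1 (hJ.smooth ν hν)).lin hW
    (hJ.smooth _ (pbracket_smooth hW hρ.1 hν)) 1 (-1)).congr fun u _ => by
      rw [one_smul, neg_one_smul, ← sub_eq_add_neg]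
      rfl

omit hH hreg in
theorem connection_smooth : N.SmoothOn W := fun ν hν =>
  ((lieDerivEnd_smooth hW hρ hJ hN hν).lin hW hν (-1) 0).congr fun u hu => by
    rw [neg_one_smul, zero_smul, add_zero]
    exact hN ν hν u hu

theorem isNonlinearConnection : IsNonlinearConnection W N := by
  refine ⟨connection_smooth hW hρ hJ hN, fun u hu => ?_, fun u hu => ?_⟩
  · exact LinearMap.ext fun p => connection_connection hW hH hreg hρ hJ hN hu p
  · ext p
    rw [LinearMap.mem_ker, LinearMap.add_apply, LinearMap.id_apply]
    constructor
    · intro h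
      obtain ⟨fr⟩ := exists_localFrame (EB := EB) (F := F) (E := E) u.proj
      rw [mem_vertical_iff fr fr.mem_dom]
      have := congrArg (crdX u.proj u) h
      rw [map_add, crdX_connection fr hW hH hρ hJ hN hu fr.mem_dom, map_zero, ← two_smul ℝ] at this
      exact (smul_eq_zero.1 this).resolve_left two_ne_zero
    · intro h
      rw [connection_vertical hW hH hreg hρ hJ hN hu h, add_neg_cancel]

omit hH hreg hρ hJ hN in
theorem symplectic_smooth {σ τ : PSec A} (hσ : σ.SmoothOn W) (hτ : τ.SmoothOn W) :
    ContMDiffOn (dualModel EB F) 𝓘(ℝ, ℝ) ∞ (symplectic σ τ) W :=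
  (((PSec.D_smooth hW hσ (liouville_smooth hτ)).sub
    (PSec.D_smooth hW hτ (liouville_smooth hσ))).sub
      (liouville_smooth (pbracket_smooth hW hσ hτ))).neg

theorem dynCov_vertical {X : PSec A} (hX : X.SmoothOn W) (hXv : X.VerticalOn W) {u : Dual F E}
    (hu : u ∈ W) : dynCov ρ N X u = vproj N u (pbracket ρ X u) := by
  have e1 : ∀ y ∈ W, (hproj N).app X y = 0 := fun y hy => by
    change (1 / 2 : ℝ) • (X y + N y (X y)) = 0
    rw [connection_vertical hW hH hreg hρ hJ hN hy (hXv y hy), add_neg_cancel, smul_zero]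
  have e2 : ∀ y ∈ W, (vproj N).app X y = X y := fun y hy => by
    change (1 / 2 : ℝ) • (X y - N y (X y)) = X y
    rw [connection_vertical hW hH hreg hρ hJ hN hy (hXv y hy), sub_neg_eq_add, ← two_smul ℝ,
      smul_smul]
    norm_num
  change hproj N u (pbracket ρ ((hproj N).app X) u) +
    vproj N u (pbracket ρ ((vproj N).app X) u) = _
  rw [pbracket_zero hW hρ.1 hu e1, map_zero, zero_add, pbracket_congr hW hρ.1 hX e2 hu]

/-- A vertical section `X` is the image by `J` of the horizontal section `-h [ρ, X]`, and the
dynamical covariant derivative of `X` is `J [ρ, -h [ρ, X]]`. -/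
theorem exists_horizontal_lift {X : PSec A} (hX : X.SmoothOn W) (hXv : X.VerticalOn W) :
    ∃ ν : PSec A, ν.SmoothOn W ∧ ∀ u ∈ W, X u = J u (ν u) ∧
      dynCov ρ N X u = pbracket ρ X u + ν u ∧ dynCov ρ N X u = J u (pbracket ρ ν u) := by
  have hb := pbracket_smooth hW hρ.1 hX
  have hNs := connection_smooth hW hρ hJ hN
  -- This is `-h[ρ, X]` with the projector written out.
  obtain ⟨ν, hν⟩ : ∃ ν : PSec A, ν = fun u => (-(1 / 2) : ℝ) • pbracket ρ X u +
    (-(1 / 2) : ℝ) • N u (pbracket ρ X u) := ⟨_, rfl⟩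
  have hνs : ν.SmoothOn W := by
    rw [hν]
    exact hb.lin hW (hNs _ hb) _ _
  have hJX : ∀ y ∈ W, J.app X y = 0 := fun y hy => by
    have : X y ∈ LinearMap.ker (J y) := by rw [hJ.ker_eq y hy]; exact hXv y hy
    exact this
  -- `L_ρ J` is the identity on the vertical `X`, while `J X = 0`.
  have hJb : ∀ u ∈ W, J u (pbracket ρ X u) = -X u := by
    intro u hu
    have h := lieDerivEnd_vertical hW hH hρ hJ hreg hX hu (hXv u hu)
    have h' : pbracket ρ (J.app X) u - J u (pbracket ρ X u) = X u := h
    rw [pbracket_zero hW hρ.1 hu hJX, zero_sub] at h'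
    rw [← h', neg_neg]
  have hJν : ∀ u ∈ W, J u (ν u) = X u := by
    intro u hu
    have h0 : J u (N u (pbracket ρ X u)) = J u (pbracket ρ X u) := by
      have h := connection_sub_mem hW hH hreg hρ hJ hN hu (pbracket ρ X u)
      rw [← hJ.ker_eq u hu, LinearMap.mem_ker, map_sub] at h
      exact sub_eq_zero.1 h
    rw [hν, map_add, map_smul, map_smul, h0, hJb u hu, smul_neg, ← neg_smul, ← add_smul]
    norm_num
  refine ⟨ν, hνs, fun u hu => ⟨(hJν u hu).symm, ?_⟩⟩
  have e1 : dynCov ρ N X u = pbracket ρ X u + ν u := by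
    rw [dynCov_vertical hW hH hreg hρ hJ hN hX hXv hu, hν]
    change (1 / 2 : ℝ) • (pbracket ρ X u - N u (pbracket ρ X u)) = _
    module
  refine ⟨e1, ?_⟩
  have e2 : N u (ν u) = ν u := by
    rw [hν, map_add, map_smul, map_smul, connection_connection hW hH hreg hρ hJ hN hu, add_comm]
  -- As `ν` is horizontal and `J ν = X`, this becomes `J[ρ, ν] = [ρ, X] + ν`, the dynamical
  -- covariant derivative of `X`.
  have e3 : -(pbracket ρ (J.app ν) u - J u (pbracket ρ ν u)) = N u (ν u) := (hN ν hνs u hu).symm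
  have e4 : pbracket ρ (J.app ν) u = pbracket ρ X u := pbracket_congr hW hρ.1 hX hJν hu
  rw [e4, e2] at e3
  rw [e1, ← e3]
  abel

/-- All three terms are rewritten through `ω`; invariance of `ω` along `ρ` cancels everything except
the `ν₁` in `∇X = [ρ, X] + ν₁`. -/
theorem dynCovMetric_eq {X Y ν₁ ν₂ : PSec A} (hX : X.SmoothOn W) (hXv : X.VerticalOn W)
    (h₁ : ν₁.SmoothOn W) (h₂ : ν₂.SmoothOn W)
    (hX₁ : ∀ u ∈ W, dynCov ρ N X u = pbracket ρ X u + ν₁ u)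
    (hX₁' : ∀ u ∈ W, dynCov ρ N X u = J u (pbracket ρ ν₁ u))
    (hY₂ : ∀ u ∈ W, Y u = J u (ν₂ u))
    (hY₂' : ∀ u ∈ W, dynCov ρ N Y u = J u (pbracket ρ ν₂ u)) {u : Dual F E} (hu : u ∈ W) :
    dynCovMetric H ρ N X Y u = symplectic ν₁ ν₂ u := by
  have hb := pbracket_smooth hW hρ.1 hX
  have hb₁ := pbracket_smooth hW hρ.1 h₁
  have hb₂ := pbracket_smooth hW hρ.1 h₂
  have hD : (dynCov ρ N X).SmoothOn W := (hJ.smooth _ hb₁).congr hX₁'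
  have hDv : dynCov ρ N X u ∈ vertical A u := by
    rw [hX₁' u hu, ← hJ.range_eq u hu]
    exact ⟨_, rfl⟩
  have e1 : ρ.act (vmetric H X Y) u = -ρ.act (symplectic X ν₂) u := by
    have e : vmetric H X Y =ᶠ[𝓝 u] fun y => -symplectic X ν₂ y := by
      filter_upwards [hW.mem_nhds hu] with y hy
      exact vmetric_tangent hW hH hJ hX h₂ hy (hXv y hy) (hY₂ y hy)
    have hs : MDifferentiableAt (dualModel EB F) 𝓘(ℝ, ℝ) (symplectic X ν₂) u :=
      contMDiff_toMDiff hW (symplectic_smooth hW hX h₂) hu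
    exact (der_congr (V := ρ.field) rfl e).trans (der_neg hs)
  have e2 : vmetric H (dynCov ρ N X) Y u =
      -(symplectic (pbracket ρ X) ν₂ u + symplectic ν₁ ν₂ u) := by
    rw [vmetric_tangent hW hH hJ hD h₂ hu hDv (hY₂ u hu),
      symplectic_add_left hW hb h₁ hD h₂ hu (hX₁ u hu)]
  have e3 : vmetric H X (dynCov ρ N Y) u = -symplectic X (pbracket ρ ν₂) u :=
    vmetric_tangent hW hH hJ hX hb₂ hu (hXv u hu) (hY₂' u hu)
  unfold dynCovMetric
  rw [e1, e2, e3, act_symplectic hW hρ hH hX h₂ hu]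
  ring

/-- `∇g` is symmetric because the Hessian is, but equals `ω(ν₁, ν₂)`, which changes sign when `X`
and `Y` are exchanged. In particular the horizontal lifts are `ω`-orthogonal. -/
theorem dynCovMetric_eq_zero {X Y : PSec A} (hX : X.SmoothOn W) (hY : Y.SmoothOn W)
    (hXv : X.VerticalOn W) (hYv : Y.VerticalOn W) {u : Dual F E} (hu : u ∈ W) :
    dynCovMetric H ρ N X Y u = 0 := by
  obtain ⟨ν₁, h₁, k₁⟩ := exists_horizontal_lift hW hH hreg hρ hJ hN hX hXv
  obtain ⟨ν₂, h₂, k₂⟩ := exists_horizontal_lift hW hH hreg hρ hJ hN hY hYv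
  have e1 := dynCovMetric_eq hW hH hreg hρ hJ hN hX hXv h₁ h₂ (fun u hu => (k₁ u hu).2.1)
    (fun u hu => (k₁ u hu).2.2) (fun u hu => (k₂ u hu).1) (fun u hu => (k₂ u hu).2.2) hu
  have e2 := dynCovMetric_eq hW hH hreg hρ hJ hN hY hYv h₂ h₁ (fun u hu => (k₂ u hu).2.1)
    (fun u hu => (k₂ u hu).2.2) (fun u hu => (k₁ u hu).1) (fun u hu => (k₁ u hu).2.2) hu
  have e3 : dynCovMetric H ρ N X Y u = dynCovMetric H ρ N Y X u := by
    have s1 : ρ.act (vmetric H X Y) u = ρ.act (vmetric H Y X) u := by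
      refine der_congr (V := ρ.field) rfl ?_
      filter_upwards [hW.mem_nhds hu] with y hy
      exact vmetric_symm hW hH hy (hXv y hy) (hYv y hy)
    have v1 : dynCov ρ N X u ∈ vertical A u := by
      rw [(k₁ u hu).2.2, ← hJ.range_eq u hu]
      exact ⟨_, rfl⟩
    have v2 : dynCov ρ N Y u ∈ vertical A u := by
      rw [(k₂ u hu).2.2, ← hJ.range_eq u hu]
      exact ⟨_, rfl⟩
    unfold dynCovMetric
    rw [s1, vmetric_symm hW hH hu v1 (hYv u hu), vmetric_symm hW hH hu (hXv u hu) v2]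
    ring
  rw [symplectic_skew hW h₂ h₁ hu] at e2
  linarith

end Metric
end LieAlgd

end

theorem theorem1p6p2
    {EB : Type*} [NormedAddCommGroup EB] [NormedSpace ℝ EB] [FiniteDimensional ℝ EB]
    {F : Type*} [NormedAddCommGroup F] [NormedSpace ℝ F] [FiniteDimensional ℝ F]
    {M : Type*} [TopologicalSpace M] [T2Space M] [ChartedSpace EB M]
    [IsManifold 𝓘(ℝ, EB) ∞ M]
    (E : M → Type*) [TopologicalSpace (TotalSpace F E)]
    [∀ x, AddCommGroup (E x)] [∀ x, Module ℝ (E x)] [∀ x, TopologicalSpace (E x)]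
    [∀ x, IsTopologicalAddGroup (E x)] [∀ x, ContinuousSMul ℝ (E x)]
    [FiberBundle F E] [VectorBundle ℝ F E] [ContMDiffVectorBundle ∞ F E 𝓘(ℝ, EB)]
    (A : LieAlgd.LieAlgebroid EB F E)
    (W : Set (LieAlgd.Dual F E)) (hW : IsOpen W)
    (H : LieAlgd.Dual F E → ℝ)
    (hH : ContMDiffOn (LieAlgd.dualModel EB F) 𝓘(ℝ, ℝ) ∞ H W)
    (hreg : LieAlgd.RegularOn H W) :
    (∃ ρ : LieAlgd.PSec A, LieAlgd.IsHamiltonSection H W ρ) ∧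
    (∃ J : LieAlgd.PEnd A, LieAlgd.IsInducedTangentStructure H W J) ∧
    ∀ (ρ : LieAlgd.PSec A) (J : LieAlgd.PEnd A),
      LieAlgd.IsHamiltonSection H W ρ → LieAlgd.IsInducedTangentStructure H W J →
      ∃ N : LieAlgd.PEnd A,
        (∀ ν : LieAlgd.PSec A, ν.SmoothOn W → ∀ u ∈ W,
          N u (ν u) = -LieAlgd.lieDerivEnd ρ J ν u) ∧
        LieAlgd.IsNonlinearConnection W N ∧
        ∀ X Y : LieAlgd.PSec A, X.SmoothOn W → Y.SmoothOn W →
          X.VerticalOn W → Y.VerticalOn W →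
          ∀ u ∈ W, LieAlgd.dynCovMetric H ρ N X Y u = 0 := by
  refine ⟨LieAlgd.exists_hamiltonSection A hW hH,
    LieAlgd.exists_inducedTangentStructure A hW hH hreg, fun ρ J hρ hJ => ?_⟩
  obtain ⟨N, hN⟩ := LieAlgd.exists_lieDerivEnd_tensor hW hH hρ hJ hreg
  exact ⟨N, hN, LieAlgd.isNonlinearConnection hW hH hreg hρ hJ hN,
    fun X Y hX hY hXv hYv u hu =>
      LieAlgd.dynCovMetric_eq_zero hW hH hreg hρ hJ hN hX hY hXv hYv hu⟩
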